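/- Let $K$ be a field of characteristic zero and let $V$ be a finite-dimensional $K$-vector space with a nondegenerate bilinear form $\langle-,-\rangle$ that is symmetric or alternating. Let $\mathrm{GAut}(V)$ be the group of linear automorphisms of $V$ that preserve $\langle-,-\rangle$ up to a nonzero scalar, with Lie algebra $$\mathrm{Lie}\,\mathrm{GAut}(V)=\{X\in\mathrm{End}(V):\ \exists c\in K\ \forall v,w,\ \langle Xv,w\rangle+\langle v,Xw\rangle=c\langle v,w\rangle\},$$ and let $\phi\in\mathrm{GAut}(V)$. Let $\mathsf m\ge 0$ and let $A_0,\dots,A_{\mathsf m}$ be $K$-vector spaces, each equipped with a decreasing $\mathbf Z$-indexed filtration and a linear automorphism $\phi_j$; let $A_{\mathsf m}$ be equipped moreover with a bilinear form. Fix an integer $d\ge 0$. A self-dual filtration of $V$ is a decreasing filtration $V=F^0V\supseteq F^1V\supseteq\dots\supseteq F^dV\supseteq F^{d+1}V=0$ with $(F^pV)^\perp=F^{d+1-p}V$ for all $p$ (where $F^p V=V$ for $p\le 0$ and $F^pV=0$ for $p>d$). Fix one self-dual filtration $F_0$, and let $\mathcal H$ be the variety of all self-dual filtrations $F$ with $\dim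 F^pV=\dim F_0^pV$ for all $p$. Call $F\in\mathcal H(K)$ bad if there is a self-dual flag of subspaces $$0=\mathfrak f^0\subseteq\mathfrak f^1\subseteq\dots\subseteq\mathfrak f^{\mathsf m}\subseteq\mathfrak f^{\mathsf m+1}\subseteq\dots\subseteq\mathfrak f^{2\mathsf m+1}=V,\qquad (\mathfrak f^i)^\perp=\mathfrak f^{2\mathsf m+1-i},$$ (equalities being allowed) such that, with $\mathrm{gr}^j_{\mathfrak f}=\mathfrak f^{j+1}/\mathfrak f^j$ for $0\le j\le 2\mathsf m$, and with $\mathrm{gr}^j_{\mathfrak f}$ carrying the filtration induced by $F$, i.e. the images of the spaces $F^pV\cap\mathfrak f^{j+1}$: (a) every $\mathfrak f^i$ is $\phi$-stable; (b) for every $j$ with $W:=\mathrm{gr}^j_{\mathfrak f}\neq 0$, the weight $\frac{1}{\dim W}\sum_{p\ge 0}p\,\dim(F^pW/F^{p+1}W)$ of the induced filtration equals $d/2$; (c) for each $0\le j\le\mathsf m$ there is a linear isomorphism $\mathrm{gr}^j_{\mathfrak f}\simeq A_j$ that carries the induced filtration to that of $A_j$ and the automorphism induced by $\phi$ to $\phi_j$,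 and for the middle piece $j=\mathsf m$ it also carries the form induced by $\langle-,-\rangle$ to the form on $A_{\mathsf m}$. Let $F_0$ induce on $\mathrm{Lie}\,\mathrm{GAut}(V)$ the filtration whose $p$-th step is $\{X: X F_0^iV\subseteq F_0^{i+p}V\ \forall i\}$, and let $h^p=\dim\mathrm{gr}^p_{F_0}\mathrm{Lie}\,\mathrm{GAut}(V)$ for $p\in\mathbf Z$. The Hodge numbers are the integers $p$ with $h^p\ne 0$, each listed with multiplicity $h^p$. Let $T$ be the continuous piecewise linear function on $[0,\sum_p h^p]$ with $T(0)=0$ and slope $p$ on the interval $\left(\sum_{q>p}h^q,\ \sum_{q\ge p}h^q\right)$, so that for an integer $y$ the value $T(y)$ is the sum of the $y$ largest Hodge numbers. Let $z=\dim Z(\phi^{\mathrm{ss}})$ be the dimension of the centralizer in $\mathrm{GAut}(V)$ of the semisimple part of $\phi$. If $e$ is a positive integer such that $$\sum_{p>0}h^p\ \ge\ z+e\qquad\text{and}\qquad \sum_{p>0}p\,h^p\ >\ T(z+e)+T\!\left(\tfrac{h^0}{2}+z+e\right),$$ then the (Zariski closure of the) set of bad filtrations has codimension at least $e$ in $\mathcal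 H$. -/

import Mathlib

noncomputable section

namespace BadFil

section Dimension

/-- The coordinate ring of (the Zariski closure of) a subset `S` of a `K`-vector space `E`: the
`K`-algebra of functions `S → K` that are restrictions of polynomial functions on `E`. For
`E` finite-dimensional it is `K[E] / I(S)`, with `I(S)` the ideal of polynomials that vanish on
`S`. -/
def coordRing (K : Type*) [Field K] {E : Type*} [AddCommGroup E] [Module K E] (S : Set E) :
    Subalgebra K (S → K) :=
  Algebra.adjoin K (Set.range fun (l : Module.Dual K E) (x : S) => l (x : E))

/-- The dimension of the Zariski closure of a subset of a vector space (`⊥` for the empty set). -/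
def zariskiDim (K : Type*) [Field K] {E : Type*} [AddCommGroup E] [Module K E] (S : Set E) :
    WithBot ℕ∞ :=
  ringKrullDim (coordRing K S)

end Dimension

variable {K : Type*} [Field K] {V : Type*} [AddCommGroup V] [Module K V]

/-- The quotient `P / Q` for subspaces `Q ≤ P` of `V`. -/
abbrev SubQuot (P Q : Submodule K V) : Type _ := P ⧸ Q.submoduleOf P

/-- `GAut(V)`: the linear automorphisms that preserve the bilinear form up to a nonzero scalar. -/
def GAut (B : LinearMap.BilinForm K V) : Subgroup (V ≃ₗ[K] V) where
  carrier := {g | ∃ c : Kˣ, ∀ v w, B (g v) (g w) = (c : K) * B v w}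
  one_mem' := ⟨1, fun v w => by simp⟩
  mul_mem' := by
    rintro g h ⟨c, hc⟩ ⟨c', hc'⟩
    refine ⟨c * c', fun v w => ?_⟩
    simp only [LinearEquiv.mul_apply, hc, hc', Units.val_mul, mul_assoc]
  inv_mem' := by
    rintro g ⟨c, hc⟩
    refine ⟨c⁻¹, fun v w => ?_⟩
    have h := hc (g⁻¹ v) (g⁻¹ w)
    have e : ∀ u, g (g⁻¹ u) = u := fun u => g.apply_symm_apply u
    rw [e, e] at h
    rw [h, Units.inv_mul_cancel_left]

/-- `Lie GAut(V)`: the endomorphisms `X` with `⟨Xv, w⟩ + ⟨v, Xw⟩ = c ⟨v, w⟩` for some scalar `c`. -/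
def lieGAut (B : LinearMap.BilinForm K V) : Submodule K (Module.End K V) where
  carrier := {X | ∃ c : K, ∀ v w, B (X v) w + B v (X w) = c * B v w}
  zero_mem' := ⟨0, fun v w => by simp⟩
  add_mem' := by
    rintro X Y ⟨c, hc⟩ ⟨c', hc'⟩
    refine ⟨c + c', fun v w => ?_⟩
    have h1 := hc v w
    have h2 := hc' v w
    simp only [LinearMap.add_apply, map_add]
    linear_combination h1 + h2
  smul_mem' := by
    rintro a X ⟨c, hc⟩
    refine ⟨a * c, fun v w => ?_⟩
    have h1 := hc v w
    simp only [LinearMap.smul_apply, map_smul, smul_eq_mul]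
    linear_combination a * h1

/-- A decreasing filtration `V = F⁰ ⊇ F¹ ⊇ ⋯ ⊇ Fᵈ ⊇ Fᵈ⁺¹ = 0`, extended to all integer indices in
the obvious way, that is self-dual: `F^{d+1-p}` is the orthogonal complement of `F^p`. -/
structure IsSelfDualFiltration (B : LinearMap.BilinForm K V) (d : ℕ) (F : ℤ → Submodule K V) :
    Prop where
  antitone : Antitone F
  eq_top : ∀ p : ℤ, p ≤ 0 → F p = ⊤
  eq_bot : ∀ p : ℤ, (d : ℤ) < p → F p = ⊥
  self_dual : ∀ p : ℤ, F (d + 1 - p) = B.orthogonal (F p)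

/-- An increasing self-dual flag `0 = f⁰ ⊆ f¹ ⊆ ⋯ ⊆ f^{2m+1} = V`; equalities are permitted, and
`f^{2m+1-i}` is the orthogonal complement of `f^i`. Indices beyond `2m+1` play no role. -/
structure IsSelfDualFlag (B : LinearMap.BilinForm K V) (m : ℕ) (f : ℕ → Submodule K V) :
    Prop where
  monotone : Monotone f
  eq_bot : f 0 = ⊥
  eq_top : f (2 * m + 1) = ⊤
  self_dual : ∀ i, i ≤ 2 * m + 1 → f (2 * m + 1 - i) = B.orthogonal (f i)

/-- The weight `(∑ p · dim gr^p W) / dim W` of a decreasing filtration of `W` that is all of `W` in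
degrees `≤ 0` and zero in degrees `> d`. -/
def weight (d : ℕ) {W : Type*} [AddCommGroup W] [Module K W] (F : ℤ → Submodule K W) : ℚ :=
  (∑ p ∈ Finset.range (d + 1),
    (p : ℚ) * (Module.finrank K (SubQuot (F (p : ℤ)) (F ((p : ℤ) + 1))) : ℚ)) /
    (Module.finrank K W : ℚ)

/-- The graded piece `gr^j = f^{j+1} / f^j`. -/
abbrev Gr (f : ℕ → Submodule K V) (j : ℕ) : Type _ := SubQuot (f (j + 1)) (f j)

/-- The class in `gr^j = f^{j+1} / f^j` of an element of `f^{j+1}`. -/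
abbrev toGr (f : ℕ → Submodule K V) (j : ℕ) : f (j + 1) →ₗ[K] Gr f j :=
  ((f j).submoduleOf (f (j + 1))).mkQ

/-- The filtration induced by `F` on `gr^j`: the image of `F^p ∩ f^{j+1}`. -/
def inducedFil (F : ℤ → Submodule K V) (f : ℕ → Submodule K V) (j : ℕ) (p : ℤ) :
    Submodule K (Gr f j) :=
  ((F p).submoduleOf (f (j + 1))).map (toGr f j)

/-- The filtration `F` is bad: there is a self-dual flag `f` such that
(a) `f` is `φ`-stable;
(b) the filtration induced by `F` on each nonzero graded piece of `f` has weight `d / 2`;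
(c) for `0 ≤ j ≤ m` the graded piece `gr^j = f^{j+1} / f^j`, with the induced filtration and the
induced automorphism, is isomorphic to `A j`, and on the middle piece `gr^m = (f^m)^⊥ / f^m` the
isomorphism carries the form induced by `B` to the given form on `A m`. -/
def IsBad (B : LinearMap.BilinForm K V) (φ : V ≃ₗ[K] V) (d m : ℕ)
    (A : Fin (m + 1) → Type*) [∀ j, AddCommGroup (A j)] [∀ j, Module K (A j)]
    (FA : ∀ j, ℤ → Submodule K (A j)) (φA : ∀ j, A j ≃ₗ[K] A j)
    (BA : LinearMap.BilinForm K (A (Fin.last m)))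
    (F : ℤ → Submodule K V) : Prop :=
  ∃ f : ℕ → Submodule K V, IsSelfDualFlag B m f ∧
    (∀ i, i ≤ 2 * m + 1 → ∀ v ∈ f i, φ v ∈ f i) ∧
    (∀ k, k ≤ 2 * m → Nontrivial (Gr f k) → weight d (inducedFil F f k) = (d : ℚ) / 2) ∧
    ∃ e : ∀ j : Fin (m + 1), Gr f (j : ℕ) ≃ₗ[K] A j,
      (∀ j : Fin (m + 1), ∀ p : ℤ,
        (inducedFil F f (j : ℕ) p).map (e j : Gr f (j : ℕ) →ₗ[K] A j) = FA j p) ∧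
      (∀ j : Fin (m + 1), ∀ x y : f ((j : ℕ) + 1), (y : V) = φ (x : V) →
        e j (toGr f j y) = φA j (e j (toGr f j x))) ∧
      (∀ x y : f ((Fin.last m : ℕ) + 1),
        BA (e (Fin.last m) (toGr f _ x)) (e (Fin.last m) (toGr f _ y)) = B (x : V) (y : V))

/-- The filtration that `F` induces on `Lie GAut(V)`. -/
def adjFil (B : LinearMap.BilinForm K V) (F : ℤ → Submodule K V) (p : ℤ) :
    Submodule K (Module.End K V) where
  carrier := {X | X ∈ lieGAut B ∧ ∀ i : ℤ, ∀ v ∈ F i, X v ∈ F (i + p)}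
  zero_mem' := ⟨zero_mem _, fun i v _ => by simp⟩
  add_mem' := by
    rintro X Y ⟨hX, hX'⟩ ⟨hY, hY'⟩
    exact ⟨add_mem hX hY, fun i v hv => add_mem (hX' i v hv) (hY' i v hv)⟩
  smul_mem' := by
    rintro a X ⟨hX, hX'⟩
    exact ⟨Submodule.smul_mem _ a hX, fun i v hv => Submodule.smul_mem _ a (hX' i v hv)⟩

/-- The adjoint Hodge number `h^p = dim gr^p_F Lie GAut(V)`. -/
def hodge (B : LinearMap.BilinForm K V) (F : ℤ → Submodule K V) (p : ℤ) : ℕ :=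
  Module.finrank K (SubQuot (adjFil B F p) (adjFil B F (p + 1)))

/-- The continuous piecewise linear function `T` on `[0, ∑ h^p]` with `T 0 = 0` and slope `p` on the
interval from `∑_{q > p} h^q` to `∑_{q ≥ p} h^q`; at an integer `x` it is the sum of the `x` largest
members of the list in which each `p` occurs `h^p` times. Only `-d ≤ p ≤ d` occur. -/
def topSum (d : ℕ) (h : ℤ → ℕ) (x : ℝ) : ℝ :=
  ∑ p ∈ Finset.Icc (-(d : ℤ)) d,
    (p : ℝ) * max 0 (min (h p : ℝ) (x - ∑ q ∈ Finset.Ioc p (d : ℤ), (h q : ℝ)))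

/-- `s` is the semisimple part of `φ` in its Jordan decomposition. -/
def IsSemisimplePart (φ s : Module.End K V) : Prop :=
  s.IsSemisimple ∧ Commute s φ ∧ IsNilpotent (φ - s)

/-- The centralizer of `s` in `GAut(V)`, as a subset of the vector space `End(V)`. -/
def centralizerGAut (B : LinearMap.BilinForm K V) (s : Module.End K V) :
    Set (Module.End K V) :=
  {g | (∃ g' ∈ GAut B, (g' : V →ₗ[K] V) = g) ∧ Commute g s}

/-- The self-dual filtrations with the same dimension data as `F₀`. -/
def flagVariety (B : LinearMap.BilinForm K V) (d : ℕ) (F₀ : ℤ → Submodule K V) :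
    Set (ℤ → Submodule K V) :=
  {F | IsSelfDualFiltration B d F ∧
    ∀ p, Module.finrank K (F p) = Module.finrank K (F₀ p)}

/-- The multi-cone, under the Plücker embeddings, over a set `S` of filtrations with
`dim F^p = k p`: all tuples `(x_p)` for `0 ≤ p ≤ d + 1`, with `x_p` a nonzero element of the line
`⋀^{k p} F^p` in `⋀^{k p} V`, for some `F` in `S`. -/
def pluckerCone (d : ℕ) (k : ℤ → ℕ) (S : Set (ℤ → Submodule K V)) :
    Set ((p : Fin (d + 2)) → ⋀[K]^(k (p : ℕ)) V) :=
  {x | ∃ F ∈ S, ∀ p : Fin (d + 2), x p ≠ 0 ∧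
    x p ∈ LinearMap.range (exteriorPower.map (k (p : ℕ)) (F (p : ℕ)).subtype)}

/-- A set `S` of filtrations has codimension at least `e` in `flagVariety B d F₀`. Both cones have
dimension exactly `d + 2` more than the sets of filtrations below them, and the flag variety is
homogeneous under `GAut(V)`, hence equidimensional. So this says that the Zariski closure of `S`
has dimension at most that of the flag variety minus `e`; it holds if `S` is empty. -/
def CodimAtLeast (B : LinearMap.BilinForm K V) (d : ℕ) (F₀ : ℤ → Submodule K V)
    (S : Set (ℤ → Submodule K V)) (e : ℕ) : Prop :=
  zariskiDim K (pluckerCone d (fun p => Module.finrank K (F₀ p)) S) + (e : WithBot ℕ∞) ≤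
    zariskiDim K (pluckerCone d (fun p => Module.finrank K (F₀ p)) (flagVariety B d F₀))

end BadFil

end


/-!
Fix one bad filtration `F`, with flag `f`. Lifting the isomorphisms between graded pieces gives for
every other bad filtration an isometry `g` that carries `F` to it and commutes with `φ` up to maps
that vanish on the graded pieces of `f`. If `Y ∘ g` is tangent to the set of these `g`, then `Y` is
skew and `Y - φ⁻¹ Y φ` lies in the nilradical `𝔫` of the stabilizer of the flag `g f`. The kernel of
`Y ↦ Y - φ⁻¹ Y φ` centralizes `φ^ss`, and the part of `𝔫` that stabilizes `g F` moves nothing, so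
the bad filtrations have dimension at most `z + ∑_{p>0} dim gr^{-p} 𝔫`. In characteristic zero the
dimension of a parametrized set is bounded by its tangent vectors, which are taken here to be the
derivations of its ring of polynomial functions.

On the other side `𝓗` has dimension at least `∑_{p>0} h^p`, the dimension of the skew endomorphisms
modulo those that stabilize `F`: the Cayley transform parametrizes a piece of the isometry group by
skew endomorphisms, with an injective derivative at `F`.

The difference is at least `e` because the weight condition on the graded pieces of `f` says that
the Hodge numbers of `𝔫` add up to `0`, while `𝔫` has at most half the dimension of the Lie algebra.
-/

noncomputable section

namespace BadFil

section Differentials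

open MvPolynomial

variable {K A L ι : Type*} [Field K] [CharZero K]

/- In characteristic zero `L` is formally smooth over the fraction field of `A`, hence over `A`, so
its first cotangent homology over `A` vanishes. -/
theorem mapBaseChange_injective [CommRing A] [IsDomain A] [Algebra K A] [Field L] [Algebra K L]
    [Algebra A L] [IsScalarTower K A L] [FaithfulSMul A L] [Algebra.EssFiniteType K L] :
    Function.Injective (KaehlerDifferential.mapBaseChange K A L) := by
  let F := FractionRing A
  let : Algebra F L := FractionRing.liftAlgebra _ _
  have : IsScalarTower A F L := FractionRing.isScalarTower_liftAlgebra _ _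
  have : IsScalarTower K F L := .of_algebraMap_eq fun x => by
    rw [IsScalarTower.algebraMap_apply K A F, ← IsScalarTower.algebraMap_apply A F L,
      ← IsScalarTower.algebraMap_apply]
  have : CharZero F := charZero_of_injective_algebraMap (algebraMap K F).injective
  have : Algebra.EssFiniteType F L := .of_comp K F L
  have : Algebra.FormallySmooth A F := .of_isLocalization (nonZeroDivisors _)
  have : Algebra.FormallySmooth A L := .comp _ F _
  rw [injective_iff_map_eq_zero]
  intro x hx
  obtain ⟨y, rfl⟩ := (Algebra.H1Cotangent.exact_δ_mapBaseChange K _ L x).mp hx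
  rw [Subsingleton.elim y 0, map_zero]

variable [Field L] [Algebra K L] [Algebra.EssFiniteType K L] {x : ι → L}

theorem linearIndependent_D_of_algebraicIndependent (hx : AlgebraicIndependent K x) :
    LinearIndependent L fun i => KaehlerDifferential.D K L (x i) := by
  let : Algebra (MvPolynomial ι K) L := (aeval x).toAlgebra
  have algebraMap_eq (p) : algebraMap (MvPolynomial ι K) L p = aeval x p := rfl
  have : IsScalarTower K (MvPolynomial ι K) L := .of_algebraMap_eq fun c => by
    rw [algebraMap_eq, MvPolynomial.algebraMap_eq, aeval_C]
  have : FaithfulSMul (MvPolynomial ι K) L := (faithfulSMul_iff_algebraMap_injective _ _).2 hx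
  have hli := ((KaehlerDifferential.mvPolynomialBasis K ι).baseChange L).linearIndependent.map' _
    (LinearMap.ker_eq_bot.2 (mapBaseChange_injective (K := K) (A := MvPolynomial ι K) (L := L)))
  have D_eq : (fun i => KaehlerDifferential.D K L (x i)) =
      KaehlerDifferential.mapBaseChange K (MvPolynomial ι K) L ∘
        (KaehlerDifferential.mvPolynomialBasis K ι).baseChange L := by
    ext i
    simp [Module.Basis.baseChange_apply, algebraMap_eq]
  rwa [D_eq]

theorem exists_dual_derivations [DecidableEq ι] (hx : AlgebraicIndependent K x) :
    ∃ D : ι → Derivation K L L, ∀ i j, D i (x j) = if j = i then 1 else 0 := by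
  classical
  have hli := linearIndependent_D_of_algebraicIndependent hx
  let b := Module.Basis.extend hli.linearIndepOn_id
  have mem_extend (i) : KaehlerDifferential.D K L (x i) ∈
      hli.linearIndepOn_id.extend (Set.subset_univ _) :=
    hli.linearIndepOn_id.subset_extend _ ⟨i, rfl⟩
  have D_eq (i) : KaehlerDifferential.D K L (x i) = b ⟨_, mem_extend i⟩ := by
    simp [b]
  refine ⟨fun i => (b.coord ⟨_, mem_extend i⟩).compDer (KaehlerDifferential.D K L), fun i j => ?_⟩
  have apply_eq : (b.coord ⟨_, mem_extend i⟩).compDer (KaehlerDifferential.D K L) (x j) =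
      b.coord ⟨_, mem_extend i⟩ (b ⟨_, mem_extend j⟩) :=
    congrArg (b.coord ⟨_, mem_extend i⟩) (D_eq j)
  rw [apply_eq, Module.Basis.coord_apply, Module.Basis.repr_self, Finsupp.single_apply]
  simp only [Subtype.mk.injEq, hli.injective.eq_iff]

end Differentials

section KrullDimension

open MvPolynomial

variable {K R : Type*} [Field K] [CommRing R] [Algebra K R]

theorem ringKrullDim_le_of_isIntegral {A C : Type*} [CommRing A] [CommRing C] (g : A →+* C)
    (hg : g.IsIntegral) : ringKrullDim C ≤ ringKrullDim A := by
  let := g.toAlgebra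
  have : Algebra.IsIntegral A C := ⟨hg⟩
  refine Order.krullDim_le_of_strictMono (PrimeSpectrum.comap g) fun p q hpq => ?_
  exact Ideal.IsIntegral.comap_lt_comap (R := A) (A := C) hpq

theorem le_ringKrullDim_of_isIntegral {A C : Type*} [CommRing A] [CommRing C] (g : A →+* C)
    (hinj : Function.Injective g) (hg : g.IsIntegral) : ringKrullDim A ≤ ringKrullDim C := by
  let := g.toAlgebra
  have : Algebra.IsIntegral A C := ⟨hg⟩
  refine iSup_le fun l => ?_
  obtain ⟨Q, -, _, hQ⟩ := Ideal.exists_ideal_over_prime_of_isIntegral (S := C) l.head.asIdeal ⊥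
    (by
      rw [← RingHom.ker_eq_comap_bot, (RingHom.injective_iff_ker_eq_bot (algebraMap A C)).1 hinj]
      exact bot_le)
  have : Q.LiesOver l.head.asIdeal := ⟨hQ.symm⟩
  obtain ⟨l', hlift, -⟩ := Ideal.exists_ltSeries_of_hasGoingUp l Q
  rw [← hlift]
  exact le_iSup (fun l : LTSeries (PrimeSpectrum C) => (l.length : WithBot ℕ∞)) l'

theorem exists_integral_injective_ringKrullDim_eq (K R : Type*) [Field K] [CommRing R]
    [Nontrivial R] [Algebra K R] [Algebra.FiniteType K R] :
    ∃ (n : ℕ) (g : MvPolynomial (Fin n) K →ₐ[K] R), Function.Injective g ∧ g.IsIntegral ∧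
      ringKrullDim R = n := by
  obtain ⟨n, g, hinj, hint⟩ := exists_integral_inj_algHom_of_fg K R
  have dim_mvPolynomial : ringKrullDim (MvPolynomial (Fin n) K) = n := by
    rw [MvPolynomial.ringKrullDim_of_isNoetherianRing, ringKrullDim_eq_zero_of_field]
    simp
  refine ⟨n, g, hinj, hint, ?_⟩
  rw [← dim_mvPolynomial]
  exact le_antisymm (ringKrullDim_le_of_isIntegral g.toRingHom hint)
    (le_ringKrullDim_of_isIntegral g.toRingHom hinj hint)

theorem exists_algebraicIndependent_ringKrullDim_eq (K R : Type*) [Field K] [CommRing R]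
    [Nontrivial R] [Algebra K R] [Algebra.FiniteType K R] :
    ∃ (n : ℕ) (x : Fin n → R), AlgebraicIndependent K x ∧ ringKrullDim R = n := by
  obtain ⟨n, g, hg, -, hdim⟩ := exists_integral_injective_ringKrullDim_eq K R
  refine ⟨n, fun i => g (X i), ?_, hdim⟩
  rw [AlgebraicIndependent]
  convert hg
  exact (aeval_unique g).symm

theorem ringKrullDim_eq_trdeg [IsDomain R] [Algebra.FiniteType K R] :
    ∃ n : ℕ, ringKrullDim R = n ∧ Algebra.trdeg K R = n := by
  obtain ⟨n, g, hinj, hint, hdim⟩ := exists_integral_injective_ringKrullDim_eq K R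
  let := g.toAlgebra
  have : IsScalarTower K (MvPolynomial (Fin n) K) R := .of_algebraMap_eq fun c =>
    (g.commutes c).symm
  have : FaithfulSMul (MvPolynomial (Fin n) K) R :=
    (faithfulSMul_iff_algebraMap_injective _ _).2 hinj
  have : Algebra.IsIntegral (MvPolynomial (Fin n) K) R := ⟨hint⟩
  have htr := lift_trdeg_add_eq K (MvPolynomial (Fin n) K) R
  rw [trdeg_eq_zero (R := MvPolynomial (Fin n) K) (A := R), MvPolynomial.trdeg_of_isDomain] at htr
  exact ⟨n, hdim, by simpa using htr.symm⟩

theorem exists_minimalPrimes_algebraicIndependent {ι : Type*} {x : ι → R}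
    (hx : AlgebraicIndependent K x) :
    ∃ p ∈ minimalPrimes R, AlgebraicIndependent K fun i => Ideal.Quotient.mkₐ K p (x i) := by
  have hbot : (⊥ : Ideal (MvPolynomial ι K)) ∈
      ((⊥ : Ideal R).comap (aeval x).toRingHom).minimalPrimes := by
    rw [Ideal.comap_bot_of_injective (aeval x).toRingHom hx]
    change ⊥ ∈ minimalPrimes (MvPolynomial ι K)
    rw [IsDomain.minimalPrimes_eq_singleton_bot, Set.mem_singleton_iff]
  obtain ⟨p, hp, hcomap⟩ := Ideal.exists_minimalPrimes_comap_eq _ _ hbot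
  refine ⟨p, hp, (injective_iff_map_eq_zero (aeval _)).2 fun q hq => ?_⟩
  rw [← comp_aeval_apply] at hq
  have hmem : q ∈ p.comap (aeval x).toRingHom :=
    Ideal.mem_comap.2 (Ideal.Quotient.eq_zero_iff_mem.1 hq)
  rwa [hcomap] at hmem

theorem card_le_ringKrullDim_of_algebraicIndependent [Algebra.FiniteType K R] {ι : Type*}
    [Fintype ι] {x : ι → R} (hx : AlgebraicIndependent K x) :
    (Fintype.card ι : WithBot ℕ∞) ≤ ringKrullDim R := by
  obtain ⟨p, hp, hxp⟩ := exists_minimalPrimes_algebraicIndependent hx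
  have : p.IsPrime := hp.1.1
  obtain ⟨n, hdim, htr⟩ := ringKrullDim_eq_trdeg (K := K) (R := R ⧸ p)
  have hle := hxp.lift_cardinalMk_le_trdeg
  simp only [htr, Cardinal.mk_fintype, Cardinal.lift_natCast, Nat.cast_le] at hle
  calc (Fintype.card ι : WithBot ℕ∞) ≤ n := Nat.mono_cast hle
    _ = ringKrullDim (R ⧸ p) := hdim.symm
    _ ≤ ringKrullDim R := ringKrullDim_quotient_le p

end KrullDimension

section DualDerivations

variable {K A ι : Type*} [Field K] [CommRing A] [IsDomain A] [Algebra K A] [Algebra.FiniteType K A]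

theorem exists_common_denominator {L : Type*} [Field L] [Algebra A L] [IsFractionRing A L]
    [Algebra K L] [IsScalarTower K A L] [Finite ι] (D : ι → Derivation K L L) :
    ∃ h : A, h ≠ 0 ∧
      ∀ i a, ∃ c : A, algebraMap A L c = algebraMap A L h * D i (algebraMap A L a) := by
  classical
  cases nonempty_fintype ι
  obtain ⟨t, ht⟩ := Algebra.FiniteType.out (R := K) (A := A)
  obtain ⟨b, hb⟩ := IsLocalization.exist_integer_multiples_of_finset (nonZeroDivisors A)
    ((Finset.univ ×ˢ t).image fun ia : ι × A => D ia.1 (algebraMap A L ia.2))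
  refine ⟨b, nonZeroDivisors.coe_ne_zero b, fun i a => ?_⟩
  have ha : a ∈ Algebra.adjoin K (t : Set A) := by rw [ht]; trivial
  induction ha using Algebra.adjoin_induction with
  | mem x hx =>
    obtain ⟨c, hc⟩ := hb (D i (algebraMap A L x))
      (Finset.mem_image.2 ⟨(i, x), Finset.mem_product.2 ⟨Finset.mem_univ _, hx⟩, rfl⟩)
    exact ⟨c, by rw [hc, Algebra.smul_def]⟩
  | algebraMap r =>
    exact ⟨0, by
      rw [← IsScalarTower.algebraMap_apply, Derivation.map_algebraMap, map_zero, mul_zero]⟩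
  | add x y _ _ hx hy =>
    obtain ⟨c, hc⟩ := hx
    obtain ⟨c', hc'⟩ := hy
    exact ⟨c + c', by simp only [map_add, hc, hc']; ring⟩
  | mul x y _ _ hx hy =>
    obtain ⟨c, hc⟩ := hx
    obtain ⟨c', hc'⟩ := hy
    refine ⟨x * c' + y * c, ?_⟩
    simp only [map_add, map_mul, hc, hc', Derivation.leibniz, smul_eq_mul]
    ring

theorem exists_dual_derivations_of_isDomain [CharZero K] [Finite ι] [DecidableEq ι] {x : ι → A}
    (hx : AlgebraicIndependent K x) :
    ∃ (h : A) (D : ι → Derivation K A A), h ≠ 0 ∧ ∀ i j, D i (x j) = if j = i then h else 0 := by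
  let L := FractionRing A
  have hinj := IsFractionRing.injective A L
  have : Algebra.EssFiniteType A L := .of_isLocalization L (nonZeroDivisors A)
  have : Algebra.EssFiniteType K L := .comp K A L
  obtain ⟨D, hD⟩ := exists_dual_derivations
    (hx.map' (f := IsScalarTower.toAlgHom K A L) hinj)
  obtain ⟨h, h_ne_zero, hh⟩ := exists_common_denominator (K := K) (A := A) (L := L) D
  choose E hE using hh
  have E_add (i a b) : E i (a + b) = E i a + E i b := hinj <| by
    simp only [map_add, hE, mul_add]
  have E_smul (i) (r : K) (a) : E i (r • a) = r • E i a := hinj <| by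
    have algebraMap_smul (a : A) : algebraMap A L (r • a) = r • algebraMap A L a :=
      map_smul (IsScalarTower.toAlgHom K A L) r a
    rw [algebraMap_smul, hE, hE, algebraMap_smul, Derivation.map_smul, mul_smul_comm]
  have E_mul (i a b) : E i (a * b) = a • E i b + b • E i a := hinj <| by
    simp only [map_add, map_mul, hE, Derivation.leibniz, smul_eq_mul]
    ring
  refine ⟨h, fun i => .mk' ⟨⟨E i, E_add i⟩, E_smul i⟩ (E_mul i), h_ne_zero, fun i j => hinj ?_⟩
  have hDx : D i (algebraMap A L (x j)) = if j = i then 1 else 0 := hD i j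
  change algebraMap A L (E i (x j)) = _
  rw [hE, hDx, mul_ite, mul_one, mul_zero, apply_ite (algebraMap A L), map_zero]

end DualDerivations

section PointDerivations

/-- A derivation at the point `s` of an algebra `R` of functions on `P`: a tangent vector at `s`
to the affine variety with coordinate ring `R`. -/
structure PointDerivation {K : Type*} [Field K] {P : Type*} (R : Subalgebra K (P → K)) (s : P) where
  toLin : R →ₗ[K] K
  leibniz : ∀ f g : R, toLin (f * g) = (f : P → K) s * toLin g + (g : P → K) s * toLin f

variable {K P ι : Type*} [Field K]

theorem exists_notMem_forall_mul_eq_zero {R : Type*} [CommRing R] [IsNoetherianRing R] [IsReduced R]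
    {p : Ideal R} (hp : p ∈ minimalPrimes R) : ∃ y ∉ p, ∀ x ∈ p, y * x = 0 := by
  classical
  have hfin := minimalPrimes.finite_of_isNoetherianRing R
  have : p.IsPrime := hp.1.1
  let others := hfin.toFinset.erase p
  have inf_not_le : ¬ others.inf id ≤ p := by
    rw [Ideal.IsPrime.inf_le' ‹_›]
    rintro ⟨q, hq, hqp⟩
    rw [Finset.mem_erase, Set.Finite.mem_toFinset] at hq
    exact hq.1 (le_antisymm hqp (hp.2 hq.2.1 hqp))
  obtain ⟨y, hy, hyp⟩ := SetLike.not_le_iff_exists.1 inf_not_le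
  refine ⟨y, hyp, fun x hx => ?_⟩
  have sInf_eq_bot : sInf (minimalPrimes R) = ⊥ := by
    rw [minimalPrimes, Ideal.sInf_minimalPrimes]
    exact nilradical_eq_zero R
  rw [← Ideal.mem_bot, ← sInf_eq_bot, Submodule.mem_sInf]
  intro q hq
  by_cases hqp : q = p
  · exact hqp ▸ Ideal.mul_mem_left _ _ hx
  · have inf_le : others.inf id ≤ q := Finset.inf_le (f := id)
      (Finset.mem_erase.2 ⟨hqp, hfin.mem_toFinset.2 hq⟩)
    exact Ideal.mul_mem_right _ _ (inf_le hy)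

/-- The value at `s`, as a function on the quotient of an algebra of functions by an ideal of
functions that vanish at `s`. -/
def quotientEval {R : Subalgebra K (P → K)} {p : Ideal R} {s : P}
    (hs : ∀ f ∈ p, (f : P → K) s = 0) : (R ⧸ p) →ₐ[K] K :=
  Ideal.Quotient.liftₐ p ((Pi.evalAlgHom K (fun _ : P => K) s).comp R.val) hs

/-- The point derivation that a derivation of the quotient by an ideal of functions vanishing at
`s` induces at `s`. -/
def PointDerivation.ofQuotient {R : Subalgebra K (P → K)} {p : Ideal R} {s : P}
    (hs : ∀ f ∈ p, (f : P → K) s = 0) (D : Derivation K (R ⧸ p) (R ⧸ p)) :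
    PointDerivation R s where
  toLin := (quotientEval hs).toLinearMap ∘ₗ D.toLinearMap ∘ₗ (Ideal.Quotient.mkₐ K p).toLinearMap
  leibniz f g := by
    change quotientEval hs (D (Ideal.Quotient.mkₐ K p (f * g))) = _
    rw [map_mul, Derivation.leibniz, map_add, smul_eq_mul, smul_eq_mul, map_mul, map_mul]
    rfl

/- Pass to a component on which the functions stay independent, and take a point of it that lies on
no other component and where the denominator of the dual derivations does not vanish. -/
theorem exists_dual_pointDerivations [CharZero K] (R : Subalgebra K (P → K))
    [Algebra.FiniteType K R] [Finite ι] [DecidableEq ι] {x : ι → R}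
    (hx : AlgebraicIndependent K x) :
    ∃ (s : P) (δ : ι → PointDerivation R s) (c : K), c ≠ 0 ∧
      ∀ i j, (δ i).toLin (x j) = if j = i then c else 0 := by
  have : IsNoetherianRing R := Algebra.FiniteType.isNoetherianRing K R
  have : IsReduced R := isReduced_of_injective R.val Subtype.val_injective
  obtain ⟨p, hp, hxp⟩ := exists_minimalPrimes_algebraicIndependent hx
  have : p.IsPrime := hp.1.1
  obtain ⟨h, D, h_ne_zero, hD⟩ := exists_dual_derivations_of_isDomain hxp
  obtain ⟨h, rfl⟩ := Ideal.Quotient.mk_surjective h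
  obtain ⟨w, hwp, hw⟩ := exists_notMem_forall_mul_eq_zero hp
  have wh_notMem : w * h ∉ p := fun hmem => (‹p.IsPrime›.mem_or_mem hmem).elim hwp
    fun hh => h_ne_zero (Ideal.Quotient.eq_zero_iff_mem.2 hh)
  obtain ⟨s, hs⟩ : ∃ s, (w : P → K) s * (h : P → K) s ≠ 0 := by
    by_contra! hzero
    exact wh_notMem ((Subtype.ext (funext hzero) : w * h = 0) ▸ p.zero_mem)
  have vanish (f) (hf : f ∈ p) : (f : P → K) s = 0 :=
    (mul_eq_zero.1 (congrArg (fun g : R => (g : P → K) s) (hw f hf))).resolve_left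
      (left_ne_zero_of_mul hs)
  refine ⟨s, fun i => .ofQuotient vanish (D i), (h : P → K) s, right_ne_zero_of_mul hs,
    fun i j => ?_⟩
  change quotientEval vanish (D i (Ideal.Quotient.mkₐ K p (x j))) = _
  rw [hD, apply_ite (quotientEval vanish), map_zero]
  rfl

end PointDerivations

section TangentVectors

open MvPolynomial

variable {K : Type*} [Field K] {P : Type*} {s : P}

/-- A tangent vector at `s`, acting on some class of functions on `P`: `rel f a` says that the
function `f` is in the class, and that its derivative is `a`. -/
structure Tangent (K : Type*) [Field K] {P : Type*} (s : P) where
  rel : (P → K) → K → Prop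
  const : ∀ c, rel (fun _ => c) 0
  add : ∀ {f g a b}, rel f a → rel g b → rel (fun x => f x + g x) (a + b)
  mul : ∀ {f g a b}, rel f a → rel g b → rel (fun x => f x * g x) (f s * b + g s * a)
  unique : ∀ {f a b}, rel f a → rel f b → a = b

theorem multilinearMap_eq_sum_coord_smul {W U ι : Type*} [AddCommGroup W] [Module K W]
    [AddCommGroup U] [Module K U] [Fintype ι] (e : Module.Basis ι K W) {k : ℕ}
    (M : MultilinearMap K (fun _ : Fin (k + 1) => W) U) (v : Fin (k + 1) → W) :
    M v = ∑ a, e.coord a (v 0) • M.curryLeft (e a) (Fin.tail v) := by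
  have hcurry : M v = M.curryLeft (v 0) (Fin.tail v) := by simp
  rw [hcurry]
  conv_lhs => rw [← e.sum_repr (v 0)]
  simp only [map_sum, map_smul, _root_.sum_apply, _root_.smul_apply, Module.Basis.coord_apply]

namespace Tangent

variable (D : Tangent K s)

theorem rel_sum {ι : Type*} (t : Finset ι) {f : ι → P → K} {a : ι → K}
    (h : ∀ i ∈ t, D.rel (f i) (a i)) : D.rel (fun x => ∑ i ∈ t, f i x) (∑ i ∈ t, a i) := by
  classical
  induction t using Finset.induction_on with
  | empty => simpa using D.const 0
  | insert i t hi ih =>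
    simp only [Finset.sum_insert hi]
    exact D.add (h i (Finset.mem_insert_self _ _))
      (ih fun j hj => h j (Finset.mem_insert_of_mem hj))

theorem rel_const_mul (c : K) {f : P → K} {a : K} (h : D.rel f a) :
    D.rel (fun x => c * f x) (c * a) := by
  simpa using D.mul (D.const c) h

variable {W W' U : Type*} [AddCommGroup W] [Module K W] [AddCommGroup W'] [Module K W']
  [AddCommGroup U] [Module K U]

/-- The derivative of the vector valued function `y` is `y'`. -/
def vec (y : P → W) (y' : W) : Prop :=
  ∀ l : Module.Dual K W, D.rel (fun x => l (y x)) (l y')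

variable {D}

theorem vec_unique {y : P → W} {a b : W} (ha : D.vec y a) (hb : D.vec y b) : a = b := by
  rw [← sub_eq_zero, ← Module.forall_dual_apply_eq_zero_iff K]
  intro l
  rw [map_sub, D.unique (ha l) (hb l), sub_self]

theorem vec_const (w : W) : D.vec (fun _ => w) 0 := fun l => by
  simpa using D.const (l w)

theorem vec_iff_rel {f : P → K} {a : K} : D.vec f a ↔ D.rel f a := by
  refine ⟨fun h => h LinearMap.id, fun h l => ?_⟩
  have hl (x : K) : l x = l 1 * x := by
    rw [mul_comm, ← smul_eq_mul, ← map_smul, smul_eq_mul, mul_one]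
  simpa only [← hl] using D.rel_const_mul (l 1) h

theorem vec_linear (L : W →ₗ[K] W') {y : P → W} {y' : W} (h : D.vec y y') :
    D.vec (fun x => L (y x)) (L y') := fun l => h (l ∘ₗ L)

theorem vec_add {y x : P → W} {y' x' : W} (hy : D.vec y y') (hx : D.vec x x') :
    D.vec (fun t => y t + x t) (y' + x') := fun l => by
  simpa only [map_add] using D.add (hy l) (hx l)

theorem vec_sub {y x : P → W} {y' x' : W} (hy : D.vec y y') (hx : D.vec x x') :
    D.vec (fun t => y t - x t) (y' - x') := fun l => by
  simpa [sub_eq_add_neg] using D.add (hy l) (D.rel_const_mul (-1) (hx l))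

theorem vec_sum {ι : Type*} (t : Finset ι) {y : ι → P → W} {y' : ι → W}
    (h : ∀ i ∈ t, D.vec (y i) (y' i)) : D.vec (fun x => ∑ i ∈ t, y i x) (∑ i ∈ t, y' i) := by
  intro l
  simpa only [map_sum] using D.rel_sum t fun i hi => h i hi l

theorem vec_smul {f : P → K} {a : K} (hf : D.rel f a) {y : P → W} {y' : W} (hy : D.vec y y') :
    D.vec (fun x => f x • y x) (f s • y' + a • y s) := fun l => by
  simpa [mul_comm a] using D.mul hf (hy l)

theorem vec_bilinear [FiniteDimensional K W] (b : W →ₗ[K] W' →ₗ[K] U) {y : P → W} {y' : W}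
    {x : P → W'} {x' : W'} (hy : D.vec y y') (hx : D.vec x x') :
    D.vec (fun t => b (y t) (x t)) (b (y s) x' + b y' (x s)) := by
  let e := Module.finBasis K W
  have hexp : ∀ (w : W) (v : W'), b w v = ∑ i, e.coord i w • b (e i) v := by
    intro w v
    conv_lhs => rw [← e.sum_repr w]
    simp only [map_sum, map_smul, LinearMap.sum_apply, LinearMap.smul_apply,
      Module.Basis.coord_apply]
  have := vec_sum (D := D) Finset.univ
    fun i _ => vec_smul (hy (e.coord i)) (vec_linear (b (e i)) hx)
  simp only [hexp (y s), hexp y', ← Finset.sum_add_distrib]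
  simpa only [← hexp] using this

theorem vec_pi {ι : Type*} [Finite ι] {W : ι → Type*} [∀ i, AddCommGroup (W i)]
    [∀ i, Module K (W i)] {y : P → ∀ i, W i} {y' : ∀ i, W i}
    (h : ∀ i, D.vec (fun x => y x i) (y' i)) : D.vec y y' := by
  classical
  cases nonempty_fintype ι
  intro l
  have hexp : ∀ w : ∀ i, W i, l w = ∑ i, (l ∘ₗ LinearMap.single K W i) (w i) := by
    intro w
    conv_lhs => rw [← Finset.univ_sum_single w]
    simp
  have := D.rel_sum Finset.univ fun i _ => h i (l ∘ₗ LinearMap.single K W i)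
  rw [← hexp] at this
  simpa only [← hexp] using this

theorem vec_multilinear [FiniteDimensional K W] {k : ℕ}
    (M : MultilinearMap K (fun _ : Fin k => W) U) {y : Fin k → P → W} {y' : Fin k → W}
    (hy : ∀ i, D.vec (y i) (y' i)) :
    D.vec (fun t => M fun i => y i t) (∑ i, M (Function.update (fun j => y j s) i (y' i))) := by
  induction k with
  | zero =>
    have hconst : (fun t => M fun i => y i t) = fun _ => M Fin.elim0 :=
      funext fun t => congrArg M (Subsingleton.elim _ _)
    rw [hconst]
    simpa using vec_const (D := D) _
  | succ k ih =>
    let e := Module.finBasis K W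
    have hexp := multilinearMap_eq_sum_coord_smul e M
    have hsum := vec_sum (D := D) Finset.univ
      fun a _ => vec_smul (hy 0 (e.coord a)) (ih (M.curryLeft (e a)) fun i => hy i.succ)
    rw [funext fun t => hexp fun i => y i t]
    change D.vec (fun t => ∑ a, e.coord a (y 0 t) • M.curryLeft (e a) fun i => y i.succ t) _
    convert hsum using 1
    rw [Finset.sum_add_distrib, Fin.sum_univ_succ, add_comm]
    congr 1
    · simp only [Finset.smul_sum]
      rw [Finset.sum_comm]
      refine Finset.sum_congr rfl fun i _ => ?_
      rw [hexp]
      refine Finset.sum_congr rfl fun a _ => ?_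
      congr 2
      funext j
      simp [Fin.tail, Function.update_apply]
    · rw [hexp]
      exact Finset.sum_congr rfl fun a _ => rfl

end Tangent

/-- A point derivation of an algebra of functions, as a tangent vector. -/
def PointDerivation.tangent {R : Subalgebra K (P → K)} (δ : PointDerivation R s) :
    Tangent K s where
  rel f a := ∃ h : f ∈ R, δ.toLin ⟨f, h⟩ = a
  const c := ⟨R.algebraMap_mem c, by
    have hone : δ.toLin 1 = 0 := by simpa using δ.leibniz 1 1
    have hconst : (⟨fun _ => c, R.algebraMap_mem c⟩ : R) = c • 1 := by
      ext x; simp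
    rw [hconst, map_smul, hone, smul_zero]⟩
  add := by
    rintro f g a b ⟨hf, rfl⟩ ⟨hg, rfl⟩
    exact ⟨R.add_mem hf hg, by rw [← map_add]; rfl⟩
  mul := by
    rintro f g a b ⟨hf, rfl⟩ ⟨hg, rfl⟩
    exact ⟨R.mul_mem hf hg, (δ.leibniz ⟨f, hf⟩ ⟨g, hg⟩)⟩
  unique := by
    rintro f a b ⟨hf, rfl⟩ ⟨hg, rfl⟩
    rfl

/-- The partial derivative at the origin of polynomial functions on affine space. -/
def polyTangent (K : Type*) [Field K] [Infinite K] {σ : Type*} (j : σ) :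
    Tangent K (0 : σ → K) where
  rel f a := ∃ p : MvPolynomial σ K, (∀ u, eval u p = f u) ∧ eval 0 (pderiv j p) = a
  const c := ⟨C c, by simp, by simp⟩
  add := by
    rintro f g a b ⟨p, hp, rfl⟩ ⟨q, hq, rfl⟩
    exact ⟨p + q, by simp [hp, hq], by simp⟩
  mul := by
    rintro f g a b ⟨p, hp, rfl⟩ ⟨q, hq, rfl⟩
    refine ⟨p * q, by simp [hp, hq], ?_⟩
    rw [pderiv_mul, map_add, map_mul, map_mul, hp, hq]
    ring
  unique := by
    rintro f a b ⟨p, hp, rfl⟩ ⟨q, hq, rfl⟩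
    rw [MvPolynomial.funext fun u => (hp u).trans (hq u).symm]

end TangentVectors

section Bounds

open MvPolynomial

variable {K : Type*} [Field K] {E E' : Type*} [AddCommGroup E] [Module K E]
  [AddCommGroup E'] [Module K E']

theorem linear_mem_coordRing (S : Set E) (l : Module.Dual K E) :
    (fun x : S => l (x : E)) ∈ coordRing K S := Algebra.subset_adjoin ⟨l, rfl⟩

instance finiteType_coordRing [FiniteDimensional K E] (S : Set E) :
    Algebra.FiniteType K (coordRing K S) := by
  classical
  rw [← Subalgebra.fg_iff_finiteType]
  let b := Module.finBasis K (Module.Dual K E)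
  refine ⟨Finset.univ.image fun i => fun x : S => b i (x : E), ?_⟩
  refine le_antisymm (Algebra.adjoin_mono ?_) (Algebra.adjoin_le ?_)
  · intro f hf
    obtain ⟨i, -, rfl⟩ := Finset.mem_image.1 hf
    exact ⟨b i, rfl⟩
  · rintro _ ⟨l, rfl⟩
    have : (fun x : S => l (x : E)) = ∑ i, b.repr l i • fun x : S => b i (x : E) := by
      funext x
      conv_lhs => rw [← b.sum_repr l]
      simp only [LinearMap.sum_apply, LinearMap.smul_apply, Finset.sum_apply, Pi.smul_apply]
    simp only [this]
    refine Subalgebra.sum_mem _ fun i _ => Subalgebra.smul_mem _ (Algebra.subset_adjoin ?_) _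
    simp

/-- Composition with a map `y` into `S` whose coordinates belong to an algebra `R` of functions, as
a homomorphism from the coordinate ring of `S` to `R`. -/
def coordRingPullback {P : Type*} (R : Subalgebra K (P → K)) {S : Set E} (y : P → S)
    (hy : ∀ l : Module.Dual K E, (fun x => l (y x : E)) ∈ R) : coordRing K S →ₐ[K] R :=
  ((AlgHom.pi fun x => Pi.evalAlgHom K (fun _ : S => K) (y x)).comp
    (coordRing K S).val).codRestrict R fun f =>
      (Algebra.adjoin_le (by rintro _ ⟨l, rfl⟩; exact hy l) :
        coordRing K S ≤ R.comap (AlgHom.pi fun x => Pi.evalAlgHom K (fun _ : S => K) (y x))) f.2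

theorem coordRingPullback_injective {P : Type*} (R : Subalgebra K (P → K)) {S : Set E} {y : P → S}
    (hy : ∀ l : Module.Dual K E, (fun x => l (y x : E)) ∈ R) (hsurj : y.Surjective) :
    Function.Injective (coordRingPullback R y hy) := fun _ _ h =>
  Subtype.ext (hsurj.injective_comp_right (congrArg Subtype.val h))

theorem zariskiDim_mono {S S' : Set E} (h : S ⊆ S') : zariskiDim K S ≤ zariskiDim K S' := by
  refine ringKrullDim_le_of_surjective (coordRingPullback (coordRing K S) (Set.inclusion h)
    fun l => linear_mem_coordRing S l).toRingHom ?_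
  rintro ⟨f, hf⟩
  have hle : coordRing K S ≤ (coordRing K S').map
      (AlgHom.pi fun x => Pi.evalAlgHom K (fun _ : S' => K) (Set.inclusion h x)) := by
    refine Algebra.adjoin_le ?_
    rintro _ ⟨l, rfl⟩
    exact ⟨_, linear_mem_coordRing S' l, rfl⟩
  obtain ⟨g, hg, hgf⟩ := hle hf
  exact ⟨⟨g, hg⟩, Subtype.ext hgf⟩

theorem zariskiDim_empty : zariskiDim K (∅ : Set E) = ⊥ := by
  have : Subsingleton (coordRing K (∅ : Set E)) :=
    ⟨fun a b => Subtype.ext (funext fun x => isEmptyElim x)⟩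
  exact ringKrullDim_eq_bot_of_subsingleton

theorem nontrivial_coordRing {S : Set E} (hS : S.Nonempty) : Nontrivial (coordRing K S) := by
  have := hS.to_subtype
  exact (coordRing K S).toSubsemiring.nontrivial

theorem Tangent.rel_comp_of_vec_zero {P : Type*} {s : P} {D : Tangent K s} {S : Set E} {y : P → S}
    (hy : D.vec (fun x => (y x : E)) 0) {f : S → K} (hf : f ∈ coordRing K S) :
    D.rel (f ∘ y) 0 := by
  induction hf using Algebra.adjoin_induction with
  | mem f hf =>
    obtain ⟨l, rfl⟩ := hf
    simpa only [map_zero] using! hy l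
  | algebraMap c => exact D.const c
  | add f g _ _ hf hg => simpa only [add_zero] using! D.add hf hg
  | mul f g _ _ hf hg => simpa only [mul_zero, add_zero] using! D.mul hf hg

/-- Linear combinations of point derivations at the same point. -/
def PointDerivation.linearCombination {P ι : Type*} [Fintype ι] {R : Subalgebra K (P → K)} {s : P}
    (a : ι → K) (δ : ι → PointDerivation R s) : PointDerivation R s where
  toLin := ∑ i, a i • (δ i).toLin
  leibniz f g := by
    simp only [LinearMap.sum_apply, LinearMap.smul_apply, PointDerivation.leibniz, smul_eq_mul,
      Finset.mul_sum, ← Finset.sum_add_distrib]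
    exact Finset.sum_congr rfl fun i _ => by ring

theorem PointDerivation.exists_vec [FiniteDimensional K E] {P : Type*} {R : Subalgebra K (P → K)}
    {s : P} (δ : PointDerivation R s) {y : P → E}
    (hy : ∀ l : Module.Dual K E, (fun x => l (y x)) ∈ R) : ∃ y', δ.tangent.vec y y' := by
  let evalAt : Module.Dual K (Module.Dual K E) :=
    { toFun := fun l => δ.toLin ⟨fun x => l (y x), hy l⟩
      map_add' := fun l l' => by rw [← map_add]; rfl
      map_smul' := fun a l => by rw [RingHom.id_apply, ← map_smul]; rfl }
  exact ⟨(Module.evalEquiv K E).symm evalAt, fun l => ⟨hy l, by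
    rw [Module.apply_evalEquiv_symm_apply]; rfl⟩⟩

/- In characteristic zero the rank of a regular map at a general point is the dimension of its
image. -/
theorem zariskiDim_range_le [CharZero K] [FiniteDimensional K E] [FiniteDimensional K E']
    (S : Set E) (y : S → E') (hy : ∀ l : Module.Dual K E', (fun x => l (y x)) ∈ coordRing K S)
    (r : ℕ)
    (htangent : ∀ s : S, ∃ T : Submodule K E', Module.finrank K T ≤ r ∧
      ∀ (δ : PointDerivation (coordRing K S) s) (y' : E'), δ.tangent.vec y y' → y' ∈ T) :
    zariskiDim K (Set.range y) ≤ r := by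
  classical
  rcases isEmpty_or_nonempty S with hS | hS
  · rw [Set.range_eq_empty, zariskiDim_empty]
    exact bot_le
  have : Nontrivial (coordRing K (Set.range y)) := nontrivial_coordRing (Set.range_nonempty y)
  obtain ⟨n, x, hx, hdim⟩ := exists_algebraicIndependent_ringKrullDim_eq K
    (coordRing K (Set.range y))
  let ρ := coordRingPullback (coordRing K S) (Set.rangeFactorization y) hy
  have hρ : Function.Injective ρ :=
    coordRingPullback_injective _ hy Set.rangeFactorization_surjective
  obtain ⟨s, δ, c, hc, hδ⟩ := exists_dual_pointDerivations (coordRing K S) (hx.map' hρ)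
  obtain ⟨T, hT, hmem⟩ := htangent s
  choose w hw using fun i => (δ i).exists_vec hy
  have hli : LinearIndependent K fun i => (⟨w i, hmem (δ i) _ (hw i)⟩ : T) := by
    rw [Fintype.linearIndependent_iff]
    intro a ha j
    have hzero : (PointDerivation.linearCombination a δ).tangent.vec
        (fun t => ((Set.rangeFactorization y t : Set.range y) : E')) 0 := by
      have hsum : ∑ i, a i • w i = 0 := by simpa using congrArg Subtype.val ha
      intro l
      refine ⟨hy l, ?_⟩
      rw [← hsum, map_sum]
      simp only [PointDerivation.linearCombination, LinearMap.sum_apply, LinearMap.smul_apply,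
        map_smul]
      exact Finset.sum_congr rfl fun i _ => congrArg (a i • ·) (hw i l).2
    obtain ⟨_, hj⟩ := Tangent.rel_comp_of_vec_zero hzero (x j).2
    have hj : ∑ i, a i * (δ i).toLin (ρ (x j)) = 0 := by
      rw [← hj]
      simp only [PointDerivation.linearCombination, LinearMap.sum_apply, LinearMap.smul_apply]
      rfl
    have hδj : ∀ i, (δ i).toLin (ρ (x j)) = if j = i then c else 0 := fun i => hδ i j
    simpa [hδj, hc] using hj
  rw [zariskiDim, hdim]
  exact_mod_cast (Fintype.card_fin n ▸ hli.fintype_card_le_finrank).trans hT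

theorem pderiv_aeval {σ τ : Type*} [Fintype σ] (y : σ → MvPolynomial τ K) (j : τ)
    (q : MvPolynomial σ K) :
    pderiv j (aeval y q) = ∑ i, pderiv j (y i) * aeval y (pderiv i q) := by
  classical
  induction q using MvPolynomial.induction_on with
  | C a => simp
  | add p q hp hq => simp only [map_add, hp, hq, mul_add, Finset.sum_add_distrib]
  | mul_X p i hp =>
    simp only [map_mul, aeval_X, pderiv_mul, hp, map_add, mul_add, Finset.sum_add_distrib]
    congr 1
    · rw [Finset.sum_mul]
      exact Finset.sum_congr rfl fun k _ => by ring
    · rw [Finset.sum_eq_single i]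
      · simp; ring
      · intro k _ hk
        simp [pderiv_X_of_ne hk.symm]
      · simp

theorem totalDegree_pderiv_le {σ : Type*} (i : σ) (q : MvPolynomial σ K) :
    (pderiv i q).totalDegree ≤ q.totalDegree - 1 := by
  refine Finset.sup_le fun m hm => ?_
  rw [mem_support_iff, coeff_pderiv] at hm
  have hle := le_totalDegree (mem_support_iff.2 (left_ne_zero_of_mul hm))
  change Finsupp.degree m ≤ _
  change Finsupp.degree (m + Finsupp.single i 1) ≤ _ at hle
  rw [map_add, Finsupp.degree_single] at hle
  omega

theorem eq_C_of_pderiv_eq_zero [CharZero K] {σ : Type*} {q : MvPolynomial σ K}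
    (hq : ∀ i, pderiv i q = 0) : q = C (coeff 0 q) := by
  classical
  ext m
  rw [coeff_C]
  split_ifs with hm
  · rw [hm]
  obtain ⟨i, hi⟩ := DFunLike.ne_iff.1 (Ne.symm hm)
  have hle : Finsupp.single i 1 ≤ m := by
    simpa [Finsupp.single_le_iff, Nat.one_le_iff_ne_zero] using hi
  have hcoeff := congrArg (coeff (m - Finsupp.single i 1)) (hq i)
  rw [coeff_pderiv, tsub_add_cancel_of_le hle, coeff_zero] at hcoeff
  exact (mul_eq_zero.1 hcoeff).resolve_right (Nat.cast_add_one_ne_zero _)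

/- By the chain rule the partial derivatives of a relation are relations, of smaller degree. -/
theorem algebraicIndependent_of_det_pderiv_ne_zero [CharZero K] {σ : Type*} [Fintype σ]
    [DecidableEq σ] {y : σ → MvPolynomial σ K}
    (hdet : (Matrix.of fun j i => pderiv j (y i)).det ≠ 0) : AlgebraicIndependent K y := by
  rw [AlgebraicIndependent, injective_iff_map_eq_zero]
  suffices h : ∀ (n : ℕ) (q : MvPolynomial σ K), q.totalDegree ≤ n → aeval y q = 0 → q = 0 from
    fun q hq => h _ q le_rfl hq
  have hpderiv (q : MvPolynomial σ K) (hq : aeval y q = 0) (i : σ) : aeval y (pderiv i q) = 0 := by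
    refine congrFun (Matrix.eq_zero_of_mulVec_eq_zero
      (v := fun i => aeval y (pderiv i q)) hdet (funext fun j => ?_)) i
    have hchain := pderiv_aeval y j q
    rw [hq, map_zero] at hchain
    exact hchain.symm
  have hconst (q : MvPolynomial σ K) (hq : aeval y q = 0) (hd : ∀ i, pderiv i q = 0) : q = 0 := by
    rw [eq_C_of_pderiv_eq_zero hd] at hq ⊢
    simpa using hq
  intro n
  induction n with
  | zero =>
    intro q hn hq
    rw [totalDegree_eq_zero_iff_eq_C.1 (Nat.le_zero.1 hn)] at hq ⊢
    simpa using hq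
  | succ n ih =>
    exact fun q hn hq => hconst q hq fun i =>
      ih _ ((totalDegree_pderiv_le i q).trans (by omega)) (hpderiv q hq i)

theorem algebraicIndependent_of_pderiv_eval_zero [CharZero K] {σ : Type*} [Finite σ]
    [DecidableEq σ] {y : σ → MvPolynomial σ K}
    (hy : ∀ i j, eval 0 (pderiv j (y i)) = if i = j then 1 else 0) : AlgebraicIndependent K y := by
  cases nonempty_fintype σ
  refine algebraicIndependent_of_det_pderiv_ne_zero fun hdet => one_ne_zero (α := K) ?_
  have hone : (eval (0 : σ → K)).mapMatrix (Matrix.of fun j i => pderiv j (y i)) = 1 := by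
    ext a b
    change eval 0 (pderiv a (y b)) = _
    rw [hy, Matrix.one_apply]
    simp only [eq_comm]
  rw [← Matrix.det_one (n := σ), ← hone, ← RingHom.map_det, hdet, map_zero]

theorem algebraicIndependent_coordRing_of_polynomial_map {σ : Type*} [Infinite K] {S : Set E}
    {ψ : (σ → K) → E} {h : MvPolynomial σ K} (h_ne_zero : h ≠ 0)
    (hS : ∀ u, eval u h ≠ 0 → ψ u ∈ S) {l : σ → Module.Dual K E} {p : σ → MvPolynomial σ K}
    (hp : ∀ i u, eval u (p i) = l i (ψ u)) (hindep : AlgebraicIndependent K p) :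
    AlgebraicIndependent K fun i =>
      (⟨fun x => l i (x : E), linear_mem_coordRing S (l i)⟩ : coordRing K S) := by
  set f : σ → coordRing K S := fun i => ⟨fun x => l i (x : E), linear_mem_coordRing S (l i)⟩
  rw [AlgebraicIndependent, injective_iff_map_eq_zero]
  intro q hq
  refine (injective_iff_map_eq_zero _).1 hindep q ((mul_eq_zero.1 ?_).resolve_right h_ne_zero)
  refine MvPolynomial.funext fun u => ?_
  rw [map_mul, map_zero]
  by_cases hu : eval u h = 0
  · rw [hu, mul_zero]
  have heval : (aeval u).comp (aeval p) =
      ((Pi.evalAlgHom K (fun _ : S => K) ⟨ψ u, hS u hu⟩).comp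
        (coordRing K S).val).comp (aeval f) := by
    refine algHom_ext fun i => ?_
    simpa [aeval_eq_eval] using hp i u
  have hvalue := AlgHom.congr_fun heval q
  simp only [AlgHom.comp_apply, hq, map_zero] at hvalue
  rw [← coe_aeval_eq_eval, RingHom.coe_coe, hvalue, zero_mul]

/- The class of `polyTangent` consists of the polynomial functions, so `hη` and `hderiv` contain the
assumption that `η` and `ψ` are polynomial. -/
theorem le_zariskiDim [CharZero K] [FiniteDimensional K E] {σ : Type*} [Fintype σ] {S : Set E}
    {ψ : (σ → K) → E} {η : (σ → K) → K} (hη : ∀ j, ∃ a, (polyTangent K j).rel η a) (hη0 : η 0 ≠ 0)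
    (hS : ∀ u, η u ≠ 0 → ψ u ∈ S) {ψ' : σ → E} (hψ' : LinearIndependent K ψ')
    (hderiv : ∀ j, (polyTangent K j).vec ψ (ψ' j)) :
    (Fintype.card σ : WithBot ℕ∞) ≤ zariskiDim K S := by
  classical
  obtain ⟨h, hh⟩ : ∃ h : MvPolynomial σ K, ∀ u, eval u h = η u := by
    rcases isEmpty_or_nonempty σ with hσ | ⟨⟨j⟩⟩
    · exact ⟨C (η 0), fun u => by rw [Subsingleton.elim u 0, eval_C]⟩
    · obtain ⟨-, h, hh, -⟩ := hη j
      exact ⟨h, hh⟩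
  have h_ne_zero : h ≠ 0 := fun hzero => hη0 (by rw [← hh, hzero, map_zero])
  obtain ⟨G, hG⟩ := LinearMap.exists_leftInverse_of_injective
    (Fintype.linearCombination K ψ') (LinearMap.ker_eq_bot.2 hψ'.fintypeLinearCombination_injective)
  let l : σ → Module.Dual K E := fun i => LinearMap.proj i ∘ₗ G
  have hl : ∀ i j, l i (ψ' j) = if i = j then 1 else 0 := by
    intro i j
    have hij := congrFun (LinearMap.congr_fun hG (Pi.single j 1)) i
    simpa [l, Pi.single_apply, Fintype.linearCombination_apply] using hij
  choose p hp _ using fun i => hderiv i (l i)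
  have hpderiv : ∀ i j, eval 0 (pderiv j (p i)) = if i = j then 1 else 0 := fun i j =>
    ((polyTangent K j).unique ⟨p i, hp i, rfl⟩ (hderiv j (l i))).trans (hl i j)
  exact card_le_ringKrullDim_of_algebraicIndependent
    (algebraicIndependent_coordRing_of_polynomial_map h_ne_zero (fun u hu => hS u (hh u ▸ hu)) hp
      (algebraicIndependent_of_pderiv_eval_zero hpderiv))

end Bounds

section AdaptedBasis

variable {K : Type*} [Field K] {V : Type*} [AddCommGroup V] [Module K V]

/-- The basis `b` is adapted to the family of subspaces `G`: each `G i` is spanned by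
the basis vectors `b a` with `S i a`. -/
def IsAdapted {ι κ : Type*} (b : Module.Basis ι K V) (G : κ → Submodule K V)
    (S : κ → ι → Prop) : Prop :=
  ∀ i, G i = Submodule.span K (b '' {a | S i a})

namespace IsAdapted

variable {ι κ : Type*} {b : Module.Basis ι K V} {G : κ → Submodule K V} {S : κ → ι → Prop}

theorem mem_iff (h : IsAdapted b G S) (i : κ) (x : V) :
    x ∈ G i ↔ ∀ a, b.repr x a ≠ 0 → S i a := by
  rw [h i, Module.Basis.mem_span_image]
  exact ⟨fun hx a ha => hx (Finsupp.mem_support_iff.2 ha),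
    fun hx a ha => hx a (Finsupp.mem_support_iff.1 ha)⟩

theorem basis_mem_iff (h : IsAdapted b G S) (i : κ) (a : ι) : b a ∈ G i ↔ S i a := by
  classical
  rw [h.mem_iff]
  refine ⟨fun hS => hS a (by simp), fun hS a' ha' => ?_⟩
  rw [Module.Basis.repr_self, Finsupp.single_apply] at ha'
  split_ifs at ha' with haa'
  · rwa [← haa']
  · exact absurd rfl ha'

theorem finrank_eq [Fintype ι] (h : IsAdapted b G S) (i : κ) [DecidablePred (S i)] :
    Module.finrank K (G i) = (Finset.univ.filter (S i)).card := by
  classical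
  rw [h i]
  have himage : b '' {a | S i a} = Set.range fun a : {a // S i a} => b a := by
    ext x
    simp
  rw [himage, ← Fintype.card_subtype]
  exact finrank_span_eq_card (b.linearIndependent.comp _ Subtype.val_injective)

theorem inf {κ' : Type*} {G' : κ' → Submodule K V} {S' : κ' → ι → Prop} (h : IsAdapted b G S)
    (h' : IsAdapted b G' S') :
    IsAdapted b (fun i : κ × κ' => G i.1 ⊓ G' i.2) (fun i a => S i.1 a ∧ S' i.2 a) := by
  rintro ⟨i, i'⟩
  ext x
  rw [Submodule.mem_inf, h.mem_iff, h'.mem_iff, Module.Basis.mem_span_image]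
  constructor
  · rintro ⟨hx, heq⟩ a ha
    exact ⟨hx a (Finsupp.mem_support_iff.1 ha), heq a (Finsupp.mem_support_iff.1 ha)⟩
  · intro hx
    exact ⟨fun a ha => (hx (Finsupp.mem_support_iff.2 ha)).1,
      fun a ha => (hx (Finsupp.mem_support_iff.2 ha)).2⟩

theorem map {V' : Type*} [AddCommGroup V'] [Module K V'] (h : IsAdapted b G S) (g : V ≃ₗ[K] V') :
    IsAdapted (b.map g) (fun i => (G i).map (g : V →ₗ[K] V')) S := by
  intro i
  simp only [h i, Submodule.map_span]
  congr 1
  ext x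
  simp

end IsAdapted

theorem finrank_inf_ker_add_one [FiniteDimensional K V] {W : Submodule K V} {l : Module.Dual K V}
    {v : V} (hv : v ∈ W) (hlv : l v ≠ 0) :
    Module.finrank K (W ⊓ LinearMap.ker l : Submodule K V) + 1 = Module.finrank K W := by
  have hne : l ∘ₗ W.subtype ≠ 0 := fun h => hlv (LinearMap.congr_fun h ⟨v, hv⟩)
  rw [← Module.Dual.finrank_ker_add_one_of_ne_zero hne, LinearMap.ker_comp,
    ← Submodule.map_comap_subtype, Submodule.finrank_map_subtype_eq]

theorem inf_eq_span_image_cons {n : ℕ} {U W : Submodule K V} {v : V} {l : Module.Dual K V}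
    (hv : v ∈ W) (hlv : l v = 1) {v' : Fin n → V} {S : Fin (n + 1) → Prop}
    (hspan : U ⊓ (W ⊓ LinearMap.ker l) = Submodule.span K (v' '' {a | S a.succ}))
    (hU : S 0 → v ∈ U) (hker : ¬ S 0 → U ⊓ W ≤ LinearMap.ker l) :
    U ⊓ W = Submodule.span K (Fin.cons (α := fun _ => V) v v' '' {a | S a}) := by
  have hsucc : U ⊓ (W ⊓ LinearMap.ker l) ≤
      Submodule.span K (Fin.cons (α := fun _ => V) v v' '' {a | S a}) := by
    rw [hspan, Submodule.span_le]
    rintro _ ⟨a, ha, rfl⟩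
    exact Submodule.subset_span ⟨a.succ, ha, rfl⟩
  refine le_antisymm ?_ (Submodule.span_le.2 ?_)
  · rintro x ⟨hxU, hxW⟩
    by_cases hS : S 0
    · rw [← sub_add_cancel x (l x • v)]
      refine Submodule.add_mem _ (hsucc ⟨U.sub_mem hxU (U.smul_mem _ (hU hS)),
        W.sub_mem hxW (W.smul_mem _ hv), ?_⟩) (Submodule.smul_mem _ _
          (Submodule.subset_span ⟨0, hS, rfl⟩))
      simp [hlv]
    · exact hsucc ⟨hxU, hxW, hker hS ⟨hxU, hxW⟩⟩
  · rintro _ ⟨a, ha, rfl⟩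
    refine Fin.cases (fun hS => ⟨hU hS, hv⟩) (fun a ha => ?_) a ha
    have hmem : v' a ∈ U ⊓ (W ⊓ LinearMap.ker l) := hspan ▸ Submodule.subset_span ⟨a, ha, rfl⟩
    exact ⟨hmem.1, hmem.2.1⟩

theorem exists_mem_last_step_mem_first_step {d M : ℕ} {F : ℤ → Submodule K V} (hF0 : F 0 = ⊤)
    (hFd : ∀ p, (d : ℤ) < p → F p = ⊥) {f : ℕ → Submodule K V} (hf0 : f 0 = ⊥) (hfM : f M = ⊤)
    {W : Submodule K V} (hW : W ≠ ⊥) :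
    ∃ (v : V) (p₀ : ℤ) (j₀ : ℕ), v ∈ W ∧ v ∈ F p₀ ∧ (∀ p, p₀ < p → F p ⊓ W = ⊥) ∧
      v ∈ f (j₀ + 1) ∧ v ∉ f j₀ := by
  classical
  obtain ⟨p₀, hp₀, hgreatest⟩ := Int.exists_greatest_of_bdd (P := fun p => F p ⊓ W ≠ ⊥)
    ⟨d, fun p hp => not_lt.1 fun hlt => hp (by rw [hFd p hlt, bot_inf_eq])⟩
    ⟨0, by rwa [hF0, top_inf_eq]⟩
  have hex : ∃ j, f j ⊓ (F p₀ ⊓ W) ≠ ⊥ := ⟨M, by rwa [hfM, top_inf_eq]⟩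
  obtain ⟨j₀, hj₀⟩ : ∃ j₀, Nat.find hex = j₀ + 1 := by
    refine Nat.exists_eq_succ_of_ne_zero fun hzero => ?_
    have hspec := Nat.find_spec hex
    rw [hzero, hf0, bot_inf_eq] at hspec
    exact hspec rfl
  have hspec := Nat.find_spec hex
  rw [hj₀] at hspec
  have hmin : f j₀ ⊓ (F p₀ ⊓ W) = ⊥ :=
    not_not.1 (Nat.find_min hex (m := j₀) (by omega))
  obtain ⟨v, ⟨hvf, hvF, hvW⟩, hv0⟩ := Submodule.exists_mem_ne_zero_of_ne_bot hspec
  refine ⟨v, p₀, j₀, hvW, hvF, fun p hp => ?_, hvf, fun hv => hv0 ?_⟩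
  · by_contra hne
    exact hp.not_ge (hgreatest p hne)
  · rw [← Submodule.mem_bot K, ← hmin]
    exact ⟨hv, hvF, hvW⟩

theorem exists_dual_eq_one_of_notMem {U : Submodule K V} {v : V} (hv : v ∉ U) :
    ∃ l : Module.Dual K V, l v = 1 ∧ U ≤ LinearMap.ker l := by
  obtain ⟨l, hlv, hl⟩ := Submodule.exists_le_ker_of_notMem hv
  exact ⟨(l v)⁻¹ • l, inv_mul_cancel₀ hlv, fun x hx => by simp [LinearMap.mem_ker.1 (hl hx)]⟩

/- Induction on `W`: choose a vector in the last nonzero `F p ⊓ W` and in the first step of `f` that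
meets it, and pass to the kernel of a functional that vanishes on the step of `f` before. -/
theorem exists_adapted_family [FiniteDimensional K V] {d M : ℕ} {F : ℤ → Submodule K V}
    (hF : Antitone F) (hF0 : F 0 = ⊤) (hFd : ∀ p, (d : ℤ) < p → F p = ⊥)
    {f : ℕ → Submodule K V} (hf : Monotone f) (hf0 : f 0 = ⊥) (hfM : f M = ⊤) (n : ℕ) :
    ∀ W : Submodule K V, Module.finrank K W = n →
      ∃ (v : Fin n → V) (P : Fin n → ℤ) (J : Fin n → ℕ), LinearIndependent K v ∧
        (∀ p, F p ⊓ W = Submodule.span K (v '' {a | p ≤ P a})) ∧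
        (∀ j, f j ⊓ W = Submodule.span K (v '' {a | J a < j})) := by
  induction n with
  | zero =>
    intro W hW
    rw [Submodule.finrank_eq_zero] at hW
    subst hW
    refine ⟨Fin.elim0, Fin.elim0, Fin.elim0, linearIndependent_empty_type, fun p => ?_, fun j => ?_⟩
    · rw [Set.eq_empty_of_isEmpty {a : Fin 0 | _}]; simp
    · rw [Set.eq_empty_of_isEmpty {a : Fin 0 | _}]; simp
  | succ n ih =>
    intro W hW
    have hWne : W ≠ ⊥ := by
      rintro rfl
      simp at hW
    obtain ⟨v, p₀, j₀, hvW, hvF, hFW, hvf, hvf'⟩ :=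
      exists_mem_last_step_mem_first_step hF0 hFd hf0 hfM hWne
    obtain ⟨l, hlv, hl⟩ := exists_dual_eq_one_of_notMem hvf'
    have hfinrank := finrank_inf_ker_add_one hvW (hlv ▸ one_ne_zero : l v ≠ 0)
    obtain ⟨v', P, J, hv', hP, hJ⟩ := ih (W ⊓ LinearMap.ker l) (by omega)
    have hv'l (a) : v' a ∈ LinearMap.ker l := by
      have hmem : v' a ∈ F (P a) ⊓ (W ⊓ LinearMap.ker l) :=
        hP (P a) ▸ Submodule.subset_span ⟨a, le_refl (P a), rfl⟩
      exact hmem.2.2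
    refine ⟨Fin.cons v v', Fin.cons p₀ P, Fin.cons j₀ J, ?_, fun p => ?_, fun j => ?_⟩
    · refine linearIndependent_finCons.2 ⟨hv', fun hv => one_ne_zero (hlv.symm.trans ?_)⟩
      exact Submodule.span_le.2 (Set.range_subset_iff.2 hv'l) hv
    · refine inf_eq_span_image_cons hvW hlv (by simpa using hP p) (fun hp => hF hp hvF) fun hp => ?_
      rw [hFW p (not_le.1 hp)]
      exact bot_le
    · exact inf_eq_span_image_cons hvW hlv (by simpa using hJ j) (fun hj => hf hj hvf)
        fun hj => inf_le_left.trans ((hf (not_lt.1 hj)).trans hl)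

theorem exists_adapted_basis [FiniteDimensional K V] {d M : ℕ} {F : ℤ → Submodule K V}
    (hF : Antitone F) (hF0 : F 0 = ⊤) (hFd : ∀ p, (d : ℤ) < p → F p = ⊥)
    {f : ℕ → Submodule K V} (hf : Monotone f) (hf0 : f 0 = ⊥) (hfM : f M = ⊤) :
    ∃ (b : Module.Basis (Fin (Module.finrank K V)) K V) (P : Fin (Module.finrank K V) → ℤ)
      (J : Fin (Module.finrank K V) → ℕ),
      IsAdapted b F (fun p a => p ≤ P a) ∧ IsAdapted b f (fun j a => J a < j) := by
  obtain ⟨v, P, J, hli, hP, hJ⟩ := exists_adapted_family hF hF0 hFd hf hf0 hfM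
    (Module.finrank K V) ⊤ (finrank_top K V)
  have hspan : ⊤ ≤ Submodule.span K (Set.range v) := by
    have htop := hP 0
    rw [hF0, top_inf_eq] at htop
    rw [htop]
    exact Submodule.span_mono (Set.image_subset_range _ _)
  refine ⟨Module.Basis.mk hli hspan, P, J, fun p => ?_, fun j => ?_⟩
  · rw [Module.Basis.coe_mk, ← hP, inf_top_eq]
  · rw [Module.Basis.coe_mk, ← hJ, inf_top_eq]

end AdaptedBasis

section Skew

variable {K : Type*} [Field K] {V : Type*} [AddCommGroup V] [Module K V]

/-- The form `B` is symmetric if `ε = 1` and skew-symmetric if `ε = -1`. -/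
def IsEpsilonSymm (B : LinearMap.BilinForm K V) (ε : ℤˣ) : Prop :=
  ∀ v w, B w v = ((ε : ℤ) : K) * B v w

theorem isEpsilonSymm_one {B : LinearMap.BilinForm K V} (hB : B.IsSymm) : IsEpsilonSymm B 1 :=
  fun v w => by rw [Units.val_one, Int.cast_one, one_mul, hB.eq]

theorem isEpsilonSymm_neg_one {B : LinearMap.BilinForm K V} (hB : B.IsAlt) :
    IsEpsilonSymm B (-1) :=
  fun v w => by
    rw [Units.val_neg, Units.val_one, Int.cast_neg, Int.cast_one, neg_one_mul, hB.neg_eq]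

/-- The endomorphisms that are skew-adjoint for the form `B`. -/
def skew (B : LinearMap.BilinForm K V) : Submodule K (Module.End K V) where
  carrier := {X | ∀ v w, B (X v) w + B v (X w) = 0}
  zero_mem' := fun v w => by simp
  add_mem' := by
    intro X Y hX hY v w
    simp only [LinearMap.add_apply, map_add]
    linear_combination hX v w + hY v w
  smul_mem' := by
    intro a X hX v w
    simp only [LinearMap.smul_apply, map_smul, smul_eq_mul]
    linear_combination a * hX v w

/-- The skew-adjoint endomorphisms whose matrix of values `B (X b_a) b_{a'}` is supported on `Ω`. -/
def skewOn (B : LinearMap.BilinForm K V) {ι : Type*} (b : Module.Basis ι K V) (Ω : ι → ι → Prop) :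
    Submodule K (Module.End K V) where
  carrier := {X | X ∈ skew B ∧ ∀ a a', ¬ Ω a a' → B (X (b a)) (b a') = 0}
  zero_mem' := ⟨zero_mem _, fun a a' _ => by simp⟩
  add_mem' := by
    intro X Y hX hY
    refine ⟨add_mem hX.1 hY.1, fun a a' h => ?_⟩
    simp [hX.2 a a' h, hY.2 a a' h]
  smul_mem' := by
    intro c X hX
    refine ⟨Submodule.smul_mem _ c hX.1, fun a a' h => ?_⟩
    simp [hX.2 a a' h]

theorem units_int_cast_mul_self (ε : ℤˣ) : ((ε : ℤ) : K) * ((ε : ℤ) : K) = 1 := by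
  rw [← Int.cast_mul, ← Units.val_mul, Int.units_mul_self, Units.val_one, Int.cast_one]

theorem trace_funLeft {Q : Type*} [Fintype Q] [DecidableEq Q] (σ : Q → Q) :
    LinearMap.trace K (Q → K) (LinearMap.funLeft K K σ) =
      (Finset.univ.filter fun q => σ q = q).card := by
  rw [LinearMap.trace_eq_matrix_trace K (Pi.basisFun K Q), Matrix.trace, Finset.card_filter,
    Nat.cast_sum]
  refine Finset.sum_congr rfl fun q _ => ?_
  simp [LinearMap.funLeft_apply, Pi.single_apply]

/- The trace of the projection `(1 - ε σ) / 2` is its rank. -/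
theorem two_mul_finrank_ker_funLeft_add_smul_id [CharZero K] {Q : Type*} [Fintype Q]
    [DecidableEq Q] {σ : Q → Q} (hσ : Function.Involutive σ) (ε : ℤˣ) :
    2 * (Module.finrank K (LinearMap.ker
        (LinearMap.funLeft K K σ + ((ε : ℤ) : K) • LinearMap.id)) : ℤ) =
      Fintype.card Q - ε * (Finset.univ.filter fun q => σ q = q).card := by
  set T := LinearMap.funLeft K K σ
  have hT : ∀ f, T (T f) = f := fun f => funext fun q => congrArg f (hσ q)
  have hε := units_int_cast_mul_self (K := K) ε
  have hproj : LinearMap.IsProj (LinearMap.ker (T + ((ε : ℤ) : K) • LinearMap.id))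
      ((2 : K)⁻¹ • (LinearMap.id - ((ε : ℤ) : K) • T)) := by
    refine ⟨fun f => ?_, fun f hf => ?_⟩
    · simp only [LinearMap.mem_ker, LinearMap.add_apply, LinearMap.smul_apply, LinearMap.sub_apply,
        LinearMap.id_apply, map_smul, map_sub, hT]
      rw [smul_add, smul_smul, hε, one_smul, add_comm (T f), sub_self, smul_zero]
    · have hTf : T f = -(((ε : ℤ) : K) • f) := eq_neg_of_add_eq_zero_left hf
      simp only [LinearMap.smul_apply, LinearMap.sub_apply, LinearMap.id_apply, hTf, smul_neg,
        smul_smul, hε, one_smul, sub_neg_eq_add, ← two_smul K f,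
        inv_mul_cancel₀ (two_ne_zero (α := K))]
  have htrace := hproj.trace
  rw [map_smul, map_sub, map_smul, trace_funLeft, ← Module.End.one_eq_id, LinearMap.trace_one,
    Module.finrank_fintype_fun_eq_card, smul_eq_mul, smul_eq_mul,
    inv_mul_eq_iff_eq_mul₀ two_ne_zero] at htrace
  exact_mod_cast htrace.symm

variable {B : LinearMap.BilinForm K V} {ε : ℤˣ}

theorem skew_apply_comm (hB : IsEpsilonSymm B ε) {X : Module.End K V} (hX : X ∈ skew B)
    (v w : V) : B (X w) v = -((ε : ℤ) : K) * B (X v) w := by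
  rw [hB v (X w)]
  linear_combination ((ε : ℤ) : K) * hX v w

/-- An endomorphism is determined by its matrix of values `B (X b_a) b_{a'}`. -/
def endEquivGram [FiniteDimensional K V] (hnd : B.Nondegenerate) {ι : Type*} [Fintype ι]
    [DecidableEq ι] (b : Module.Basis ι K V) : Module.End K V ≃ₗ[K] Matrix ι ι K :=
  (LinearEquiv.congrRight (B.toDual hnd)).trans (LinearMap.toMatrix₂ b b)

theorem endEquivGram_apply [FiniteDimensional K V] (hnd : B.Nondegenerate) {ι : Type*}
    [Fintype ι] [DecidableEq ι] (b : Module.Basis ι K V) (X : Module.End K V) (a a' : ι) :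
    endEquivGram hnd b X a a' = B (X (b a)) (b a') :=
  LinearMap.toMatrix₂_apply b b _ a a'

theorem mem_skew_of_basis (hB : IsEpsilonSymm B ε) {ι : Type*} (b : Module.Basis ι K V)
    {X : Module.End K V}
    (hX : ∀ a a', B (X (b a')) (b a) = -((ε : ℤ) : K) * B (X (b a)) (b a')) : X ∈ skew B := by
  have hzero : B ∘ₗ X + B.compl₂ X = 0 := by
    refine b.ext fun a => b.ext fun a' => ?_
    simp only [LinearMap.add_apply, LinearMap.comp_apply, LinearMap.compl₂_apply,
      LinearMap.zero_apply]
    rw [hB (X (b a')) (b a), hX]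
    ring
  exact fun v w => LinearMap.congr_fun₂ hzero v w

/-- Skew-adjoint endomorphisms supported on a symmetric relation `Ω` are the functions on `Ω` that
the swap multiplies by `-ε`. -/
def skewOnEquiv [FiniteDimensional K V] (hnd : B.Nondegenerate) (hB : IsEpsilonSymm B ε)
    {ι : Type*} [Fintype ι] [DecidableEq ι] (b : Module.Basis ι K V) (Ω : ι → ι → Prop)
    (hΩ : ∀ a a', Ω a a' → Ω a' a) [DecidableRel Ω] :
    skewOn B b Ω ≃ₗ[K] LinearMap.ker (LinearMap.funLeft K K
      (fun q : {q : ι × ι // Ω q.1 q.2} => (⟨q.1.swap, hΩ _ _ q.2⟩ : {q : ι × ι // Ω q.1 q.2})) +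
        ((ε : ℤ) : K) • LinearMap.id) where
  toFun X := ⟨fun q => B ((X : Module.End K V) (b q.1.1)) (b q.1.2), funext fun q => by
    simpa [← eq_neg_iff_add_eq_zero] using skew_apply_comm hB X.2.1 (b q.1.1) (b q.1.2)⟩
  map_add' X Y := by ext q; simp
  map_smul' c X := by ext q; simp
  invFun f := ⟨(endEquivGram hnd b).symm (Matrix.of fun a a' => if h : Ω a a' then
      (f : {q : ι × ι // Ω q.1 q.2} → K) ⟨(a, a'), h⟩ else 0), by
    refine ⟨mem_skew_of_basis hB b fun a a' => ?_, fun a a' h => ?_⟩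
    · simp only [← endEquivGram_apply hnd b, LinearEquiv.apply_symm_apply, Matrix.of_apply]
      by_cases h : Ω a a'
      · rw [dif_pos h, dif_pos (hΩ a a' h)]
        have hf : f.1 ⟨(a', a), hΩ a a' h⟩ + ((ε : ℤ) : K) * f.1 ⟨(a, a'), h⟩ = 0 :=
          congrFun f.2 ⟨(a, a'), h⟩
        linear_combination hf
      · rw [dif_neg h, dif_neg fun h' => h (hΩ a' a h'), mul_zero]
    · simp [← endEquivGram_apply hnd b, h]⟩
  left_inv X := Subtype.ext <| (endEquivGram hnd b).injective <| by
    ext a a'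
    rw [LinearEquiv.apply_symm_apply, endEquivGram_apply]
    by_cases h : Ω a a'
    · simp [h]
    · simp [h, X.2.2 a a' h]
  right_inv f := by
    ext q
    simp [← endEquivGram_apply hnd b, q.2]

theorem two_mul_finrank_skewOn [CharZero K] [FiniteDimensional K V] (hnd : B.Nondegenerate)
    (hB : IsEpsilonSymm B ε) {ι : Type*} [Fintype ι] (b : Module.Basis ι K V) (Ω : ι → ι → Prop)
    (hΩ : ∀ a a', Ω a a' → Ω a' a) [DecidableRel Ω] :
    2 * (Module.finrank K (skewOn B b Ω) : ℤ) =
      ((Finset.univ : Finset (ι × ι)).filter fun q => Ω q.1 q.2).card -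
        ε * ((Finset.univ : Finset ι).filter fun a => Ω a a).card := by
  classical
  have hdiag : (Finset.univ.filter fun q : {q : ι × ι // Ω q.1 q.2} =>
      (⟨q.1.swap, hΩ _ _ q.2⟩ : {q : ι × ι // Ω q.1 q.2}) = q).card =
        ((Finset.univ : Finset ι).filter fun a => Ω a a).card := by
    refine Finset.card_bij' (fun q _ => q.1.1)
      (fun a ha => ⟨(a, a), (Finset.mem_filter.1 ha).2⟩) ?_ ?_ ?_ ?_
    · rintro ⟨⟨a, a'⟩, hΩaa'⟩ hq
      obtain rfl : a' = a := congrArg (fun q => q.1.1) (Finset.mem_filter.1 hq).2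
      simpa using hΩaa'
    · simp
    · rintro ⟨⟨a, a'⟩, hΩaa'⟩ hq
      obtain rfl : a' = a := congrArg (fun q => q.1.1) (Finset.mem_filter.1 hq).2
      rfl
    · exact fun _ _ => rfl
  rw [(skewOnEquiv hnd hB b Ω hΩ).finrank_eq, two_mul_finrank_ker_funLeft_add_smul_id
    (fun q => Subtype.ext (Prod.swap_swap q.1)), hdiag, Fintype.card_subtype]

end Skew

section PairSum

/-- The sum of `θ` over ordered pairs, corrected on the diagonal by the sign `ε`: for symmetric `θ`
it is twice the sum over unordered pairs, of distinct elements if `ε = 1`. -/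
def pairSum {ι : Type*} [Fintype ι] (ε : ℤˣ) (θ : ι → ι → ℤ) : ℤ :=
  ∑ a, ∑ a', θ a a' - ε * ∑ a, θ a a

variable {ι : Type*} [Fintype ι] {ε : ℤˣ}

theorem pairSum_add (θ θ' : ι → ι → ℤ) :
    pairSum ε (fun a a' => θ a a' + θ' a a') = pairSum ε θ + pairSum ε θ' := by
  simp only [pairSum, Finset.sum_add_distrib]
  ring

theorem pairSum_sub (θ θ' : ι → ι → ℤ) :
    pairSum ε (fun a a' => θ a a' - θ' a a') = pairSum ε θ - pairSum ε θ' := by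
  simp only [pairSum, Finset.sum_sub_distrib]
  ring

theorem pairSum_sum {κ : Type*} (t : Finset κ) (θ : κ → ι → ι → ℤ) :
    pairSum ε (fun a a' => ∑ k ∈ t, θ k a a') = ∑ k ∈ t, pairSum ε (θ k) := by
  classical
  induction t using Finset.induction_on with
  | empty => simp [pairSum]
  | insert k t hk ih => simp only [Finset.sum_insert hk, pairSum_add, ih]

theorem pairSum_mul (c : ℤ) (θ : ι → ι → ℤ) :
    pairSum ε (fun a a' => c * θ a a') = c * pairSum ε θ := by
  simp only [pairSum, ← Finset.mul_sum]
  ring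

theorem pairSum_comp (σ : Equiv.Perm ι) (θ : ι → ι → ℤ) :
    pairSum ε (fun a a' => θ (σ a) (σ a')) = pairSum ε θ := by
  simp only [pairSum]
  congr 1
  · rw [← Equiv.sum_comp σ (fun a => ∑ a', θ a a')]
    exact Finset.sum_congr rfl fun a _ => Equiv.sum_comp σ (fun a' => θ (σ a) a')
  · rw [Equiv.sum_comp σ (fun a => θ a a)]

theorem pairSum_nonneg {θ : ι → ι → ℤ} (hθ : ∀ a a', 0 ≤ θ a a') : 0 ≤ pairSum ε θ := by
  rw [pairSum, Finset.mul_sum, ← Finset.sum_sub_distrib]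
  refine Finset.sum_nonneg fun a _ => ?_
  have hdiag : θ a a ≤ ∑ a', θ a a' :=
    Finset.single_le_sum (fun a' _ => hθ a a') (Finset.mem_univ a)
  have := hθ a a
  rcases Int.units_eq_one_or ε with rfl | rfl <;> push_cast <;> linarith

theorem pairSum_mono {θ θ' : ι → ι → ℤ} (h : ∀ a a', θ a a' ≤ θ' a a') :
    pairSum ε θ ≤ pairSum ε θ' := by
  rw [← sub_nonneg, ← pairSum_sub]
  exact pairSum_nonneg fun a a' => sub_nonneg.2 (h a a')

theorem exists_perm_of_card_eq (J J' : ι → ℤ)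
    (h : ∀ k, (Finset.univ.filter fun a => J a < k).card =
      (Finset.univ.filter fun a => J' a < k).card) :
    ∃ σ : Equiv.Perm ι, ∀ a, J' (σ a) = J a := by
  have hsplit : ∀ (J : ι → ℤ) k, (Finset.univ.filter fun a => J a < k + 1).card =
      (Finset.univ.filter fun a => J a < k).card + Fintype.card {a // J a = k} := by
    intro J k
    rw [Fintype.card_subtype, Finset.card_filter, Finset.card_filter, Finset.card_filter,
      ← Finset.sum_add_distrib]
    refine Finset.sum_congr rfl fun a _ => ?_
    split_ifs <;> omega
  have hcard : ∀ k, Fintype.card {a // J a = k} = Fintype.card {a // J' a = k} := fun k => by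
    have := h k
    have := h (k + 1)
    rw [hsplit, hsplit] at this
    omega
  exact ⟨Equiv.ofFiberEquiv fun k => Fintype.equivOfCardEq (hcard k), Equiv.ofFiberEquiv_map _⟩

end PairSum

section HodgeNumbers

variable {K : Type*} [Field K] {V : Type*} [AddCommGroup V] [Module K V]
  {B : LinearMap.BilinForm K V} {ε : ℤˣ}

theorem finrank_subQuot [FiniteDimensional K V] {G H : Submodule K V} (h : H ≤ G) :
    Module.finrank K (SubQuot G H) + Module.finrank K H = Module.finrank K G := by
  have := Submodule.finrank_quotient_add_finrank (H.submoduleOf G)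
  rwa [(Submodule.submoduleOfEquivOfLe h).finrank_eq] at this

theorem IsEpsilonSymm.isRefl (hB : IsEpsilonSymm B ε) : B.IsRefl := fun v w h => by
  rw [hB, h, mul_zero]

theorem mem_lieGAut_of_mem_skew {X : Module.End K V} (hX : X ∈ skew B) : X ∈ lieGAut B :=
  ⟨0, fun v w => by rw [hX v w, zero_mul]⟩

theorem one_mem_lieGAut : (1 : Module.End K V) ∈ lieGAut B :=
  ⟨2, fun v w => by rw [Module.End.one_apply, Module.End.one_apply, two_mul]⟩

theorem one_notMem_skew [CharZero K] [Nontrivial V] (hnd : B.Nondegenerate) :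
    (1 : Module.End K V) ∉ skew B := by
  intro hone
  obtain ⟨v, hv⟩ := exists_ne (0 : V)
  refine hv (hnd.1 _ fun w => ?_)
  have : (2 : K) * B v w = 0 := (two_mul (B v w)).trans (hone v w)
  exact (mul_eq_zero.1 this).resolve_left two_ne_zero

theorem disjoint_skew_span_one [CharZero K] [Nontrivial V] (hnd : B.Nondegenerate) :
    Disjoint (skew B) (Submodule.span K {(1 : Module.End K V)}) :=
  (Submodule.disjoint_span_singleton' one_ne_zero).2 (one_notMem_skew hnd)

theorem adjFil_antitone {F : ℤ → Submodule K V} (hF : Antitone F) : Antitone (adjFil B F) :=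
  fun _ _ hpq _ hX => ⟨hX.1, fun i v hv => hF (by omega) (hX.2 i v hv)⟩

theorem skew_inf_adjFil_sup_span_one [CharZero K] {F : ℤ → Submodule K V} (hF : Antitone F)
    {p : ℤ} (hp : p ≤ 0) :
    (skew B ⊓ adjFil B F p) ⊔ Submodule.span K {(1 : Module.End K V)} = adjFil B F p := by
  have hone : (1 : Module.End K V) ∈ adjFil B F p :=
    ⟨one_mem_lieGAut, fun i v hv => hF (by omega) hv⟩
  refine le_antisymm (sup_le inf_le_right ((Submodule.span_singleton_le_iff_mem _ _).2 hone))
    fun X hX => ?_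
  obtain ⟨c, hc⟩ := hX.1
  rw [← sub_add_cancel X ((c / 2) • (1 : Module.End K V))]
  refine Submodule.add_mem_sup ⟨fun v w => ?_, Submodule.sub_mem _ hX
    (Submodule.smul_mem _ _ hone)⟩ (Submodule.smul_mem _ _ (Submodule.mem_span_singleton_self _))
  simp only [LinearMap.sub_apply, LinearMap.smul_apply, Module.End.one_apply, map_sub,
    map_smul, smul_eq_mul]
  linear_combination hc v w

section SelfDual

variable {d : ℕ} {F : ℤ → Submodule K V}

theorem IsSelfDualFiltration.mem_iff (hF : IsSelfDualFiltration B d F) (p : ℤ) (x : V) :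
    x ∈ F p ↔ ∀ w ∈ F (d + 1 - p), B w x = 0 := by
  have hdual := hF.self_dual (d + 1 - p)
  rw [sub_sub_cancel] at hdual
  rw [hdual]
  rfl

theorem IsSelfDualFiltration.exists_ne_bot [Nontrivial V] (hF : IsSelfDualFiltration B d F) :
    ∃ p, F p ≠ ⊥ ∧ F (p + 1) = ⊥ := by
  obtain ⟨p, hp, hmax⟩ := Int.exists_greatest_of_bdd (P := fun p => F p ≠ ⊥)
    ⟨d, fun p hp => not_lt.1 fun hlt => hp (hF.eq_bot p hlt)⟩
    ⟨0, by rw [hF.eq_top 0 le_rfl]; exact top_ne_bot⟩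
  exact ⟨p, hp, not_not.1 fun hne => absurd (hmax _ hne) (by omega)⟩

/- Let `F q` be the last nonzero step, so that `F (d - q)` is everything. An `X` of positive degree
kills `F q` and maps everything into the orthogonal complement of `F q`, so its multiplier is
zero. -/
theorem IsSelfDualFiltration.adjFil_le_skew_of_pos (hF : IsSelfDualFiltration B d F)
    (hnd : B.Nondegenerate) {p : ℤ} (hp : 0 < p) : adjFil B F p ≤ skew B := by
  rintro X ⟨⟨c, hc⟩, hX⟩ v w
  obtain hV | hV := subsingleton_or_nontrivial V
  · simp [Subsingleton.elim v 0]
  obtain ⟨q, hq, hq'⟩ := hF.exists_ne_bot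
  obtain ⟨u, hu, hu0⟩ := (Submodule.ne_bot_iff _).1 hq
  have htop : F (d - q) = ⊤ := by
    have hdual := hF.self_dual (q + 1)
    rwa [hq', LinearMap.BilinForm.orthogonal_bot, add_sub_add_right_eq_sub] at hdual
  have hXu : X u = 0 := by
    have := hF.antitone (show q + 1 ≤ q + p by omega) (hX q u hu)
    rwa [hq'] at this
  have hXorth : ∀ y, B u (X y) = 0 := fun y => by
    have hmem : X y ∈ F (d + 1 - q) := hF.antitone (show (d : ℤ) + 1 - q ≤ d - q + p by omega)
      (hX _ y (htop ▸ Submodule.mem_top))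
    rw [hF.self_dual] at hmem
    exact hmem u hu
  have hc0 : c = 0 := by
    by_contra hc0
    refine hu0 (hnd.1 _ fun y => ?_)
    have := hc u y
    rw [hXu, hXorth, map_zero, LinearMap.zero_apply, add_zero] at this
    exact (mul_eq_zero.1 this.symm).resolve_left hc0
  rw [hc, hc0, zero_mul]

theorem IsSelfDualFiltration.finrank_adjFil [CharZero K] [FiniteDimensional K V] [Nontrivial V]
    (hF : IsSelfDualFiltration B d F) (hnd : B.Nondegenerate) (p : ℤ) :
    Module.finrank K (adjFil B F p) =
      Module.finrank K (skew B ⊓ adjFil B F p : Submodule K (Module.End K V)) +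
        if p ≤ 0 then 1 else 0 := by
  split_ifs with hp
  · have hdim := Submodule.finrank_sup_add_finrank_inf_eq (skew B ⊓ adjFil B F p)
      (Submodule.span K {(1 : Module.End K V)})
    rwa [skew_inf_adjFil_sup_span_one hF.antitone hp,
      ((disjoint_skew_span_one hnd).mono_left inf_le_left).eq_bot, finrank_bot, add_zero,
      finrank_span_singleton one_ne_zero] at hdim
  · rw [inf_eq_right.2 (hF.adjFil_le_skew_of_pos hnd (not_le.1 hp)), add_zero]

end SelfDual

section Adapted

variable {d : ℕ} {F : ℤ → Submodule K V} {ι : Type*} {b : Module.Basis ι K V} {P : ι → ℤ}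

theorem IsSelfDualFiltration.adapted_bounds (hF : IsSelfDualFiltration B d F)
    (hP : IsAdapted b F (fun p a => p ≤ P a)) (a : ι) : 0 ≤ P a ∧ P a ≤ d := by
  constructor
  · rw [← hP.basis_mem_iff, hF.eq_top 0 le_rfl]
    exact Submodule.mem_top
  · by_contra hlt
    have hmem : b a ∈ F (P a) := (hP.basis_mem_iff _ _).2 le_rfl
    rw [hF.eq_bot _ (not_le.1 hlt)] at hmem
    exact b.ne_zero a hmem

theorem skew_inf_adjFil_eq_skewOn (hB : IsEpsilonSymm B ε) (hF : IsSelfDualFiltration B d F)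
    (hP : IsAdapted b F (fun p a => p ≤ P a)) (p : ℤ) :
    skew B ⊓ adjFil B F p = skewOn B b (fun a a' => P a + P a' ≤ d - p) := by
  ext X
  constructor
  · rintro ⟨hX, -, hXF⟩
    refine ⟨hX, fun a a' haa' => ?_⟩
    rw [hB.isRefl.eq_iff]
    exact (hF.mem_iff _ _).1 (hXF (P a) (b a) ((hP.basis_mem_iff _ _).2 le_rfl)) _
      ((hP.basis_mem_iff _ _).2 (by omega))
  · rintro ⟨hX, hXΩ⟩
    refine ⟨hX, mem_lieGAut_of_mem_skew hX, fun i v hv => (hF.mem_iff _ _).2 fun w hw => ?_⟩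
    rw [hB.isRefl.eq_iff]
    rw [hP] at hv hw
    refine LinearMap.BilinMap.apply_apply_mem_of_mem_span ⊥ _ _ (B ∘ₗ X) ?_ _ _ hv hw
    rintro _ ⟨a, ha, rfl⟩ _ ⟨a', ha', rfl⟩
    rw [Set.mem_ofPred_eq] at ha ha'
    exact hXΩ a a' (by omega)

variable [CharZero K] [FiniteDimensional K V] [Fintype ι]

theorem two_mul_finrank_skewOn_eq_pairSum (hnd : B.Nondegenerate) (hB : IsEpsilonSymm B ε)
    (b : Module.Basis ι K V) (Ω : ι → ι → Prop) (hΩ : ∀ a a', Ω a a' → Ω a' a)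
    [DecidableRel Ω] :
    2 * (Module.finrank K (skewOn B b Ω) : ℤ) =
      pairSum ε (fun a a' => if Ω a a' then 1 else 0) := by
  simp only [two_mul_finrank_skewOn hnd hB b Ω hΩ, pairSum, Finset.card_filter, Nat.cast_sum,
    Nat.cast_ite, Nat.cast_one, Nat.cast_zero, ← Finset.univ_product_univ, Finset.sum_product]

theorem two_mul_finrank_adjFil [Nontrivial V] (hnd : B.Nondegenerate) (hB : IsEpsilonSymm B ε)
    (hF : IsSelfDualFiltration B d F) (hP : IsAdapted b F (fun p a => p ≤ P a)) (p : ℤ) :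
    2 * (Module.finrank K (adjFil B F p) : ℤ) =
      pairSum ε (fun a a' => if P a + P a' ≤ d - p then 1 else 0) + if p ≤ 0 then 2 else 0 := by
  rw [hF.finrank_adjFil hnd, skew_inf_adjFil_eq_skewOn hB hF hP, Nat.cast_add, mul_add,
    two_mul_finrank_skewOn_eq_pairSum hnd hB b _ fun a a' h => by omega]
  split_ifs <;> rfl

theorem two_mul_hodge [Nontrivial V] (hnd : B.Nondegenerate) (hB : IsEpsilonSymm B ε)
    (hF : IsSelfDualFiltration B d F) (hP : IsAdapted b F (fun p a => p ≤ P a)) (p : ℤ) :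
    2 * (hodge B F p : ℤ) =
      pairSum ε (fun a a' => if (d : ℤ) - P a - P a' = p then 1 else 0) +
        if p = 0 then 2 else 0 := by
  have hgr := finrank_subQuot (adjFil_antitone (B := B) hF.antitone (Int.le_add_one (le_refl p)))
  have hdim := two_mul_finrank_adjFil hnd hB hF hP p
  have hdim' := two_mul_finrank_adjFil hnd hB hF hP (p + 1)
  have hpair : pairSum ε (fun a a' => if (d : ℤ) - P a - P a' = p then 1 else 0) =
      pairSum ε (fun a a' => if P a + P a' ≤ (d : ℤ) - p then 1 else 0) -
      pairSum ε (fun a a' => if P a + P a' ≤ (d : ℤ) - (p + 1) then 1 else 0) := by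
    rw [← pairSum_sub]
    congr 1
    funext a a'
    split_ifs <;> omega
  rw [hodge, hpair]
  split_ifs at hdim hdim' ⊢ <;> omega

end Adapted

end HodgeNumbers

section FlagCombinatorics

variable {K : Type*} [Field K] {V : Type*} [AddCommGroup V] [Module K V]
  {B : LinearMap.BilinForm K V} {d m : ℕ} {F : ℤ → Submodule K V} {f : ℕ → Submodule K V}

theorem finrank_orthogonal_add [FiniteDimensional K V] (hnd : B.Nondegenerate)
    (W : Submodule K V) :
    Module.finrank K (B.orthogonal W) + Module.finrank K W = Module.finrank K V := by
  rw [LinearMap.BilinForm.finrank_orthogonal hnd, Nat.sub_add_cancel (Submodule.finrank_le W)]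

theorem IsSelfDualFlag.eq_top_of_le (hf : IsSelfDualFlag B m f) {i : ℕ} (hi : 2 * m + 1 ≤ i) :
    f i = ⊤ :=
  top_le_iff.1 (hf.eq_top ▸ hf.monotone hi)

theorem IsSelfDualFlag.isSelfDualFiltration (hf : IsSelfDualFlag B m f) :
    IsSelfDualFiltration B (2 * m) fun p => f (2 * m + 1 - p).toNat where
  antitone p q hpq := hf.monotone (by omega)
  eq_top p hp := hf.eq_top_of_le (by omega)
  eq_bot p hp := by
    rw [show (2 * m + 1 - p).toNat = 0 by push_cast at hp; omega, hf.eq_bot]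
  self_dual p := by
    rw [show 2 * (m : ℤ) + 1 - ((2 * m : ℕ) + 1 - p) = p by push_cast; ring]
    rcases lt_or_ge p 0 with hneg | hnonneg
    · rw [hf.eq_top_of_le (i := (2 * m + 1 - p).toNat) (by omega), ← hf.eq_top,
        ← hf.self_dual _ le_rfl, Nat.sub_self, Int.toNat_of_nonpos hneg.le]
    rcases le_or_gt p (2 * m + 1) with hle | hgt
    · rw [← hf.self_dual _ (by omega)]
      congr 1
      omega
    · rw [show (2 * m + 1 - p).toNat = 0 by omega, ← hf.self_dual 0 (Nat.zero_le _),
        hf.eq_top_of_le (by omega), hf.eq_top_of_le (by omega)]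

theorem finrank_inducedFil_add [FiniteDimensional K V] (hf : Monotone f) (k : ℕ) (p : ℤ) :
    Module.finrank K (inducedFil F f k p) + Module.finrank K (F p ⊓ f k : Submodule K V) =
      Module.finrank K (F p ⊓ f (k + 1) : Submodule K V) := by
  let N := (F p).submoduleOf (f (k + 1))
  let ψ : N →ₗ[K] V := (f (k + 1)).subtype ∘ₗ N.subtype
  have hψ : Function.Injective ψ := Subtype.val_injective.comp Subtype.val_injective
  have hrange : LinearMap.range ψ = F p ⊓ f (k + 1) := by
    rw [LinearMap.range_comp, Submodule.range_subtype, inf_comm]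
    exact Submodule.map_comap_subtype (f (k + 1)) (F p)
  have hker : (LinearMap.ker ((toGr f k).domRestrict N)).map ψ = F p ⊓ f k := by
    ext x
    constructor
    · rintro ⟨⟨⟨y, hy⟩, hyN⟩, hker, rfl⟩
      exact ⟨hyN, (Submodule.Quotient.mk_eq_zero ((f k).submoduleOf (f (k + 1)))).1 hker⟩
    · rintro ⟨hxF, hxf⟩
      exact ⟨⟨⟨x, hf (Nat.le_succ k) hxf⟩, hxF⟩, (Submodule.Quotient.mk_eq_zero _).2 hxf, rfl⟩
  have hdim := LinearMap.finrank_range_add_finrank_ker ((toGr f k).domRestrict N)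
  rwa [LinearMap.range_domRestrict, (Submodule.equivMapOfInjective ψ hψ _).finrank_eq, hker,
    ← LinearMap.finrank_range_of_inj hψ, hrange] at hdim

variable {ι : Type*} {b : Module.Basis ι K V} {P : ι → ℤ} {J : ι → ℕ}

theorem IsSelfDualFlag.adapted_le (hf : IsSelfDualFlag B m f)
    (hJ : IsAdapted b f (fun j a => J a < j)) (a : ι) : J a ≤ 2 * m := by
  rw [← Nat.lt_succ_iff, ← hJ.basis_mem_iff, hf.eq_top]
  exact Submodule.mem_top

theorem IsSelfDualFiltration.exists_perm [Finite ι] [FiniteDimensional K V] (hnd : B.Nondegenerate)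
    (hF : IsSelfDualFiltration B d F) (hP : IsAdapted b F (fun p a => p ≤ P a)) :
    ∃ σ : Equiv.Perm ι, ∀ a, P (σ a) = d - P a := by
  cases nonempty_fintype ι
  refine exists_perm_of_card_eq (fun a => (d : ℤ) - P a) P fun k => ?_
  have hdual := finrank_orthogonal_add hnd (F k)
  rw [← hF.self_dual, hP.finrank_eq, hP.finrank_eq, Module.finrank_eq_card_basis b] at hdual
  have hcompl := Finset.card_filter_add_card_filter_not (s := (Finset.univ : Finset ι))
    (fun a => P a < k)
  simp only [not_lt, Finset.card_univ] at hcompl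
  rw [Finset.filter_congr fun a _ => show (d : ℤ) - P a < k ↔ d + 1 - k ≤ P a by omega]
  omega

theorem IsSelfDualFlag.exists_perm [Finite ι] [FiniteDimensional K V] (hnd : B.Nondegenerate)
    (hf : IsSelfDualFlag B m f) (hJ : IsAdapted b f (fun j a => J a < j)) :
    ∃ σ : Equiv.Perm ι, ∀ a, (J (σ a) : ℤ) = 2 * m - J a := by
  have hadapted : IsAdapted b (fun p : ℤ => f (2 * m + 1 - p).toNat)
      fun p a => p ≤ 2 * m - J a := fun p => by
    refine (hJ _).trans ?_
    congr! 4 with a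
    omega
  obtain ⟨σ, hσ⟩ := hf.isSelfDualFiltration.exists_perm hnd hadapted
  refine ⟨σ, fun a => ?_⟩
  have := hσ a
  push_cast at this
  omega

variable [Fintype ι]

theorem finrank_gr [FiniteDimensional K V] (hf : Monotone f)
    (hJ : IsAdapted b f (fun j a => J a < j)) (k : ℕ) :
    Module.finrank K (Gr f k) = (Finset.univ.filter fun a => J a = k).card := by
  have hdim : Module.finrank K (Gr f k) + Module.finrank K (f k) =
      Module.finrank K (f (k + 1)) := finrank_subQuot (hf (Nat.le_succ k))
  have hcard : (Finset.univ.filter fun a => J a < k + 1).card =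
      (Finset.univ.filter fun a => J a = k).card + (Finset.univ.filter fun a => J a < k).card := by
    simp only [Finset.card_filter, ← Finset.sum_add_distrib]
    refine Finset.sum_congr rfl fun a _ => ?_
    split_ifs <;> omega
  rw [hJ.finrank_eq, hJ.finrank_eq] at hdim
  omega

theorem finrank_inducedFil [FiniteDimensional K V] (hf : Monotone f)
    (hP : IsAdapted b F (fun p a => p ≤ P a)) (hJ : IsAdapted b f (fun j a => J a < j))
    (k : ℕ) (p : ℤ) :
    Module.finrank K (inducedFil F f k p) =
      (Finset.univ.filter fun a => J a = k ∧ p ≤ P a).card := by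
  have hdim := finrank_inducedFil_add (F := F) hf k p
  have hdim_k := (hP.inf hJ).finrank_eq (p, k)
  have hdim_succ := (hP.inf hJ).finrank_eq (p, k + 1)
  have hcard : (Finset.univ.filter fun a => p ≤ P a ∧ J a < k + 1).card =
      (Finset.univ.filter fun a => J a = k ∧ p ≤ P a).card +
      (Finset.univ.filter fun a => p ≤ P a ∧ J a < k).card := by
    simp only [Finset.card_filter, ← Finset.sum_add_distrib]
    refine Finset.sum_congr rfl fun a _ => ?_
    split_ifs <;> omega
  simp only at hdim_k hdim_succ
  omega

theorem finrank_gr_inducedFil [FiniteDimensional K V] (hF : Antitone F) (hf : Monotone f)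
    (hP : IsAdapted b F (fun p a => p ≤ P a)) (hJ : IsAdapted b f (fun j a => J a < j))
    (k : ℕ) (p : ℤ) :
    Module.finrank K (SubQuot (inducedFil F f k p) (inducedFil F f k (p + 1))) =
      (Finset.univ.filter fun a => J a = k ∧ P a = p).card := by
  have hle : inducedFil F f k (p + 1) ≤ inducedFil F f k p :=
    Submodule.map_mono (Submodule.comap_mono (hF (Int.le_add_one (le_refl p))))
  have hdim := finrank_subQuot hle
  have hcard : (Finset.univ.filter fun a => J a = k ∧ p ≤ P a).card =
      (Finset.univ.filter fun a => J a = k ∧ P a = p).card +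
        (Finset.univ.filter fun a => J a = k ∧ p + 1 ≤ P a).card := by
    simp only [Finset.card_filter, ← Finset.sum_add_distrib]
    refine Finset.sum_congr rfl fun a _ => ?_
    split_ifs <;> omega
  rw [finrank_inducedFil hf hP hJ, finrank_inducedFil hf hP hJ] at hdim
  omega

theorem weight_inducedFil [FiniteDimensional K V] (hF : IsSelfDualFiltration B d F)
    (hf : Monotone f) (hP : IsAdapted b F (fun p a => p ≤ P a))
    (hJ : IsAdapted b f (fun j a => J a < j)) (k : ℕ) :
    weight d (inducedFil F f k) = (∑ a with J a = k, (P a : ℚ)) /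
      (Finset.univ.filter fun a => J a = k).card := by
  have hP_nonneg := fun a => (hF.adapted_bounds hP a).1
  rw [weight, finrank_gr hf hJ, ← Finset.sum_fiberwise_of_maps_to (g := fun a => (P a).toNat)
    (t := Finset.range (d + 1)) fun a _ => Finset.mem_range.2 (by
      have := hF.adapted_bounds hP a
      omega)]
  congr 1
  refine Finset.sum_congr rfl fun p _ => ?_
  rw [finrank_gr_inducedFil hF.antitone hf hP hJ, Finset.filter_filter, mul_comm, ← nsmul_eq_mul,
    ← Finset.sum_const]
  refine Finset.sum_congr (Finset.filter_congr fun a _ => ?_) fun a ha => ?_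
  · have := hP_nonneg a
    omega
  · rw [← (Finset.mem_filter.1 ha).2.2]
    exact_mod_cast Int.toNat_of_nonneg (hP_nonneg a)

theorem sum_sub_two_mul_eq_zero_of_weight [FiniteDimensional K V]
    (hF : IsSelfDualFiltration B d F) (hf : Monotone f)
    (hP : IsAdapted b F (fun p a => p ≤ P a)) (hJ : IsAdapted b f (fun j a => J a < j)) {k : ℕ}
    (hweight : Nontrivial (Gr f k) → weight d (inducedFil F f k) = (d : ℚ) / 2) :
    ∑ a with J a = k, ((d : ℤ) - 2 * P a) = 0 := by
  rcases Finset.eq_empty_or_nonempty (Finset.univ.filter fun a => J a = k) with h | h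
  · rw [h, Finset.sum_empty]
  have hcard := h.card_pos
  have hk := hweight (Module.finrank_pos_iff.1 (by rwa [finrank_gr hf hJ]))
  rw [weight_inducedFil hF hf hP hJ, div_eq_div_iff (by positivity) two_ne_zero] at hk
  rw [Finset.sum_sub_distrib, ← Finset.mul_sum, Finset.sum_const, nsmul_eq_mul, sub_eq_zero]
  exact_mod_cast (mul_comm _ _).trans (hk.symm.trans (mul_comm _ _))

variable {ε : ℤˣ}

/- Since `θ` sums to zero over every fibre of `J`, each row sum of `θ a + θ a'` over the pairs with
`2 m < J a + J a'` vanishes, and so does the diagonal sum. -/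
theorem pairSum_ite_lt_add_eq_zero {θ : ι → ℤ} (hθ : ∀ k, ∑ a with J a = k, θ a = 0) (M : ℕ) :
    pairSum ε (fun a a' => if M < J a + J a' then θ a + θ a' else 0) = 0 := by
  have hfib : ∀ g : ℕ → ℤ, ∑ a, g (J a) * θ a = 0 := fun g => by
    rw [← Finset.sum_fiberwise_of_maps_to (t := Finset.univ.image J)
      fun a ha => Finset.mem_image_of_mem J ha]
    refine Finset.sum_eq_zero fun k _ => ?_
    rw [← mul_zero (g k), ← hθ k, Finset.mul_sum]
    exact Finset.sum_congr rfl fun a ha => by rw [(Finset.mem_filter.1 ha).2]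
  have hdiag : ∑ a, (if M < J a + J a then θ a + θ a else 0) = 0 := by
    simpa [ite_mul, ← two_mul] using hfib fun k => if M < k + k then 2 else 0
  have hrow : ∀ a, ∑ a', (if M < J a + J a' then θ a' else 0) = 0 := fun a => by
    simpa [ite_mul] using hfib fun k => if M < J a + k then 1 else 0
  have hcol : ∑ a, ∑ a', (if M < J a + J a' then θ a else 0) = 0 := by
    rw [Finset.sum_comm]
    refine Finset.sum_eq_zero fun a' _ => (Finset.sum_congr rfl fun a _ => ?_).trans (hrow a')
    rw [add_comm]
  have hsplit : ∀ a a', (if M < J a + J a' then θ a + θ a' else 0) =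
      (if M < J a + J a' then θ a else 0) + if M < J a + J a' then θ a' else 0 := fun a a' => by
    split_ifs <;> ring
  rw [pairSum, hdiag]
  simp only [hsplit, Finset.sum_add_distrib, hrow, hcol, add_zero, mul_zero, sub_zero]

theorem two_mul_pairSum_lt_add_le {M : ℕ} {σ : Equiv.Perm ι}
    (hσ : ∀ a, (J (σ a) : ℤ) = M - J a) :
    2 * pairSum ε (fun a a' => if M < J a + J a' then 1 else 0) ≤
      pairSum ε (fun _ _ : ι => 1) := by
  have hcomp := pairSum_comp (ε := ε) σ (fun a a' => if M < J a + J a' then 1 else 0)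
  rw [two_mul]
  nth_rw 2 [← hcomp]
  rw [← pairSum_add]
  refine pairSum_mono fun a a' => ?_
  have := hσ a
  have := hσ a'
  split_ifs <;> omega

end FlagCombinatorics

section Numerics

open Finset

theorem sum_Icc_neg_eq {M : Type*} [AddCommMonoid M] (d : ℕ) (g : ℤ → M) :
    ∑ p ∈ Icc (-(d : ℤ)) d, g p =
      ∑ p ∈ Icc (1 : ℤ) d, g (-p) + (g 0 + ∑ p ∈ Icc (1 : ℤ) d, g p) := by
  have hsplit : Icc (-(d : ℤ)) d =
      (Icc (1 : ℤ) d).image (fun p => -p) ∪ (insert 0 (Icc (1 : ℤ) d)) := by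
    ext p
    simp only [mem_Icc, mem_union, mem_image, mem_insert]
    constructor
    · intro hp
      rcases lt_trichotomy p 0 with hneg | hzero | hpos
      · exact Or.inl ⟨-p, by omega, by omega⟩
      · exact Or.inr (Or.inl hzero)
      · exact Or.inr (Or.inr (by omega))
    · rintro (⟨q, hq, rfl⟩ | rfl | hp) <;> omega
  rw [hsplit, sum_union, sum_image (fun a _ b _ hab => neg_injective hab), sum_insert (by simp)]
  rw [disjoint_left]
  intro p hp hp'
  simp only [mem_Icc, mem_image, mem_insert] at hp hp'
  obtain ⟨q, hq, rfl⟩ := hp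
  omega

theorem sum_mul_eq_sum_sum (d : ℕ) (c : ℤ → ℝ) :
    ∑ p ∈ Icc (1 : ℤ) d, (p : ℝ) * c p = ∑ k ∈ Icc (1 : ℤ) d, ∑ p ∈ Icc k d, c p := by
  rw [sum_comm' (t' := Icc (1 : ℤ) d) (s' := fun p => Icc 1 p)
    fun k p => by simp only [mem_Icc]; omega]
  refine sum_congr rfl fun p hp => ?_
  rw [mem_Icc] at hp
  rw [sum_const, nsmul_eq_mul, Int.card_Icc, add_sub_cancel_right]
  congr 1
  exact_mod_cast (Int.toNat_of_nonneg (by omega : 0 ≤ p)).symm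

variable {d : ℕ} {h : ℤ → ℕ} {x : ℝ}

/-- The multiplicity of `p` among the `x` largest members of the list in which each `q ≤ d` occurs
`h q` times: the summands of `topSum` are `p * topCount d h x p`. -/
def topCount (d : ℕ) (h : ℤ → ℕ) (x : ℝ) (p : ℤ) : ℝ :=
  max 0 (min (h p : ℝ) (x - ∑ q ∈ Ioc p (d : ℤ), (h q : ℝ)))

theorem topSum_eq_sum_topCount (hx : x ≤ h 0 + ∑ p ∈ Icc (1 : ℤ) d, (h p : ℝ)) :
    topSum d h x = ∑ p ∈ Icc (1 : ℤ) d, (p : ℝ) * topCount d h x p := by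
  have hneg : ∑ p ∈ Icc (1 : ℤ) d, ((-p : ℤ) : ℝ) * topCount d h x (-p) = 0 := by
    refine sum_eq_zero fun p hp => ?_
    have hle : (h 0 : ℝ) + ∑ q ∈ Icc (1 : ℤ) d, (h q : ℝ) ≤
        ∑ q ∈ Ioc (-p) (d : ℤ), (h q : ℝ) := by
      rw [← sum_insert (f := fun q => (h q : ℝ)) (by simp)]
      refine sum_le_sum_of_subset_of_nonneg (fun q hq => ?_) fun q _ _ => by positivity
      simp only [mem_insert, mem_Icc, mem_Ioc] at hp hq ⊢
      omega
    rw [topCount, max_eq_left ((min_le_right _ _).trans (by linarith)), mul_zero]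
  exact (sum_Icc_neg_eq d fun p : ℤ => (p : ℝ) * topCount d h x p).trans
    (by rw [hneg, Int.cast_zero, zero_mul, zero_add, zero_add])

theorem sum_topCount_eq_min (hx : 0 ≤ x) {k : ℤ} (hk : k ≤ d + 1) :
    ∑ p ∈ Icc k (d : ℤ), topCount d h x p = min x (∑ p ∈ Icc k (d : ℤ), (h p : ℝ)) := by
  induction k, hk using Int.leInductionDown with
  | base => simp [hx]
  | pred k hk ih =>
    have hIcc : Icc (k - 1) (d : ℤ) = insert (k - 1) (Icc k (d : ℤ)) := by
      ext p
      simp only [mem_Icc, mem_insert]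
      omega
    have hIoc : Ioc (k - 1) (d : ℤ) = Icc k (d : ℤ) := by
      rw [← Icc_add_one_left_eq_Ioc, sub_add_cancel]
    have hnotMem : k - 1 ∉ Icc k (d : ℤ) := by simp
    rw [hIcc, sum_insert hnotMem, sum_insert hnotMem, ih, topCount, hIoc]
    have hmult : (0 : ℝ) ≤ h (k - 1) := by positivity
    generalize ∑ p ∈ Icc k (d : ℤ), (h p : ℝ) = total
    generalize (h (k - 1) : ℝ) = mult at hmult
    grind

/- Both sides are sums of tail sums over `p ≥ k`; that of `topCount` is the largest value allowed by
the two constraints on `c`. -/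
theorem sum_le_topSum {c : ℤ → ℝ} (hc_nonneg : ∀ p ∈ Icc (1 : ℤ) d, 0 ≤ c p)
    (hc_le : ∀ p ∈ Icc (1 : ℤ) d, c p ≤ h p) (hcx : ∑ p ∈ Icc (1 : ℤ) d, c p ≤ x)
    (hx : x ≤ h 0 + ∑ p ∈ Icc (1 : ℤ) d, (h p : ℝ)) :
    ∑ p ∈ Icc (1 : ℤ) d, (p : ℝ) * c p ≤ topSum d h x := by
  rw [topSum_eq_sum_topCount hx, sum_mul_eq_sum_sum, sum_mul_eq_sum_sum]
  refine sum_le_sum fun k hk => ?_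
  rw [mem_Icc] at hk
  have hsub : Icc k (d : ℤ) ⊆ Icc 1 (d : ℤ) := Icc_subset_Icc_left hk.1
  rw [sum_topCount_eq_min ((sum_nonneg hc_nonneg).trans hcx) (by omega)]
  exact le_min ((sum_le_sum_of_subset_of_nonneg hsub fun p hp _ => hc_nonneg p hp).trans hcx)
    (sum_le_sum fun p hp => hc_le p (hsub hp))

/- If the conclusion failed, `h p - ν (-p)` would have total less than `z + e` over `p > 0`, and
then `ν p` total less than `h 0 / 2 + z + e` because `ν` has at most half the mass of `h`. The two
moments over `p > 0` are therefore bounded by the two values of `topSum`, while by balance they add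
up to that of `h`. -/
theorem sum_neg_add_le {ν : ℤ → ℝ} {z e : ℕ} (hsymm : ∀ p, h (-p) = h p)
    (hν_nonneg : ∀ p, 0 ≤ ν p) (hν_le : ∀ p, ν p ≤ h p)
    (hbalance : ∑ p ∈ Icc (-(d : ℤ)) d, (p : ℝ) * ν p = 0)
    (hhalf : 2 * ∑ p ∈ Icc (-(d : ℤ)) d, ν p ≤ ∑ p ∈ Icc (-(d : ℤ)) d, (h p : ℝ))
    (hnum : z + e ≤ ∑ p ∈ Icc (1 : ℤ) d, h p)
    (hsum : topSum d h ((z : ℝ) + e) + topSum d h ((h 0 : ℝ) / 2 + z + e) <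
      ∑ p ∈ Icc (1 : ℤ) d, (p : ℝ) * (h p : ℝ)) :
    ∑ p ∈ Icc (1 : ℤ) d, ν (-p) + z + e ≤ ∑ p ∈ Icc (1 : ℤ) d, (h p : ℝ) := by
  by_contra! hlt
  have hnum' : (z : ℝ) + e ≤ ∑ p ∈ Icc (1 : ℤ) d, (h p : ℝ) := by exact_mod_cast hnum
  have hzero : (0 : ℝ) ≤ h 0 := by positivity
  have hcomplement := sum_le_topSum (c := fun p => h p - ν (-p)) (x := z + e)
    (fun p _ => sub_nonneg.2 (hsymm p ▸ hν_le (-p)))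
    (fun p _ => sub_le_self _ (hν_nonneg (-p)))
    (by rw [sum_sub_distrib]; linarith) (by linarith)
  rw [sum_Icc_neg_eq, sum_Icc_neg_eq] at hhalf
  simp only [hsymm] at hhalf
  have hpositive := sum_le_topSum (d := d) (c := ν) (x := (h 0 : ℝ) / 2 + z + e)
    (fun p _ => hν_nonneg p) (fun p _ => hν_le p)
    (by linarith [hν_nonneg 0]) (by linarith)
  rw [sum_Icc_neg_eq] at hbalance
  simp only [Int.cast_neg, Int.cast_zero, zero_mul, zero_add, neg_mul,
    sum_neg_distrib] at hbalance
  simp only [mul_sub, sum_sub_distrib] at hcomplement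
  linarith

end Numerics

section RadicalCount

variable {K : Type*} [Field K] {V : Type*} [AddCommGroup V] [Module K V]
  {B : LinearMap.BilinForm K V} {ε : ℤˣ} {d m : ℕ} {F F' : ℤ → Submodule K V}
  {f : ℕ → Submodule K V}

theorem IsSelfDualFiltration.exists_isAdapted [FiniteDimensional K V]
    (hF : IsSelfDualFiltration B d F) :
    ∃ (b : Module.Basis (Fin (Module.finrank K V)) K V) (P : Fin (Module.finrank K V) → ℤ),
      IsAdapted b F (fun p a => p ≤ P a) := by
  have htrivial : Monotone fun i : ℕ => if i = 0 then (⊥ : Submodule K V) else ⊤ :=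
    fun i j hij => by
      rcases Nat.eq_zero_or_pos i with rfl | hi
      · exact bot_le
      · simp [(hi.trans_le hij).ne']
  obtain ⟨b, P, -, hP, -⟩ := exists_adapted_basis hF.antitone (hF.eq_top 0 le_rfl) hF.eq_bot
    htrivial rfl (if_neg one_ne_zero)
  exact ⟨b, P, hP⟩

theorem hodge_congr [CharZero K] [FiniteDimensional K V] [Nontrivial V]
    (hnd : B.Nondegenerate) (hB : IsEpsilonSymm B ε)
    (hF : IsSelfDualFiltration B d F) (hF' : IsSelfDualFiltration B d F')
    (hdim : ∀ p, Module.finrank K (F p) = Module.finrank K (F' p)) :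
    hodge B F = hodge B F' := by
  obtain ⟨b, P, hP⟩ := hF.exists_isAdapted
  obtain ⟨b', P', hP'⟩ := hF'.exists_isAdapted
  obtain ⟨σ, hσ⟩ := exists_perm_of_card_eq P P' fun k => by
    have hcompl := Finset.card_filter_add_card_filter_not (s := Finset.univ) fun a => P a < k
    have hcompl' := Finset.card_filter_add_card_filter_not (s := Finset.univ) fun a => P' a < k
    have hcard := hdim k
    rw [hP.finrank_eq, hP'.finrank_eq] at hcard
    simp only [not_lt] at hcompl hcompl'
    omega
  funext p
  have hcomp := pairSum_comp (ε := ε) σ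
    fun a a' => if (d : ℤ) - P' a - P' a' = p then 1 else 0
  simp only [hσ] at hcomp
  have hh := two_mul_hodge hnd hB hF hP p
  rw [hcomp, ← two_mul_hodge hnd hB hF' hP' p] at hh
  omega

theorem hodge_neg [CharZero K] [FiniteDimensional K V] [Nontrivial V] (hnd : B.Nondegenerate)
    (hB : IsEpsilonSymm B ε) (hF : IsSelfDualFiltration B d F) (p : ℤ) :
    hodge B F (-p) = hodge B F p := by
  obtain ⟨b, P, hP⟩ := hF.exists_isAdapted
  obtain ⟨σ, hσ⟩ := hF.exists_perm hnd hP
  have hcomp := pairSum_comp (ε := ε) σ fun a a' => if (d : ℤ) - P a - P a' = p then 1 else 0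
  have hdual : ∀ a a', (d : ℤ) - P (σ a) - P (σ a') = p ↔ (d : ℤ) - P a - P a' = -p :=
    fun a a' => by
      have := hσ a
      have := hσ a'
      omega
  simp only [hdual] at hcomp
  have hh := two_mul_hodge hnd hB hF hP (-p)
  simp only [hcomp, neg_eq_zero, ← two_mul_hodge hnd hB hF hP p] at hh
  omega

variable {ι : Type*} [Fintype ι] {b : Module.Basis ι K V} {P : ι → ℤ} {J : ι → ℕ}

/-- In terms of a basis adapted to a filtration (with jumps `P`) and to a self-dual flag of length
`2 m + 1` (with jumps `J`): twice the dimension of the degree `p` part of the nilradical of the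
stabilizer of the flag. -/
def radicalCount (ε : ℤˣ) (d m : ℕ) (P : ι → ℤ) (J : ι → ℕ) (p : ℤ) : ℤ :=
  pairSum ε fun a a' => if (d : ℤ) - P a - P a' = p then if 2 * m < J a + J a' then 1 else 0 else 0

theorem radicalCount_nonneg (p : ℤ) : 0 ≤ radicalCount ε d m P J p :=
  pairSum_nonneg fun a a' => by split_ifs <;> simp

theorem radicalCount_le [CharZero K] [FiniteDimensional K V] [Nontrivial V]
    (hnd : B.Nondegenerate) (hB : IsEpsilonSymm B ε) (hF : IsSelfDualFiltration B d F)
    (hP : IsAdapted b F (fun p a => p ≤ P a)) (p : ℤ) :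
    radicalCount ε d m P J p ≤ 2 * hodge B F p := by
  rw [two_mul_hodge hnd hB hF hP]
  exact (pairSum_mono fun a a' => by split_ifs <;> simp).trans
    (le_add_of_nonneg_right (by split_ifs <;> simp))

theorem sum_Icc_pairSum_ite (x : ι → ι → ℤ) (θ : ℤ → ι → ι → ℤ) (l u : ℤ) :
    ∑ p ∈ Finset.Icc l u, pairSum ε (fun a a' => if x a a' = p then θ p a a' else 0) =
      pairSum ε fun a a' => if l ≤ x a a' ∧ x a a' ≤ u then θ (x a a') a a' else 0 := by
  simp only [← pairSum_sum, Finset.sum_ite_eq, Finset.mem_Icc]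

theorem sum_mul_radicalCount_eq_zero (hP : ∀ a, 0 ≤ P a ∧ P a ≤ d)
    (hbalance : ∀ k, ∑ a with J a = k, ((d : ℤ) - 2 * P a) = 0) :
    ∑ p ∈ Finset.Icc (-(d : ℤ)) d, p * radicalCount ε d m P J p = 0 := by
  refine (mul_eq_zero.1 ?_).resolve_left (two_ne_zero (α := ℤ))
  rw [← pairSum_ite_lt_add_eq_zero (ε := ε) hbalance (2 * m)]
  simp only [radicalCount, ← pairSum_mul, mul_ite, mul_one, mul_zero, sum_Icc_pairSum_ite]
  congr! 3 with a a'
  have := hP a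
  have := hP a'
  rw [if_pos (by omega)]
  split_ifs <;> ring

theorem two_mul_sum_radicalCount_le [CharZero K] [FiniteDimensional K V] [Nontrivial V]
    (hnd : B.Nondegenerate) (hB : IsEpsilonSymm B ε) (hF : IsSelfDualFiltration B d F)
    (hf : IsSelfDualFlag B m f) (hP : IsAdapted b F (fun p a => p ≤ P a))
    (hJ : IsAdapted b f (fun j a => J a < j)) :
    2 * ∑ p ∈ Finset.Icc (-(d : ℤ)) d, radicalCount ε d m P J p ≤
      ∑ p ∈ Finset.Icc (-(d : ℤ)) d, 2 * (hodge B F p : ℤ) := by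
  have hrange : ∀ a a', -(d : ℤ) ≤ d - P a - P a' ∧ (d : ℤ) - P a - P a' ≤ d := fun a a' => by
    have := hF.adapted_bounds hP a
    have := hF.adapted_bounds hP a'
    omega
  obtain ⟨τ, hτ⟩ := hf.exists_perm hnd hJ
  calc 2 * ∑ p ∈ Finset.Icc (-(d : ℤ)) d, radicalCount ε d m P J p
      = 2 * pairSum ε (fun a a' => if 2 * m < J a + J a' then 1 else 0) := by
        simp only [radicalCount, sum_Icc_pairSum_ite, if_pos (hrange _ _)]
    _ ≤ pairSum ε (fun _ _ : ι => 1) := two_mul_pairSum_lt_add_le (by exact_mod_cast hτ)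
    _ = ∑ p ∈ Finset.Icc (-(d : ℤ)) d,
          pairSum ε (fun a a' => if (d : ℤ) - P a - P a' = p then 1 else 0) := by
        simp only [sum_Icc_pairSum_ite _ fun _ _ _ => 1, if_pos (hrange _ _)]
    _ ≤ ∑ p ∈ Finset.Icc (-(d : ℤ)) d, 2 * (hodge B F p : ℤ) := by
        refine Finset.sum_le_sum fun p _ => ?_
        rw [two_mul_hodge hnd hB hF hP]
        exact le_add_of_nonneg_right (by split_ifs <;> simp)

theorem sum_pairSum_neg_eq (hP : ∀ a, 0 ≤ P a ∧ P a ≤ d) (θ : ι → ι → ℤ) :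
    ∑ p ∈ Finset.Icc (1 : ℤ) d,
        pairSum ε (fun a a' => if (d : ℤ) - P a - P a' = -p then θ a a' else 0) =
      pairSum ε fun a a' => if d < P a + P a' then θ a a' else 0 := by
  have hiff : ∀ a a' p, (d : ℤ) - P a - P a' = -p ↔ P a + P a' - d = p := fun a a' p => by omega
  simp only [hiff, sum_Icc_pairSum_ite _ fun _ => θ]
  congr! 4 with a a'
  have := hP a
  have := hP a'
  omega

theorem sum_radicalCount_neg_eq (hP : ∀ a, 0 ≤ P a ∧ P a ≤ d) :
    ∑ p ∈ Finset.Icc (1 : ℤ) d, radicalCount ε d m P J (-p) =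
      pairSum ε fun a a' => if 2 * m < J a + J a' ∧ d < P a + P a' then 1 else 0 := by
  simp only [radicalCount]
  rw [sum_pairSum_neg_eq hP fun a a' => if 2 * m < J a + J a' then 1 else 0]
  simp only [← ite_and, and_comm]

theorem two_mul_sum_hodge_eq [CharZero K] [FiniteDimensional K V] [Nontrivial V]
    (hnd : B.Nondegenerate) (hB : IsEpsilonSymm B ε) (hF : IsSelfDualFiltration B d F)
    (hP : IsAdapted b F (fun p a => p ≤ P a)) :
    2 * ∑ p ∈ Finset.Icc (1 : ℤ) d, (hodge B F p : ℤ) =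
      pairSum ε fun a a' => if d < P a + P a' then 1 else 0 := by
  rw [← sum_pairSum_neg_eq (hF.adapted_bounds hP), Finset.mul_sum]
  refine Finset.sum_congr rfl fun p hp => ?_
  rw [← hodge_neg hnd hB hF, two_mul_hodge hnd hB hF hP,
    if_neg (by rw [Finset.mem_Icc] at hp; omega), add_zero]

theorem pairSum_neg_add_le [CharZero K] [FiniteDimensional K V] [Nontrivial V]
    (hnd : B.Nondegenerate) (hB : IsEpsilonSymm B ε)
    (hF : IsSelfDualFiltration B d F) (hf : IsSelfDualFlag B m f)
    (hP : IsAdapted b F (fun p a => p ≤ P a)) (hJ : IsAdapted b f (fun j a => J a < j))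
    (hbalance : ∀ k, ∑ a with J a = k, ((d : ℤ) - 2 * P a) = 0) {z e : ℕ}
    (hnum : z + e ≤ ∑ p ∈ Finset.Icc (1 : ℤ) d, hodge B F p)
    (hsum : topSum d (hodge B F) ((z : ℝ) + e) +
        topSum d (hodge B F) ((hodge B F 0 : ℝ) / 2 + z + e) <
      ∑ p ∈ Finset.Icc (1 : ℤ) d, (p : ℝ) * (hodge B F p : ℝ)) :
    pairSum ε (fun a a' => if 2 * m < J a + J a' ∧ d < P a + P a' then 1 else 0) +
      2 * z + 2 * e ≤ pairSum ε (fun a a' => if d < P a + P a' then 1 else 0) := by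
  have hbounds := hF.adapted_bounds hP
  have hsum_zero := sum_mul_radicalCount_eq_zero (ε := ε) (m := m) hbounds hbalance
  have hsum_half := two_mul_sum_radicalCount_le hnd hB hF hf hP hJ
  have hkey := sum_neg_add_le (ν := fun p => (radicalCount ε d m P J p : ℝ) / 2)
    (hodge_neg hnd hB hF)
    (fun p => div_nonneg (by exact_mod_cast radicalCount_nonneg p) zero_le_two)
    (fun p => by
      rw [div_le_iff₀' zero_lt_two]
      exact_mod_cast radicalCount_le hnd hB hF hP p)
    (by
      simp only [← mul_div_assoc, ← Finset.sum_div]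
      rw [div_eq_zero_iff]
      exact Or.inl (by exact_mod_cast hsum_zero))
    (by
      rw [← Finset.mul_sum] at hsum_half
      rw [← Finset.sum_div, mul_div_cancel₀ _ two_ne_zero]
      exact_mod_cast (mul_le_mul_iff_right₀ (zero_lt_two (α := ℤ))).1 hsum_half)
    hnum hsum
  rw [← sum_radicalCount_neg_eq hbounds, ← two_mul_sum_hodge_eq hnd hB hF hP]
  rw [← Finset.sum_div] at hkey
  have : (((∑ p ∈ Finset.Icc (1 : ℤ) d, radicalCount ε d m P J (-p)) + 2 * z + 2 * e : ℤ) : ℝ) ≤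
      ((2 * ∑ p ∈ Finset.Icc (1 : ℤ) d, (hodge B F p : ℤ) : ℤ) : ℝ) := by
    push_cast
    linarith
  exact_mod_cast this

end RadicalCount

section GrLift

variable {K : Type*} [Field K] {V : Type*} [AddCommGroup V] [Module K V]
  {V' : Type*} [AddCommGroup V'] [Module K V']

theorem IsAdapted.apply_mem {ι κ : Type*} {b : Module.Basis ι K V} {G : κ → Submodule K V}
    {S : κ → ι → Prop} (h : IsAdapted b G S) {i : κ} {N : Submodule K V'} {g : V →ₗ[K] V'}
    (hg : ∀ a, S i a → g (b a) ∈ N) {x : V} (hx : x ∈ G i) : g x ∈ N := by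
  have hle : G i ≤ N.comap g := by
    rw [h i, Submodule.span_le]
    rintro _ ⟨a, ha, rfl⟩
    exact hg a ha
  exact hle hx

theorem toGr_eq_toGr_iff {f : ℕ → Submodule K V} {j : ℕ} {x y : f (j + 1)} :
    toGr f j x = toGr f j y ↔ (x : V) - y ∈ f j :=
  Submodule.Quotient.eq _

theorem toGr_eq_zero_iff {f : ℕ → Submodule K V} {j : ℕ} {x : f (j + 1)} :
    toGr f j x = 0 ↔ (x : V) ∈ f j :=
  Submodule.Quotient.mk_eq_zero _

theorem IsAdapted.exists_toGr_eq {ι : Type*} {b : Module.Basis ι K V} {J : ι → ℕ}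
    {f : ℕ → Submodule K V} {f' : ℕ → Submodule K V'} (hJ : IsAdapted b f (fun j a => J a < j))
    {j : ℕ} {ψ : Gr f j →ₗ[K] Gr f' j} {h : V →ₗ[K] V'}
    (hb : ∀ a (ha : b a ∈ f (j + 1)), ∃ y : f' (j + 1), y = h (b a) ∧
      toGr f' j y = ψ (toGr f j ⟨b a, ha⟩)) (x : f (j + 1)) :
    ∃ y : f' (j + 1), y = h x ∧ toGr f' j y = ψ (toGr f j x) := by
  have hmem : ∀ x ∈ f (j + 1), h x ∈ f' (j + 1) := fun x => hJ.apply_mem fun a ha => by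
    obtain ⟨y, hy, -⟩ := hb a ((hJ.basis_mem_iff _ _).2 ha)
    exact hy ▸ y.2
  let E := LinearMap.eqLocus (toGr f' j ∘ₗ h.restrict hmem) (ψ ∘ₗ toGr f j)
  have hE : f (j + 1) ≤ E.map (f (j + 1)).subtype := by
    conv_lhs => rw [hJ (j + 1)]
    rw [Submodule.span_le]
    rintro _ ⟨a, ha, rfl⟩
    obtain ⟨y, hy, hya⟩ := hb a ((hJ.basis_mem_iff _ _).2 ha)
    refine ⟨⟨b a, (hJ.basis_mem_iff _ _).2 ha⟩, Eq.trans ?_ hya, rfl⟩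
    exact congrArg (toGr f' j) (Subtype.ext hy.symm)
  obtain ⟨x', hx', hxx'⟩ := hE x.2
  obtain rfl : x' = x := Subtype.ext hxx'
  exact ⟨h.restrict hmem x', rfl, hx'⟩

/-- The linear map `h` lifts the isomorphisms `θ j` between the first `n` graded pieces of `f` and
`f'`, and it maps the filtration `F` into `F'`. -/
structure IsGrLift {n : ℕ} (F : ℤ → Submodule K V) (F' : ℤ → Submodule K V')
    (f : ℕ → Submodule K V) (f' : ℕ → Submodule K V')
    (θ : ∀ j : Fin n, Gr f (j : ℕ) ≃ₗ[K] Gr f' (j : ℕ)) (h : V →ₗ[K] V') : Prop where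
  map_fil : ∀ p, ∀ x ∈ F p, h x ∈ F' p
  map_flag : ∀ (j : Fin n) (x : f ((j : ℕ) + 1)),
    ∃ y : f' ((j : ℕ) + 1), y = h x ∧ toGr f' j y = θ j (toGr f j x)

variable {n : ℕ} {F : ℤ → Submodule K V} {F' : ℤ → Submodule K V'} {f : ℕ → Submodule K V}
  {f' : ℕ → Submodule K V'} {θ : ∀ j : Fin n, Gr f (j : ℕ) ≃ₗ[K] Gr f' (j : ℕ)}

theorem exists_isGrLift {ι : Type*} {b : Module.Basis ι K V} {P : ι → ℤ} {J : ι → ℕ}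
    (hP : IsAdapted b F (fun p a => p ≤ P a)) (hJ : IsAdapted b f (fun j a => J a < j))
    (hF' : Antitone F') (hf' : Monotone f')
    (hθ : ∀ (j : Fin n) p x, θ j x ∈ inducedFil F' f' j p ↔ x ∈ inducedFil F f j p) :
    ∃ h, IsGrLift F F' f f' θ h := by
  have hlift (a) : ∃ c ∈ F' (P a), ∀ ha : J a < n, ∃ y : f' (J a + 1), y = c ∧
      toGr f' (J a) y = θ ⟨J a, ha⟩ (toGr f (J a)
        ⟨b a, (hJ.basis_mem_iff _ _).2 (Nat.lt_succ_self _)⟩) := by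
    by_cases ha : J a < n
    · obtain ⟨y, hyF, hy⟩ := (hθ ⟨J a, ha⟩ (P a) _).2
        ⟨⟨b a, (hJ.basis_mem_iff _ _).2 (Nat.lt_succ_self _)⟩, (hP.basis_mem_iff _ _).2 le_rfl, rfl⟩
      exact ⟨y, hyF, fun _ => ⟨y, rfl, hy⟩⟩
    · exact ⟨0, zero_mem _, fun h => absurd h ha⟩
  choose c hcF hcf using hlift
  refine ⟨b.constr K c, fun p x => hP.apply_mem fun a ha => ?_, fun j x =>
    hJ.exists_toGr_eq (ψ := (θ j : Gr f j →ₗ[K] Gr f' j)) (fun a ha => ?_) x⟩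
  · rw [Module.Basis.constr_basis]
    exact hF' ha (hcF a)
  rw [Module.Basis.constr_basis]
  rcases (Nat.lt_succ_iff_lt_or_eq.1 ((hJ.basis_mem_iff _ _).1 ha) : J a < j ∨ J a = j)
    with hlt | heq
  · obtain ⟨y, hyc, -⟩ := hcf a (hlt.trans j.2)
    have hcf' : c a ∈ f' j := hyc ▸ hf' (Nat.succ_le_of_lt hlt) y.2
    refine ⟨⟨c a, hf' (Nat.le_succ _) hcf'⟩, rfl, ?_⟩
    rw [toGr_eq_zero_iff.2 hcf', toGr_eq_zero_iff.2 ((hJ.basis_mem_iff _ _).2 hlt), map_zero]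
  · obtain ⟨j, hj⟩ := j
    obtain rfl : J a = j := heq
    exact hcf a hj

namespace IsGrLift

variable {h : V →ₗ[K] V'}

theorem mem_of_apply_mem (hh : IsGrLift F F' f f' θ h) (hf0 : f 0 = ⊥)
    (hθ : ∀ (j : Fin n) p x, θ j x ∈ inducedFil F' f' j p ↔ x ∈ inducedFil F f j p) {p : ℤ} {j : ℕ}
    (hj : j ≤ n) {x : V} (hx : x ∈ f j) (hxF : h x ∈ F' p) : x ∈ F p := by
  induction j generalizing x with
  | zero =>
    rw [hf0, Submodule.mem_bot] at hx
    exact hx ▸ zero_mem _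
  | succ j ih =>
    obtain ⟨y, hyx, hyθ⟩ := hh.map_flag ⟨j, hj⟩ ⟨x, hx⟩
    obtain ⟨u, huF, hux⟩ := (hθ ⟨j, hj⟩ p _).1
      (hyθ ▸ Submodule.mem_map_of_mem (p := (F' p).submoduleOf _) (hyx ▸ hxF : (y : V') ∈ F' p))
    have hsub : x - u ∈ F p := ih (by omega) (toGr_eq_toGr_iff.1 hux.symm)
      (by rw [map_sub]; exact sub_mem hxF (hh.map_fil p u huF))
    simpa using add_mem hsub huF

theorem exists_apply_eq (hh : IsGrLift F F' f f' θ h) (hf : Monotone f) (hf'0 : f' 0 = ⊥) {j : ℕ}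
    (hj : j ≤ n) {y : V'} (hy : y ∈ f' j) : ∃ x ∈ f j, h x = y := by
  induction j generalizing y with
  | zero =>
    rw [hf'0, Submodule.mem_bot] at hy
    exact ⟨0, zero_mem _, by rw [hy, map_zero]⟩
  | succ j ih =>
    obtain ⟨x, hx⟩ := Submodule.mkQ_surjective _ ((θ ⟨j, hj⟩).symm (toGr f' j ⟨y, hy⟩))
    obtain ⟨u, hux, huθ⟩ := hh.map_flag ⟨j, hj⟩ x
    have hyu : toGr f' j ⟨y, hy⟩ = toGr f' j u := by
      rw [huθ, ← LinearEquiv.symm_apply_eq]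
      exact hx.symm
    obtain ⟨r, hr, hrh⟩ := ih (by omega) (toGr_eq_toGr_iff.1 hyu)
    exact ⟨r + x, add_mem (hf (Nat.le_succ j) hr) x.2, by rw [map_add, hrh, ← hux, sub_add_cancel]⟩

theorem map_eq (hh : IsGrLift F F' f f' θ h) (hf : Monotone f) (hf0 : f 0 = ⊥) (hf'0 : f' 0 = ⊥)
    {i : ℕ} (hi : i ≤ n) : (f i).map h = f' i := by
  refine le_antisymm ?_ fun y hy => hh.exists_apply_eq hf hf'0 hi hy
  rintro _ ⟨x, hx, rfl⟩
  cases i with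
  | zero =>
    rw [SetLike.mem_coe, hf0, Submodule.mem_bot] at hx
    rw [hx, map_zero]
    exact zero_mem _
  | succ j =>
    obtain ⟨y, hyx, -⟩ := hh.map_flag ⟨j, hi⟩ ⟨x, hx⟩
    exact hyx ▸ y.2

theorem congr {h₁ : V →ₗ[K] V'} (hh : IsGrLift F F' f f' θ h) (hf : Monotone f)
    (hfil : ∀ p, ∀ x ∈ F p, h₁ x ∈ F' p) (heq : Set.EqOn h₁ h (f n)) :
    IsGrLift F F' f f' θ h₁ where
  map_fil := hfil
  map_flag j x := by
    rw [heq (hf j.2 x.2)]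
    exact hh.map_flag j x

end IsGrLift

end GrLift

section IsometryLift

variable {K : Type*} [Field K] {V : Type*} [AddCommGroup V] [Module K V]
  {B : LinearMap.BilinForm K V} {ε : ℤˣ} {d m : ℕ} {F F' : ℤ → Submodule K V}
  {f f' : ℕ → Submodule K V}

theorem IsSelfDualFiltration.mem_iff_left (hB : B.IsRefl) (hF : IsSelfDualFiltration B d F) (p : ℤ)
    (x : V) : x ∈ F p ↔ ∀ w ∈ F (d + 1 - p), B x w = 0 := by
  rw [hF.mem_iff]
  exact forall₂_congr fun w _ => hB.eq_iff

theorem IsSelfDualFlag.eq_orthogonal (hf : IsSelfDualFlag B m f) {i : ℕ} (hi : i ≤ 2 * m + 1) :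
    f i = B.orthogonal (f (2 * m + 1 - i)) := by
  rw [← hf.self_dual _ (Nat.sub_le _ _), Nat.sub_sub_self hi]

theorem IsSelfDualFlag.orthogonal_le (hf : IsSelfDualFlag B m f) :
    B.orthogonal (f (m + 1)) ≤ f (m + 1) := by
  rw [← hf.self_dual _ (by omega)]
  exact hf.monotone (by omega)

theorem mem_GAut_of_isometry {g : V ≃ₗ[K] V} (hg : ∀ v w, B (g v) (g w) = B v w) : g ∈ GAut B :=
  ⟨1, fun v w => (hg v w).trans (one_mul _).symm⟩

theorem orthogonal_map_eq_map_orthogonal {g : V ≃ₗ[K] V} (hg : g ∈ GAut B) (W : Submodule K V) :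
    B.orthogonal (W.map (g : V →ₗ[K] V)) = (B.orthogonal W).map (g : V →ₗ[K] V) := by
  obtain ⟨c, hc⟩ := hg
  ext y
  obtain ⟨x, rfl⟩ := g.surjective y
  constructor
  · exact fun hx =>
      ⟨x, fun w hw => c.mul_right_eq_zero.1 ((hc w x).symm.trans (hx _ ⟨w, hw, rfl⟩)), rfl⟩
  · rintro ⟨x', hx', hxx'⟩ _ ⟨w, hw, rfl⟩
    exact hxx' ▸ (hc w x').trans (c.mul_right_eq_zero.2 (hx' w hw))

theorem IsSelfDualFiltration.map_eq (hF : IsSelfDualFiltration B d F)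
    (hF' : IsSelfDualFiltration B d F') {g : V ≃ₗ[K] V} (hg : g ∈ GAut B)
    (hgF : ∀ p, ∀ x ∈ F p, g x ∈ F' p) (p : ℤ) : (F p).map (g : V →ₗ[K] V) = F' p := by
  have hle (p) : (F p).map (g : V →ₗ[K] V) ≤ F' p := Submodule.map_le_iff_le_comap.2 (hgF p)
  refine le_antisymm (hle p) ?_
  have hp : (d : ℤ) + 1 - (d + 1 - p) = p := by ring
  calc F' p = B.orthogonal (F' (d + 1 - p)) := by rw [← hF'.self_dual, hp]
    _ ≤ B.orthogonal ((F (d + 1 - p)).map (g : V →ₗ[K] V)) :=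
      LinearMap.BilinForm.orthogonal_le (hle _)
    _ = (F p).map (g : V →ₗ[K] V) := by
      rw [orthogonal_map_eq_map_orthogonal hg, ← hF.self_dual, hp]

theorem IsSelfDualFlag.map_eq (hf : IsSelfDualFlag B m f) (hf' : IsSelfDualFlag B m f')
    {g : V ≃ₗ[K] V} (hg : g ∈ GAut B)
    (hgf : ∀ i ≤ m + 1, (f i).map (g : V →ₗ[K] V) = f' i) {i : ℕ} (hi : i ≤ 2 * m + 1) :
    (f i).map (g : V →ₗ[K] V) = f' i := by
  rcases le_or_gt i (m + 1) with hlow | hhigh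
  · exact hgf i hlow
  · rw [hf.eq_orthogonal hi, ← orthogonal_map_eq_map_orthogonal hg, hgf _ (by omega),
      ← hf'.eq_orthogonal hi]

/- By strictness of `h` on `U`, the functional `B v` descends along `h` to a functional on
`h U / (h U ∩ F' (d + 1 - p))`, which extends to `V / F' (d + 1 - p)`. -/
theorem exists_extend_pairing [FiniteDimensional K V] (hnd : B.Nondegenerate) (hB : B.IsRefl)
    (hF : IsSelfDualFiltration B d F) (hF' : IsSelfDualFiltration B d F') {U : Submodule K V}
    {h : V →ₗ[K] V} (hU : ∀ p, ∀ x ∈ U, h x ∈ F' p → x ∈ F p) {p : ℤ} {v : V} (hv : v ∈ F p) :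
    ∃ c ∈ F' p, ∀ w ∈ U, B c (h w) = B v w := by
  let N := F' (d + 1 - p)
  have hmem : (B v).domRestrict U ∈ LinearMap.range (N.mkQ ∘ₗ h ∘ₗ U.subtype).dualMap := by
    rw [LinearMap.range_dualMap_eq_dualAnnihilator_ker, Submodule.mem_dualAnnihilator]
    intro w hw
    exact (hF.mem_iff_left hB p v).1 hv w
      (hU _ w w.2 ((Submodule.Quotient.mk_eq_zero _).1 (LinearMap.mem_ker.1 hw)))
  obtain ⟨μ, hμ⟩ := hmem
  have hc (x) : B ((B.toDual hnd).symm (μ ∘ₗ N.mkQ)) x = μ (N.mkQ x) := by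
    rw [LinearMap.BilinForm.apply_toDual_symm_apply]
    rfl
  refine ⟨(B.toDual hnd).symm (μ ∘ₗ N.mkQ), (hF'.mem_iff_left hB p _).2 fun w hw => ?_,
    fun w hw => (hc _).trans (LinearMap.congr_fun hμ ⟨w, hw⟩)⟩
  rw [hc, Submodule.mkQ_apply, (Submodule.Quotient.mk_eq_zero _).2 hw, map_zero]

theorem exists_extend_isometry_pairing [FiniteDimensional K V] (hnd : B.Nondegenerate)
    (hB : B.IsRefl) (hF : IsSelfDualFiltration B d F) (hF' : IsSelfDualFiltration B d F')
    {ι : Type*} {b : Module.Basis ι K V} {P : ι → ℤ} {J : ι → ℕ}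
    (hP : IsAdapted b F (fun p a => p ≤ P a)) (hJ : IsAdapted b f (fun j a => J a < j)) {k : ℕ}
    {h : V →ₗ[K] V} (hfil : ∀ p, ∀ x ∈ F p, h x ∈ F' p)
    (hstrict : ∀ p, ∀ x ∈ f k, h x ∈ F' p → x ∈ F p)
    (hiso : ∀ x ∈ f k, ∀ y ∈ f k, B (h x) (h y) = B x y) :
    ∃ g : V →ₗ[K] V, (∀ p, ∀ x ∈ F p, g x ∈ F' p) ∧ Set.EqOn g h (f k) ∧
      ∀ x, ∀ y ∈ f k, B (g x) (g y) = B x y := by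
  have hext (a) : ∃ c ∈ F' (P a), (J a < k → c = h (b a)) ∧ ∀ w ∈ f k, B c (h w) = B (b a) w := by
    have ha : b a ∈ F (P a) := (hP.basis_mem_iff _ _).2 le_rfl
    by_cases hJa : J a < k
    · exact ⟨h (b a), hfil _ _ ha, fun _ => rfl, hiso _ ((hJ.basis_mem_iff _ _).2 hJa)⟩
    · obtain ⟨c, hcF, hcB⟩ := exists_extend_pairing hnd hB hF hF' hstrict ha
      exact ⟨c, hcF, fun hlt => absurd hlt hJa, hcB⟩
  choose c hcF hch hcB using hext
  have heq : Set.EqOn (b.constr K c) h (f k) := fun x hx => sub_eq_zero.1 <|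
    (Submodule.mem_bot K).1 <| hJ.apply_mem (g := b.constr K c - h) (fun a ha => by
      rw [LinearMap.sub_apply, Module.Basis.constr_basis, hch a ha, sub_self]
      exact zero_mem _) hx
  refine ⟨b.constr K c, fun p x => hP.apply_mem fun a ha => ?_, heq, fun x y hy => ?_⟩
  · rw [Module.Basis.constr_basis]
    exact hF'.antitone ha (hcF a)
  · have hflip : B.flip (h y) ∘ₗ b.constr K c = B.flip y := b.ext fun a => by
      rw [LinearMap.comp_apply, Module.Basis.constr_basis]
      exact hcB a y hy
    rw [heq hy]
    exact LinearMap.congr_fun hflip x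

/-- The endomorphism `N` with `B (N x) y = B (g x) (g y) - B x y`, which measures by how much `g`
fails to be an isometry. -/
def isometryDefect [FiniteDimensional K V] (hnd : B.Nondegenerate) (g : V →ₗ[K] V) :
    Module.End K V :=
  (B.toDual hnd).symm.toLinearMap ∘ₗ (B.compl₁₂ g g - B)

section IsometryDefect

variable [FiniteDimensional K V] {hnd : B.Nondegenerate} {g : V →ₗ[K] V} {U : Submodule K V}

theorem isometryDefect_apply_left (x y : V) :
    B (isometryDefect hnd g x) y = B (g x) (g y) - B x y :=
  LinearMap.BilinForm.apply_toDual_symm_apply (hB := hnd) (B.compl₁₂ g g x - B x) y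

theorem isometryDefect_apply_right (hB : IsEpsilonSymm B ε) (x y : V) :
    B x (isometryDefect hnd g y) = B (g x) (g y) - B x y := by
  rw [hB _ x, isometryDefect_apply_left, hB x y, hB (g x) (g y)]
  linear_combination (B (g x) (g y) - B x y) * units_int_cast_mul_self (K := K) ε

theorem isometryDefect_mem_orthogonal (hB : IsEpsilonSymm B ε)
    (hg : ∀ x, ∀ y ∈ U, B (g x) (g y) = B x y) (x : V) :
    isometryDefect hnd g x ∈ B.orthogonal U := fun y hy => by
  rw [hB.isRefl.eq_iff, isometryDefect_apply_left, hg x y hy, sub_self]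

theorem isometryDefect_eq_zero (hB : IsEpsilonSymm B ε)
    (hg : ∀ x, ∀ y ∈ U, B (g x) (g y) = B x y) {y : V} (hy : y ∈ U) :
    isometryDefect hnd g y = 0 :=
  hnd.2 _ fun x => by rw [isometryDefect_apply_right hB, hg x y hy, sub_self]

theorem isometryDefect_mem (hB : B.IsRefl) (hF : IsSelfDualFiltration B d F)
    (hF' : IsSelfDualFiltration B d F') (hgF : ∀ p, ∀ x ∈ F p, g x ∈ F' p) {p : ℤ} {x : V}
    (hx : x ∈ F p) : isometryDefect hnd g x ∈ F p := by
  refine (hF.mem_iff_left hB p _).2 fun w hw => ?_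
  rw [isometryDefect_apply_left, (hF.mem_iff_left hB p x).1 hx w hw,
    (hF'.mem_iff_left hB p _).1 (hgF p x hx) _ (hgF _ w hw), sub_zero]

end IsometryDefect

/- The defect `N` of `g₀` has image in `U^⊥ ≤ U` and vanishes on `U`, so `N² = 0` and `1 - N / 2` is
an inverse square root of `1 + N`; thus `g₀ ∘ (1 - N / 2)` is an isometry. -/
theorem exists_isometry_eqOn [CharZero K] [FiniteDimensional K V] (hnd : B.Nondegenerate)
    (hB : IsEpsilonSymm B ε) (hF : IsSelfDualFiltration B d F) (hF' : IsSelfDualFiltration B d F')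
    {U : Submodule K V} (hU : B.orthogonal U ≤ U) {g₀ : V →ₗ[K] V}
    (hg₀F : ∀ p, ∀ x ∈ F p, g₀ x ∈ F' p) (hg₀ : ∀ x, ∀ y ∈ U, B (g₀ x) (g₀ y) = B x y) :
    ∃ g : V ≃ₗ[K] V, (∀ v w, B (g v) (g w) = B v w) ∧ (∀ p, ∀ x ∈ F p, g x ∈ F' p) ∧
      Set.EqOn g g₀ U := by
  let N := isometryDefect hnd g₀
  have hNU (x) : N x ∈ U := hU (isometryDefect_mem_orthogonal hB hg₀ x)
  let g₁ : V →ₗ[K] V := g₀ ∘ₗ (LinearMap.id - (2⁻¹ : K) • N)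
  have hg₁ (x) : g₁ x = g₀ x - (2⁻¹ : K) • g₀ (N x) := by simp [g₁]
  have hiso (x y) : B (g₁ x) (g₁ y) = B x y := by
    have hright : B (g₀ x) (g₀ (N y)) = B (g₀ x) (g₀ y) - B x y := by
      rw [hg₀ x _ (hNU y), isometryDefect_apply_right hB]
    have hleft : B (g₀ (N x)) (g₀ y) = B (g₀ x) (g₀ y) - B x y := by
      rw [hB (g₀ y), hg₀ y _ (hNU x), ← hB, isometryDefect_apply_left]
    have hboth : B (g₀ (N x)) (g₀ (N y)) = 0 := by
      rw [hg₀ _ _ (hNU y)]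
      exact isometryDefect_mem_orthogonal hB hg₀ y _ (hNU x)
    simp only [hg₁, map_sub, map_smul, LinearMap.sub_apply, LinearMap.smul_apply, smul_eq_mul,
      hright, hleft, hboth]
    field_simp
    ring
  have hinj : Function.Injective g₁ := (injective_iff_map_eq_zero g₁).2 fun x hx =>
    hnd.1 _ fun y => by rw [← hiso, hx, map_zero, LinearMap.zero_apply]
  refine ⟨LinearEquiv.ofInjectiveEndo g₁ hinj, hiso, fun p x hx => ?_, fun x hx => ?_⟩
  · rw [LinearEquiv.coe_ofInjectiveEndo, hg₁]
    exact sub_mem (hg₀F p x hx)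
      (Submodule.smul_mem _ _ (hg₀F p _ (isometryDefect_mem hB.isRefl hF hF' hg₀F hx)))
  · rw [LinearEquiv.coe_ofInjectiveEndo, hg₁, show N x = 0 from isometryDefect_eq_zero hB hg₀ hx,
      map_zero, smul_zero, sub_zero]

theorem exists_isometry_isGrLift [CharZero K] [FiniteDimensional K V] (hnd : B.Nondegenerate)
    (hB : IsEpsilonSymm B ε) (hF : IsSelfDualFiltration B d F) (hF' : IsSelfDualFiltration B d F')
    (hf : IsSelfDualFlag B m f) (hf' : IsSelfDualFlag B m f')
    {θ : ∀ j : Fin (m + 1), Gr f (j : ℕ) ≃ₗ[K] Gr f' (j : ℕ)}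
    (hθ : ∀ (j : Fin (m + 1)) p x, θ j x ∈ inducedFil F' f' j p ↔ x ∈ inducedFil F f j p)
    (hθB : ∀ (x y : f (m + 1)) (x' y' : f' (m + 1)),
      toGr f' m x' = θ (Fin.last m) (toGr f m x) → toGr f' m y' = θ (Fin.last m) (toGr f m y) →
        B (x' : V) y' = B (x : V) y) :
    ∃ g : V ≃ₗ[K] V, (∀ v w, B (g v) (g w) = B v w) ∧
      (∀ p, (F p).map (g : V →ₗ[K] V) = F' p) ∧
      (∀ i ≤ 2 * m + 1, (f i).map (g : V →ₗ[K] V) = f' i) ∧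
      IsGrLift F F' f f' θ (g : V →ₗ[K] V) := by
  obtain ⟨b, P, J, hP, hJ⟩ := exists_adapted_basis hF.antitone (hF.eq_top 0 le_rfl) hF.eq_bot
    hf.monotone hf.eq_bot hf.eq_top
  obtain ⟨h, hh⟩ := exists_isGrLift hP hJ hF'.antitone hf'.monotone hθ
  have hiso : ∀ x ∈ f (m + 1), ∀ y ∈ f (m + 1), B (h x) (h y) = B x y := fun x hx y hy => by
    obtain ⟨x', hx', hx'θ⟩ := hh.map_flag (Fin.last m) ⟨x, hx⟩
    obtain ⟨y', hy', hy'θ⟩ := hh.map_flag (Fin.last m) ⟨y, hy⟩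
    exact hx' ▸ hy' ▸ hθB ⟨x, hx⟩ ⟨y, hy⟩ x' y' hx'θ hy'θ
  obtain ⟨g₀, hg₀F, hg₀h, hg₀B⟩ := exists_extend_isometry_pairing hnd hB.isRefl hF hF' hP hJ
    hh.map_fil (fun p x => hh.mem_of_apply_mem hf.eq_bot hθ le_rfl) hiso
  obtain ⟨g, hgB, hgF, hgg₀⟩ := exists_isometry_eqOn hnd hB hF hF' hf.orthogonal_le hg₀F hg₀B
  have hlift : IsGrLift F F' f f' θ (g : V →ₗ[K] V) :=
    hh.congr hf.monotone hgF (hgg₀.trans hg₀h)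
  have hgG := mem_GAut_of_isometry hgB
  exact ⟨g, hgB, hF.map_eq hF' hgG hgF, fun i hi => hf.map_eq hf' hgG
    (fun i hi => hlift.map_eq hf.monotone hf.eq_bot hf'.eq_bot hi) hi, hlift⟩

end IsometryLift

section Wedge

variable {K : Type*} [Field K] {V : Type*} [AddCommGroup V] [Module K V]
variable {W : Submodule K V} {k : ℕ}

theorem map_subtype_ιMulti (w : Fin k → W) :
    exteriorPower.map k W.subtype (exteriorPower.ιMulti K k w) =
      exteriorPower.ιMulti K k fun i => (w i : V) :=
  exteriorPower.map_apply_ιMulti W.subtype w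

theorem ιMulti_basis_ne_zero (w : Module.Basis (Fin k) K W) :
    exteriorPower.ιMulti K k (fun i => (w i : V)) ≠ 0 := by
  have hw : exteriorPower.ιMulti K k w ≠ 0 := fun hw => by
    have hdet := exteriorPower.alternatingMapLinearEquiv_apply_ιMulti w.det w
    rw [hw, map_zero, w.det_self] at hdet
    exact zero_ne_one hdet
  have hinj := exteriorPower.map_injective_field (n := k) (f := W.subtype) W.subtype_injective
  rw [← map_subtype_ιMulti]
  exact (map_ne_zero_iff _ hinj).2 hw

theorem mem_range_map_iff (w : Module.Basis (Fin k) K W) (x : ⋀[K]^k V) :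
    x ∈ LinearMap.range (exteriorPower.map k W.subtype) ↔
      ∃ c : K, c • exteriorPower.ιMulti K k (fun i => (w i : V)) = x := by
  constructor
  · rintro ⟨y, rfl⟩
    have : FiniteDimensional K W := Module.Finite.of_basis w
    have hline : Module.finrank K (⋀[K]^k W) = 1 := by
      rw [exteriorPower.finrank_eq, Module.finrank_eq_card_basis w, Fintype.card_fin,
        Nat.choose_self]
    have hw : exteriorPower.ιMulti K k w ≠ 0 := fun hw =>
      ιMulti_basis_ne_zero w (by rw [← map_subtype_ιMulti, hw, map_zero])
    obtain ⟨c, rfl⟩ := (finrank_eq_one_iff_of_nonzero' _ hw).1 hline y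
    exact ⟨c, by rw [map_smul, map_subtype_ιMulti]⟩
  · rintro ⟨c, rfl⟩
    exact ⟨c • exteriorPower.ιMulti K k w, by rw [map_smul, map_subtype_ιMulti]⟩

/-- The derivative of the action of endomorphisms on the decomposable vector
`w 0 ∧ ⋯ ∧ w (k - 1)`. -/
def wedgeDeriv (w : Fin k → V) : Module.End K V →ₗ[K] ⋀[K]^k V :=
  ∑ i, ((exteriorPower.ιMulti K k).toMultilinearMap.toLinearMap w i) ∘ₗ LinearMap.applyₗ (w i)

theorem wedgeDeriv_apply (w : Fin k → V) (Y : Module.End K V) :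
    wedgeDeriv w Y = ∑ i, exteriorPower.ιMulti K k (Function.update w i (Y (w i))) := by
  simp [wedgeDeriv, LinearMap.sum_apply]

theorem wedgeDeriv_mem (w : Module.Basis (Fin k) K W) {Y : Module.End K V}
    (hY : ∀ v ∈ W, Y v ∈ W) :
    wedgeDeriv (fun i => (w i : V)) Y ∈
      Submodule.span K {exteriorPower.ιMulti K k (fun i => (w i : V))} := by
  rw [wedgeDeriv_apply]
  refine sum_mem fun i _ => ?_
  rw [Submodule.mem_span_singleton, ← mem_range_map_iff]
  refine ⟨exteriorPower.ιMulti K k (Function.update w i ⟨Y (w i), hY _ (w i).2⟩), ?_⟩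
  rw [map_subtype_ιMulti]
  congr 1
  ext j
  rcases eq_or_ne j i with rfl | hji
  · simp
  · simp [Function.update_of_ne hji]

theorem exists_linearMap_exchange (w : Module.Basis (Fin k) K W) (i : Fin k) {y : V}
    (hy : y ∉ W) :
    ∃ ρ : V →ₗ[K] W, ρ (w i) = 0 ∧ (∀ j, j ≠ i → ρ (w j) = w j) ∧ ρ y = w i := by
  obtain ⟨ρ, hρ, hρy⟩ := LinearMap.exists_extend_of_notMem
    (w.constr K (Function.update w i 0)) hy (w i)
  have hρw (j : Fin k) : ρ (w j) = Function.update (w : Fin k → W) i 0 j :=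
    (LinearMap.congr_fun hρ (w j)).trans (w.constr_basis K _ j)
  exact ⟨ρ, by simp [hρw], fun j hj => by simp [hρw, hj], hρy⟩

theorem apply_basis_mem_of_wedgeDeriv_mem (w : Module.Basis (Fin k) K W) {Y : Module.End K V}
    (hY : wedgeDeriv (fun i => (w i : V)) Y ∈
      Submodule.span K {exteriorPower.ιMulti K k (fun i => (w i : V))}) (i : Fin k) :
    Y (w i) ∈ W := by
  by_contra hi
  obtain ⟨ρ, hρi, hρ, hρY⟩ := exists_linearMap_exchange w i hi
  let Φ := exteriorPower.alternatingMapLinearEquiv (w.det.compLinearMap ρ)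
  have hΦ (x : Fin k → V) : Φ (exteriorPower.ιMulti K k x) = w.det (fun j => ρ (x j)) :=
    exteriorPower.alternatingMapLinearEquiv_apply_ιMulti _ _
  have hline : Φ (exteriorPower.ιMulti K k fun i => (w i : V)) = 0 := by
    rw [hΦ]
    exact AlternatingMap.map_coord_zero _ i hρi
  have hderiv : Φ (wedgeDeriv (fun i => (w i : V)) Y) = 1 := by
    rw [wedgeDeriv_apply, map_sum, Finset.sum_eq_single i]
    · have hw : (fun j => ρ (Function.update (fun i => (w i : V)) i (Y (w i)) j)) = w := by
        ext j
        rcases eq_or_ne j i with rfl | hji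
        · simp [hρY]
        · simp [Function.update_of_ne hji, hρ j hji]
      rw [hΦ, hw, w.det_self]
    · intro j _ hj
      rw [hΦ]
      refine AlternatingMap.map_coord_zero _ i ?_
      rw [Function.update_of_ne hj.symm, hρi]
    · simp
  obtain ⟨c, hc⟩ := Submodule.mem_span_singleton.1 hY
  rw [← hc, map_smul, hline, smul_zero] at hderiv
  exact zero_ne_one hderiv

theorem apply_mem_of_wedgeDeriv_mem (w : Module.Basis (Fin k) K W) {Y : Module.End K V}
    (hY : wedgeDeriv (fun i => (w i : V)) Y ∈
      Submodule.span K {exteriorPower.ιMulti K k (fun i => (w i : V))}) {v : V} (hv : v ∈ W) :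
    Y v ∈ W := by
  have hspan : Submodule.span K (Set.range w) ≤ (W.comap Y).submoduleOf W := by
    rw [Submodule.span_le]
    rintro _ ⟨i, rfl⟩
    exact apply_basis_mem_of_wedgeDeriv_mem w hY i
  exact hspan (w.mem_span ⟨v, hv⟩)

end Wedge

section Rank

variable {K : Type*} [Field K] {E E' : Type*} [AddCommGroup E] [Module K E] [AddCommGroup E']
  [Module K E'] [FiniteDimensional K E]

theorem finrank_map_add_finrank_inf_ker (T : Submodule K E) (L : E →ₗ[K] E') :
    Module.finrank K (T.map L) + Module.finrank K (T ⊓ LinearMap.ker L : Submodule K E) =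
      Module.finrank K T := by
  rw [← LinearMap.finrank_range_add_finrank_ker (L.domRestrict T), LinearMap.range_domRestrict,
    ← Submodule.map_comap_subtype, ← LinearMap.ker_domRestrict, Submodule.finrank_map_subtype_eq]

variable [FiniteDimensional K E']

theorem finrank_inf_comap_le (S : Submodule K E) (N : Submodule K E') (L : E →ₗ[K] E') :
    Module.finrank K (S ⊓ N.comap L : Submodule K E) ≤
      Module.finrank K N + Module.finrank K (S ⊓ LinearMap.ker L : Submodule K E) := by
  rw [← finrank_map_add_finrank_inf_ker _ L]
  refine add_le_add (Submodule.finrank_mono ?_) (Submodule.finrank_mono ?_)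
  · exact (Submodule.map_mono inf_le_right).trans (Submodule.map_comap_le _ _)
  · exact inf_le_inf_right _ inf_le_left

theorem finrank_sup_map_add_le (Λ : Submodule K E') (T N : Submodule K E) (D : E →ₗ[K] E')
    (hN : N ≤ T) (hD : N.map D ≤ Λ) :
    Module.finrank K (Λ ⊔ T.map D : Submodule K E') + Module.finrank K N ≤
      Module.finrank K Λ + Module.finrank K T := by
  have hsup := finrank_map_add_finrank_inf_ker (Λ ⊔ T.map D) Λ.mkQ
  have hT := finrank_map_add_finrank_inf_ker T (Λ.mkQ ∘ₗ D)
  have hquot : (Λ ⊔ T.map D).map Λ.mkQ = T.map (Λ.mkQ ∘ₗ D) := by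
    rw [Submodule.map_sup, Submodule.mkQ_map_self, bot_sup_eq, Submodule.map_comp]
  have hker : Module.finrank K N ≤
      Module.finrank K (T ⊓ LinearMap.ker (Λ.mkQ ∘ₗ D) : Submodule K E) := by
    refine Submodule.finrank_mono (le_inf hN ?_)
    rw [LinearMap.ker_comp, Submodule.ker_mkQ, ← Submodule.map_le_iff_le_comap]
    exact hD
  have hΛ : Module.finrank K ((Λ ⊔ T.map D) ⊓ LinearMap.ker Λ.mkQ : Submodule K E') ≤
      Module.finrank K Λ := by
    rw [Submodule.ker_mkQ]
    exact Submodule.finrank_mono inf_le_right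
  rw [hquot] at hsup
  omega

theorem zariskiDim_range_le_of_vec [CharZero K] (S : Set E) (y : S → E') (r : ℕ)
    (h : ∀ s : S, ∃ T : Submodule K E', Module.finrank K T ≤ r ∧
      ∀ (δ : PointDerivation (coordRing K S) s) (x' : E),
        δ.tangent.vec (fun x : S => (x : E)) x' → ∃ y' ∈ T, δ.tangent.vec y y') :
    zariskiDim K (Set.range y) ≤ r := by
  refine zariskiDim_range_le S y (fun l => ?_) r fun s => ?_
  · rcases isEmpty_or_nonempty S with hS | ⟨⟨s⟩⟩
    · have hzero : (fun x => l (y x)) = 0 := Subsingleton.elim _ _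
      rw [hzero]
      exact zero_mem _
    · obtain ⟨T, -, hT⟩ := h s
      let δ : PointDerivation (coordRing K S) s := ⟨0, fun f g => by simp⟩
      obtain ⟨y', -, hy⟩ := hT δ 0 fun l => ⟨linear_mem_coordRing S l, by simp [δ]⟩
      exact (hy l).1
  · obtain ⟨T, hr, hT⟩ := h s
    refine ⟨T, hr, fun δ y' hy => ?_⟩
    obtain ⟨x', hx⟩ := δ.exists_vec (linear_mem_coordRing S)
    obtain ⟨y'', hy''T, hy''⟩ := hT δ x' hx
    rwa [Tangent.vec_unique hy hy'']

end Rank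

section OrbitMap

variable {K : Type*} [Field K] {V : Type*} [AddCommGroup V] [Module K V] {κ : Type*} {k : κ → ℕ}

/-- The map that sends an endomorphism `g` and scalars `c p` to the decomposable vectors
`c p • (g (w p 0) ∧ g (w p 1) ∧ ⋯)`. If `w p` is a basis of the `p`-th step of a filtration, these
are Plücker coordinates of its translate by `g`. -/
def orbitMap (w : ∀ p, Fin (k p) → V) (x : Module.End K V × (κ → K)) (p : κ) : ⋀[K]^(k p) V :=
  x.2 p • exteriorPower.ιMulti K (k p) fun i => x.1 (w p i)

/-- The derivative of `orbitMap w` at `(1, c)` in the direction of endomorphisms. -/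
def orbitDeriv (w : ∀ p, Fin (k p) → V) (c : κ → K) : Module.End K V →ₗ[K] ∀ p, ⋀[K]^(k p) V :=
  LinearMap.pi fun p => c p • wedgeDeriv (w p)

/-- The derivative of `orbitMap w` at `(1, c)`, for any `c`, in the direction of scalars. -/
def scaleMap (w : ∀ p, Fin (k p) → V) : (κ → K) →ₗ[K] ∀ p, ⋀[K]^(k p) V :=
  LinearMap.pi fun p => (LinearMap.proj p).smulRight (exteriorPower.ιMulti K (k p) (w p))

theorem scaleMap_apply (w : ∀ p, Fin (k p) → V) (c : κ → K) (p : κ) :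
    scaleMap w c p = c p • exteriorPower.ιMulti K (k p) (w p) :=
  rfl

theorem Tangent.vec_orbitMap [FiniteDimensional K V] [Finite κ] {T : Type*} {t : T}
    {D : Tangent K t} (w : ∀ p, Fin (k p) → V) {y : T → Module.End K V} {Y : Module.End K V}
    (hy : D.vec y (Y ∘ₗ y t)) {c : T → κ → K} {c' : κ → K} (hc : ∀ p, D.rel (c · p) (c' p)) :
    D.vec (fun x => orbitMap w (y x, c x))
      (orbitDeriv (fun p i => y t (w p i)) (c t) Y +
        scaleMap (fun p i => y t (w p i)) c') := by
  refine vec_pi fun p => ?_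
  have hwedge := vec_multilinear (exteriorPower.ιMulti K (k p)).toMultilinearMap fun i =>
    vec_linear (LinearMap.applyₗ (w p i)) hy
  have hterm := vec_smul (hc p) hwedge
  rw [Pi.add_apply, orbitDeriv, LinearMap.pi_apply, LinearMap.smul_apply, wedgeDeriv_apply]
  exact hterm

variable {W : κ → Submodule K V} (w : ∀ p, Module.Basis (Fin (k p)) K (W p))

theorem orbitDeriv_mem_range_scaleMap (c : κ → K) {Y : Module.End K V}
    (hY : ∀ p, ∀ v ∈ W p, Y v ∈ W p) :
    orbitDeriv (fun p i => (w p i : V)) c Y ∈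
      LinearMap.range (scaleMap fun p i => (w p i : V)) := by
  choose t ht using fun p => Submodule.mem_span_singleton.1 (wedgeDeriv_mem (w p) (hY p))
  refine ⟨fun p => c p * t p, funext fun p => ?_⟩
  rw [scaleMap_apply, mul_smul, ht, orbitDeriv, LinearMap.pi_apply, LinearMap.smul_apply]

theorem apply_mem_of_orbitDeriv_mem_range_scaleMap {Y : Module.End K V}
    (hY : orbitDeriv (fun p i => (w p i : V)) 1 Y ∈
      LinearMap.range (scaleMap fun p i => (w p i : V)))
    {p : κ} {v : V} (hv : v ∈ W p) : Y v ∈ W p := by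
  obtain ⟨c, hc⟩ := hY
  refine apply_mem_of_wedgeDeriv_mem (w p) (Submodule.mem_span_singleton.2 ⟨c p, ?_⟩) hv
  exact (congrFun hc p).trans (one_smul K (wedgeDeriv (fun i => (w p i : V)) Y))

end OrbitMap

section Transporter

variable {K : Type*} [Field K] {V : Type*} [AddCommGroup V] [Module K V]
variable {B : LinearMap.BilinForm K V} {ε : ℤˣ} {d m : ℕ} {F : ℤ → Submodule K V}
  {f : ℕ → Submodule K V} {φ g : V ≃ₗ[K] V}

theorem IsSelfDualFiltration.map (hF : IsSelfDualFiltration B d F) (hg : g ∈ GAut B) :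
    IsSelfDualFiltration B d (fun p => (F p).map (g : V →ₗ[K] V)) where
  antitone _ _ hpq := Submodule.map_mono (hF.antitone hpq)
  eq_top p hp := by rw [hF.eq_top p hp, Submodule.map_top, LinearEquiv.range]
  eq_bot p hp := by rw [hF.eq_bot p hp, Submodule.map_bot]
  self_dual p := by rw [hF.self_dual, orthogonal_map_eq_map_orthogonal hg]

/-- An isometry `g` such that the flag `g f` is `φ`-stable and `g` commutes with the action of `φ`
on the graded pieces up to the middle one. -/
structure IsTransporter (B : LinearMap.BilinForm K V) (φ : V ≃ₗ[K] V) (m : ℕ)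
    (f : ℕ → Submodule K V) (g : V ≃ₗ[K] V) : Prop where
  isometry : ∀ v w, B (g v) (g w) = B v w
  stable : ∀ i, i ≤ 2 * m + 1 → ∀ v ∈ f i, ∃ v' ∈ f i, φ (g v) = g v'
  comm : ∀ j, j ≤ m → ∀ v ∈ f (j + 1), ∀ w ∈ f (2 * m + 1 - j), B (φ (g v) - g (φ v)) (g w) = 0

/-- The operator `Y ↦ Y - φ⁻¹ Y φ`. -/
def adSub (φ : V ≃ₗ[K] V) : Module.End K V →ₗ[K] Module.End K V :=
  LinearMap.id - LinearMap.lcomp K V (φ : V →ₗ[K] V) ∘ₗ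
    LinearMap.llcomp K V V V (φ.symm : V →ₗ[K] V)

theorem adSub_apply (Y : Module.End K V) (v : V) : adSub φ Y v = Y v - φ.symm (Y (φ v)) := rfl

theorem apply_adSub (Y : Module.End K V) (v : V) : φ (adSub φ Y v) = φ (Y v) - Y (φ v) := by
  rw [adSub_apply, map_sub, LinearEquiv.apply_symm_apply]

theorem adSub_mem_skew (hφ : φ ∈ GAut B) {Y : Module.End K V} (hY : Y ∈ skew B) :
    adSub φ Y ∈ skew B := by
  obtain ⟨c, hc⟩ := hφ
  intro v w
  refine c.mul_right_eq_zero.1 ?_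
  rw [mul_add, ← hc, ← hc, apply_adSub, apply_adSub, map_sub, map_sub, LinearMap.sub_apply]
  have hvw := hY v w
  have hφvw := hY (φ v) (φ w)
  linear_combination c * hvw - hφvw + hc (Y v) w + hc v (Y w)

theorem mem_ker_adSub {Y : Module.End K V} :
    Y ∈ LinearMap.ker (adSub φ) ↔ Commute Y (φ : V →ₗ[K] V) := by
  rw [LinearMap.mem_ker, commute_iff_eq, LinearMap.ext_iff, LinearMap.ext_iff]
  refine forall_congr' fun v => ?_
  rw [adSub_apply, LinearMap.zero_apply, sub_eq_zero, LinearEquiv.eq_symm_apply, eq_comm]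
  rfl

/-- The endomorphisms that commute with `s`, as a subspace. -/
def commutant (s : Module.End K V) : Submodule K (Module.End K V) :=
  Subalgebra.toSubmodule (Subalgebra.centralizer K {s})

theorem mem_commutant {s Y : Module.End K V} : Y ∈ commutant s ↔ Commute Y s := by
  simp [commutant, Subalgebra.mem_centralizer_iff, Commute, SemiconjBy, eq_comm]

theorem commute_of_mem_adjoin_singleton {R A : Type*} [CommSemiring R] [Semiring A] [Algebra R A]
    {x y a : A} (ha : a ∈ Algebra.adjoin R {y}) (hxy : Commute x y) : Commute x a := by
  have hle : Algebra.adjoin R {y} ≤ Subalgebra.centralizer R {x} :=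
    Algebra.adjoin_singleton_le ((Subalgebra.mem_centralizer_iff R).2 fun _ h => by
      rw [Set.mem_singleton_iff.1 h]
      exact hxy)
  exact (Subalgebra.mem_centralizer_iff R).1 (hle ha) x rfl

theorem IsSemisimplePart.commute [PerfectField K] [FiniteDimensional K V] {φ s : Module.End K V}
    (hs : IsSemisimplePart φ s) {Y : Module.End K V} (hY : Commute Y φ) : Commute Y s := by
  obtain ⟨n, hn, s', hs', hnil, hss, hadd⟩ := φ.exists_isNilpotent_isSemisimple
  have hcomm : Commute n s' :=
    commute_of_mem_adjoin_singleton hs'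
      (commute_of_mem_adjoin_singleton hn (Commute.refl φ)).symm
  obtain ⟨-, rfl⟩ := Module.End.isNilpotent_isSemisimple_unique hnil hss hs.2.2 hs.1 hcomm
    (hs.2.1.symm.sub_left (Commute.refl s)) (by rw [← hadd, sub_add_cancel])
  exact commute_of_mem_adjoin_singleton hs' hY

theorem finrank_skew_inf_comap_adSub_le [PerfectField K] [FiniteDimensional K V]
    {s : Module.End K V} (hs : IsSemisimplePart (φ : V →ₗ[K] V) s)
    (U : Submodule K (Module.End K V)) :
    Module.finrank K (skew B ⊓ U.comap (adSub φ) : Submodule K (Module.End K V)) ≤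
      Module.finrank K U +
        Module.finrank K (skew B ⊓ commutant s : Submodule K (Module.End K V)) := by
  refine (finrank_inf_comap_le _ _ _).trans (add_le_add_right (Submodule.finrank_mono ?_) _)
  exact inf_le_inf_left _ fun Y hY => mem_commutant.2 (hs.commute (mem_ker_adSub.1 hY))

variable {ι : Type*} {b : Module.Basis ι K V} {P : ι → ℤ} {J : ι → ℕ}

/-- For `b` adapted to the flag `f`, with `b a` in step `J a + 1` but not in step `J a`: the Lie
algebra of the unipotent radical of the stabilizer of the flag `g f`. -/
abbrev radical (B : LinearMap.BilinForm K V) (m : ℕ) (b : Module.Basis ι K V) (J : ι → ℕ)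
    (g : V ≃ₗ[K] V) : Submodule K (Module.End K V) :=
  skewOn B (b.map g) fun a a' => 2 * m < J a + J a'

theorem adSub_mem_radical (hB : IsEpsilonSymm B ε) (hφ : φ ∈ GAut B)
    (hJ : IsAdapted b f (fun j a => J a < j))
    (hg : ∀ i, i ≤ 2 * m + 1 → ∀ v ∈ f i, ∃ v' ∈ f i, φ (g v) = g v')
    {Y : Module.End K V} (hY : Y ∈ skew B)
    (hcomm : ∀ j, j ≤ m → ∀ v ∈ f (j + 1), ∀ w ∈ f (2 * m + 1 - j),
      B (φ (Y (g v)) - Y (φ (g v))) (g w) = 0) : adSub φ Y ∈ radical B m b J g := by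
  have hskew := adSub_mem_skew hφ hY
  obtain ⟨c, hc⟩ := hφ
  have hlow (a a') (ha : J a ≤ m) (haa' : J a + J a' ≤ 2 * m) :
      B (adSub φ Y (g (b a))) (g (b a')) = 0 := by
    obtain ⟨v', hv', hφv'⟩ := hg (2 * m + 1 - J a) (by omega) (b a')
      ((hJ.basis_mem_iff _ _).2 (by omega))
    have hzero := hcomm (J a) ha (b a) ((hJ.basis_mem_iff _ _).2 (Nat.lt_succ_self _)) v' hv'
    rw [← hφv', ← apply_adSub, hc] at hzero
    exact c.mul_right_eq_zero.1 hzero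
  refine ⟨hskew, fun a a' haa' => ?_⟩
  rw [Module.Basis.map_apply, Module.Basis.map_apply]
  rcases le_or_gt (J a) m with ha | ha
  · exact hlow a a' ha (by omega)
  · rw [skew_apply_comm hB hskew, hlow a' a (by omega) (by omega), mul_zero]

theorem apply_eq_zero_of_mem_radical (hJ : IsAdapted b f (fun j a => J a < j))
    {Y : Module.End K V} (hY : Y ∈ radical B m b J g) {j : ℕ} (hj : j ≤ 2 * m)
    {v : V} (hv : v ∈ f (j + 1)) {w : V} (hw : w ∈ f (2 * m + 1 - j)) : B (Y (g v)) (g w) = 0 := by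
  rw [hJ] at hv hw
  refine LinearMap.BilinMap.apply_apply_mem_of_mem_span ⊥ _ _
    (B.compl₁₂ (Y ∘ₗ (g : V →ₗ[K] V)) (g : V →ₗ[K] V)) ?_ _ _ hv hw
  rintro _ ⟨a, ha, rfl⟩ _ ⟨a', ha', rfl⟩
  rw [Set.mem_ofPred_eq] at ha ha'
  have hzero := hY.2 a a' (by omega)
  rwa [Module.Basis.map_apply, Module.Basis.map_apply] at hzero

theorem radical_le_comap_adSub (hφ : φ ∈ GAut B) (hJ : IsAdapted b f (fun j a => J a < j))
    (hg : ∀ i, i ≤ 2 * m + 1 → ∀ v ∈ f i, ∃ v' ∈ f i, φ (g v) = g v') :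
    radical B m b J g ≤ (radical B m b J g).comap (adSub φ) := by
  intro Y hY
  refine ⟨adSub_mem_skew hφ hY.1, fun a a' haa' => ?_⟩
  rw [Module.Basis.map_apply, Module.Basis.map_apply]
  have ha : b a ∈ f (J a + 1) := (hJ.basis_mem_iff _ _).2 (Nat.lt_succ_self _)
  have ha' : b a' ∈ f (2 * m + 1 - J a) := (hJ.basis_mem_iff _ _).2 (by omega)
  obtain ⟨v, hv, hφv⟩ := hg (J a + 1) (by omega) _ ha
  obtain ⟨w, hw, hφw⟩ := hg (2 * m + 1 - J a) (by omega) _ ha'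
  obtain ⟨c, hc⟩ := hφ
  refine c.mul_right_eq_zero.1 ?_
  rw [← hc, apply_adSub, map_sub, LinearMap.sub_apply, hc,
    apply_eq_zero_of_mem_radical hJ hY (by omega) ha ha', hφv, hφw,
    apply_eq_zero_of_mem_radical hJ hY (by omega) hv hw, mul_zero, sub_zero]

/-- The endomorphisms `Y` such that `Y ∘ g` can be tangent at `g` to the set of transporters. -/
abbrev transporterTangent (B : LinearMap.BilinForm K V) (φ : V ≃ₗ[K] V) (m : ℕ)
    (b : Module.Basis ι K V) (J : ι → ℕ) (g : V ≃ₗ[K] V) : Submodule K (Module.End K V) :=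
  skew B ⊓ (radical B m b J g).comap (adSub φ)

/-- Pairs of an endomorphism that is a transporter and a tuple of scalars, the source of
`orbitMap`. -/
abbrev transporterPairs (B : LinearMap.BilinForm K V) (φ : V ≃ₗ[K] V) (m : ℕ)
    (f : ℕ → Submodule K V) (κ : Type*) : Set (Module.End K V × (κ → K)) :=
  {x | ∃ g, IsTransporter B φ m f g ∧ (g : V →ₗ[K] V) = x.1}

theorem mem_transporterTangent [FiniteDimensional K V] (hB : IsEpsilonSymm B ε) (hφ : φ ∈ GAut B)
    (hJ : IsAdapted b f (fun j a => J a < j)) {κ : Type*} {x : transporterPairs B φ m f κ}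
    (hg : IsTransporter B φ m f g) (hgx : (g : V →ₗ[K] V) = x.1.1) {D : Tangent K x}
    {Y : Module.End K V} (hY : D.vec (fun x => x.1.1) (Y ∘ₗ x.1.1)) :
    Y ∈ transporterTangent B φ m b J g := by
  have happ (v : V) : D.vec (fun x => x.1.1 v) (Y (g v)) := by
    have h := Tangent.vec_linear (LinearMap.applyₗ v) hY
    rwa [← hgx] at h
  have hskew : Y ∈ skew B := by
    intro v w
    obtain ⟨v, rfl⟩ := g.surjective v
    obtain ⟨w, rfl⟩ := g.surjective w
    have hderiv := Tangent.vec_bilinear B (happ v) (happ w)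
    have hconst : (fun x : transporterPairs B φ m f κ => B (x.1.1 v) (x.1.1 w)) =
        fun _ => B v w := by
      funext ⟨x, g', hg', hx⟩
      exact hx ▸ hg'.isometry v w
    rw [hconst, ← hgx] at hderiv
    exact (add_comm _ _).trans (Tangent.vec_unique hderiv (Tangent.vec_const _))
  refine ⟨hskew, adSub_mem_radical hB hφ hJ hg.stable hskew fun j hj v hv w hw => ?_⟩
  have hderiv := Tangent.vec_bilinear B
    (Tangent.vec_sub (Tangent.vec_linear (φ : V →ₗ[K] V) (happ v)) (happ (φ v))) (happ w)
  have hconst : (fun x : transporterPairs B φ m f κ =>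
      B ((φ : V →ₗ[K] V) (x.1.1 v) - x.1.1 (φ v)) (x.1.1 w)) = fun _ => 0 := by
    funext ⟨x, g', hg', hx⟩
    exact hx ▸ hg'.comm j hj v hv w hw
  rw [hconst, ← hgx] at hderiv
  have hsum : B (φ (g v) - g (φ v)) (Y (g w)) + B (φ (Y (g v)) - Y (g (φ v))) (g w) = 0 :=
    Tangent.vec_unique hderiv (Tangent.vec_const _)
  have hY' := hskew (φ (g v) - g (φ v)) (g w)
  simp only [map_sub, LinearMap.sub_apply] at hsum hY' ⊢
  linear_combination hsum - hY'

theorem finrank_orbit_tangent_le [CharZero K] [FiniteDimensional K V] [Fintype ι]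
    (hnd : B.Nondegenerate) (hB : IsEpsilonSymm B ε) (hφ : φ ∈ GAut B) {s : Module.End K V}
    (hs : IsSemisimplePart (φ : V →ₗ[K] V) s) (hJ : IsAdapted b f (fun j a => J a < j))
    (hg : IsTransporter B φ m f g) {E : Type*} [AddCommGroup E] [Module K E]
    [FiniteDimensional K E] (Λ : Submodule K E) (D : Module.End K V →ₗ[K] E)
    (hD : (skewOn B (b.map g) fun a a' => 2 * m < J a + J a' ∧ P a + P a' ≤ d).map D ≤ Λ) :
    2 * (Module.finrank K (Λ ⊔ (transporterTangent B φ m b J g).map D : Submodule K E) : ℤ) ≤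
      2 * Module.finrank K Λ +
        2 * Module.finrank K (skew B ⊓ commutant s : Submodule K (Module.End K V)) +
        pairSum ε (fun a a' => if 2 * m < J a + J a' ∧ d < P a + P a' then 1 else 0) := by
  let N := skewOn B (b.map g) fun a a' => 2 * m < J a + J a' ∧ P a + P a' ≤ d
  have hN : N ≤ transporterTangent B φ m b J g := by
    have hle : N ≤ radical B m b J g := fun Y hY => ⟨hY.1, fun a a' h => hY.2 a a' fun h' => h h'.1⟩
    exact le_inf (fun Y hY => hY.1) (hle.trans (radical_le_comap_adSub hφ hJ hg.stable))
  have hsup := finrank_sup_map_add_le Λ _ N D hN hD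
  have htangent := finrank_skew_inf_comap_adSub_le hs (B := B) (radical B m b J g)
  have hradical := two_mul_finrank_skewOn_eq_pairSum hnd hB (b.map g)
    (fun a a' => 2 * m < J a + J a') fun a a' h => by omega
  have hfinrankN := two_mul_finrank_skewOn_eq_pairSum hnd hB (b.map g)
    (fun a a' => 2 * m < J a + J a' ∧ P a + P a' ≤ d) fun a a' h => by omega
  have hsplit := pairSum_add (ε := ε)
    (fun a a' => if 2 * m < J a + J a' ∧ P a + P a' ≤ d then 1 else 0)
    (fun a a' => if 2 * m < J a + J a' ∧ d < P a + P a' then 1 else 0)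
  have hite (a a' : ι) : (if 2 * m < J a + J a' ∧ P a + P a' ≤ d then (1 : ℤ) else 0) +
      (if 2 * m < J a + J a' ∧ d < P a + P a' then 1 else 0) =
      if 2 * m < J a + J a' then 1 else 0 := by
    split_ifs <;> omega
  simp only [hite] at hsplit
  simp only [N, transporterTangent] at hsup ⊢
  simp only [radical] at hsup htangent ⊢
  omega

theorem zariskiDim_orbit_le [CharZero K] [FiniteDimensional K V] [Fintype ι]
    (hnd : B.Nondegenerate) (hB : IsEpsilonSymm B ε) (hφ : φ ∈ GAut B) {s : Module.End K V}
    (hs : IsSemisimplePart (φ : V →ₗ[K] V) s) (hF : IsSelfDualFiltration B d F)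
    (hP : IsAdapted b F (fun p a => p ≤ P a)) (hJ : IsAdapted b f (fun j a => J a < j))
    {κ : Type*} [Fintype κ] {k : κ → ℕ} {q : κ → ℤ}
    (w : ∀ p, Module.Basis (Fin (k p)) K (F (q p))) {r : ℕ}
    (hr : 2 * (Fintype.card κ : ℤ) +
      2 * Module.finrank K (skew B ⊓ commutant s : Submodule K (Module.End K V)) +
      pairSum ε (fun a a' => if 2 * m < J a + J a' ∧ d < P a + P a' then 1 else 0) ≤ 2 * r) :
    zariskiDim K (Set.range fun x : transporterPairs B φ m f κ =>
      orbitMap (fun p i => (w p i : V)) x.1) ≤ r := by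
  refine zariskiDim_range_le_of_vec _ _ r ?_
  rintro ⟨⟨g', c⟩, g, hg, rfl : (g : V →ₗ[K] V) = g'⟩
  let gw (p : κ) := (w p).map (g.submoduleMap (F (q p)))
  let Λ := LinearMap.range (scaleMap (K := K) fun p i => (gw p i : V))
  let D := orbitDeriv (fun p i => (gw p i : V)) c
  refine ⟨Λ ⊔ (transporterTangent B φ m b J g).map D, ?_, ?_⟩
  · have hΛ : Module.finrank K Λ ≤ Fintype.card κ :=
      (LinearMap.finrank_range_le _).trans_eq (Module.finrank_pi K)
    have hD : (skewOn B (b.map g) fun a a' => 2 * m < J a + J a' ∧ P a + P a' ≤ d).map D ≤ Λ := by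
      rintro _ ⟨Y, hY, rfl⟩
      have hmem : Y ∈ skew B ⊓ adjFil B (fun p => (F p).map (g : V →ₗ[K] V)) 0 := by
        rw [skew_inf_adjFil_eq_skewOn hB (hF.map (mem_GAut_of_isometry hg.isometry)) (hP.map g)]
        exact ⟨hY.1, fun a a' h => hY.2 a a' fun h' => h (by have := h'.2; omega)⟩
      exact orbitDeriv_mem_range_scaleMap gw c fun p v hv => by simpa using hmem.2.2 (q p) v hv
    have := finrank_orbit_tangent_le hnd hB hφ hs hJ hg Λ D hD
    omega
  · rintro δ ⟨X, c'⟩ hδ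
    let Y : Module.End K V := X ∘ₗ (g.symm : V →ₗ[K] V)
    have hYX : Y ∘ₗ (g : V →ₗ[K] V) = X := by ext v; simp [Y]
    have hY : δ.tangent.vec (fun x => x.1.1) (Y ∘ₗ (g : V →ₗ[K] V)) := by
      rw [hYX]
      exact Tangent.vec_linear (LinearMap.fst K (Module.End K V) (κ → K)) hδ
    have hc (p : κ) : δ.tangent.rel (fun x => x.1.2 p) (c' p) :=
      hδ (LinearMap.proj p ∘ₗ LinearMap.snd K (Module.End K V) (κ → K))
    exact ⟨_, add_mem
      (Submodule.mem_sup_right ⟨Y, mem_transporterTangent hB hφ hJ hg rfl hY, rfl⟩)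
      (Submodule.mem_sup_left ⟨c', rfl⟩), Tangent.vec_orbitMap _ hY hc⟩

end Transporter

section Bad

variable {K : Type*} [Field K] {V : Type*} [AddCommGroup V] [Module K V]
variable {B : LinearMap.BilinForm K V} {ε : ℤˣ} {d m : ℕ} {F F' : ℤ → Submodule K V}
  {f f' : ℕ → Submodule K V} {φ : V ≃ₗ[K] V}

theorem IsGrLift.apply_sub_apply_mem {n : ℕ}
    {θ : ∀ j : Fin n, Gr f (j : ℕ) ≃ₗ[K] Gr f' (j : ℕ)} {g : V →ₗ[K] V}
    (hg : IsGrLift F F' f f' θ g) {j : Fin n} (hfφ : ∀ v ∈ f (j + 1), φ v ∈ f (j + 1))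
    (hf'φ : ∀ v ∈ f' (j + 1), φ v ∈ f' (j + 1))
    (hθφ : ∀ (x y : f (j + 1)) (x' y' : f' (j + 1)), (y : V) = φ x → (y' : V) = φ x' →
      toGr f' j x' = θ j (toGr f j x) → toGr f' j y' = θ j (toGr f j y))
    {v : V} (hv : v ∈ f (j + 1)) : φ (g v) - g (φ v) ∈ f' j := by
  obtain ⟨x', hx', hx'gr⟩ := hg.map_flag j ⟨v, hv⟩
  obtain ⟨y, hy, hygr⟩ := hg.map_flag j ⟨φ v, hfφ v hv⟩
  have hgr : toGr f' j ⟨φ x', hf'φ x' x'.2⟩ = toGr f' j y :=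
    (hθφ ⟨v, hv⟩ ⟨φ v, hfφ v hv⟩ x' _ rfl rfl hx'gr).trans hygr.symm
  have hmem : φ x' - y ∈ f' j := toGr_eq_toGr_iff.1 hgr
  rwa [hx', hy] at hmem

theorem exists_isTransporter_map_eq [CharZero K] [FiniteDimensional K V] (hnd : B.Nondegenerate)
    (hB : IsEpsilonSymm B ε) (hF : IsSelfDualFiltration B d F) (hF' : IsSelfDualFiltration B d F')
    (hf : IsSelfDualFlag B m f) (hf' : IsSelfDualFlag B m f')
    (hfφ : ∀ i ≤ 2 * m + 1, ∀ v ∈ f i, φ v ∈ f i)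
    (hf'φ : ∀ i ≤ 2 * m + 1, ∀ v ∈ f' i, φ v ∈ f' i)
    {θ : ∀ j : Fin (m + 1), Gr f (j : ℕ) ≃ₗ[K] Gr f' (j : ℕ)}
    (hθ : ∀ (j : Fin (m + 1)) p x, θ j x ∈ inducedFil F' f' j p ↔ x ∈ inducedFil F f j p)
    (hθφ : ∀ (j : Fin (m + 1)) (x y : f (j + 1)) (x' y' : f' (j + 1)), (y : V) = φ x →
      (y' : V) = φ x' → toGr f' j x' = θ j (toGr f j x) → toGr f' j y' = θ j (toGr f j y))
    (hθB : ∀ (x y : f (m + 1)) (x' y' : f' (m + 1)),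
      toGr f' m x' = θ (Fin.last m) (toGr f m x) → toGr f' m y' = θ (Fin.last m) (toGr f m y) →
        B (x' : V) y' = B (x : V) y) :
    ∃ g, IsTransporter B φ m f g ∧ ∀ p, (F p).map (g : V →ₗ[K] V) = F' p := by
  obtain ⟨g, hgB, hgF, hgf, hgθ⟩ := exists_isometry_isGrLift hnd hB hF hF' hf hf' hθ hθB
  refine ⟨g, ⟨hgB, fun i hi v hv => ?_, fun j hj v hv w hw => ?_⟩, hgF⟩
  · have hφgv : φ (g v) ∈ (f i).map (g : V →ₗ[K] V) := by
      rw [hgf i hi]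
      refine hf'φ i hi _ ?_
      rw [← hgf i hi]
      exact Submodule.mem_map_of_mem hv
    obtain ⟨v', hv', hgv'⟩ := hφgv
    exact ⟨v', hv', hgv'.symm⟩
  · have hmem : φ (g v) - g (φ v) ∈ f' j :=
      hgθ.apply_sub_apply_mem (j := ⟨j, by omega⟩) (hfφ (j + 1) (by omega))
        (hf'φ (j + 1) (by omega)) (hθφ ⟨j, by omega⟩) hv
    rw [hf'.eq_orthogonal (by omega), ← hgf _ (by omega)] at hmem
    exact hB.isRefl _ _ (hmem _ (Submodule.mem_map_of_mem hw))

theorem IsBad.exists_flag_forall_exists_isTransporter [CharZero K] [FiniteDimensional K V]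
    (hnd : B.Nondegenerate) (hB : IsEpsilonSymm B ε)
    {A : Fin (m + 1) → Type*} [∀ j, AddCommGroup (A j)] [∀ j, Module K (A j)]
    {FA : ∀ j, ℤ → Submodule K (A j)} {φA : ∀ j, A j ≃ₗ[K] A j}
    {BA : LinearMap.BilinForm K (A (Fin.last m))}
    (hF : IsSelfDualFiltration B d F) (hbad : IsBad B φ d m A FA φA BA F) :
    ∃ f, IsSelfDualFlag B m f ∧
      (∀ k, k ≤ 2 * m → Nontrivial (Gr f k) → weight d (inducedFil F f k) = (d : ℚ) / 2) ∧
      ∀ F', IsSelfDualFiltration B d F' → IsBad B φ d m A FA φA BA F' →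
        ∃ g, IsTransporter B φ m f g ∧ ∀ p, (F p).map (g : V →ₗ[K] V) = F' p := by
  obtain ⟨f, hf, hfφ, hweight, e, heF, heφ, heB⟩ := hbad
  refine ⟨f, hf, hweight, fun F' hF' ⟨f', hf', hf'φ, _, e', heF', heφ', heB'⟩ => ?_⟩
  let θ (j : Fin (m + 1)) : Gr f j ≃ₗ[K] Gr f' j := (e j).trans (e' j).symm
  have hθ (j : Fin (m + 1)) (x : Gr f j) (x' : Gr f' j) : x' = θ j x ↔ e' j x' = e j x :=
    (e' j).eq_symm_apply
  refine exists_isTransporter_map_eq (θ := θ) hnd hB hF hF' hf hf' hfφ hf'φ (fun j p x => ?_)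
    (fun j x y x' y' hy hy' hx => ?_) fun x y x' y' hx hy => ?_
  · have hmem : (e' j).symm (e j x) ∈ inducedFil F' f' j p ↔
        (e j).symm (e j x) ∈ inducedFil F f j p := by
      rw [← Submodule.mem_map_equiv, ← Submodule.mem_map_equiv, heF', heF]
    rwa [LinearEquiv.symm_apply_apply] at hmem
  · rw [hθ] at hx ⊢
    rw [heφ' j x' y' hy', heφ j x y hy, hx]
  · rw [← heB' x' y', ← heB x y]
    exact congrArg₂ (fun a b => BA a b) ((hθ _ _ _).1 hx) ((hθ _ _ _).1 hy)

theorem pluckerCone_subset_range {k : ℤ → ℕ}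
    (w : ∀ p : Fin (d + 2), Module.Basis (Fin (k (p : ℕ))) K (F (p : ℕ)))
    {S : Set (ℤ → Submodule K V)}
    (hS : ∀ F' ∈ S, ∃ g, IsTransporter B φ m f g ∧ ∀ p, (F p).map (g : V →ₗ[K] V) = F' p) :
    pluckerCone d k S ⊆ Set.range fun x : transporterPairs B φ m f (Fin (d + 2)) =>
      orbitMap (fun p i => (w p i : V)) x.1 := by
  rintro x ⟨F', hF', hx⟩
  obtain ⟨g, hg, hgF⟩ := hS F' hF'
  have hcoeff (p : Fin (d + 2)) :
      ∃ c : K, c • exteriorPower.ιMulti K (k (p : ℕ)) (fun i => g (w p i)) = x p := by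
    have hxp := (hx p).2
    rw [← hgF] at hxp
    exact (mem_range_map_iff ((w p).map (g.submoduleMap _)) _).1 hxp
  choose c hc using hcoeff
  exact ⟨⟨((g : V →ₗ[K] V), c), g, hg, rfl⟩, funext hc⟩

end Bad

section Det

variable {K : Type*} [Field K] {T : Type*} {t : T} {D : Tangent K t} {n : ℕ}
  {M : T → Matrix (Fin n) (Fin n) K} {M' : Matrix (Fin n) (Fin n) K}

theorem Tangent.rel_det (hM : D.vec M M') :
    D.rel (fun x => (M x).det) (∑ i, ((M t).updateRow i (M' i)).det) :=
  vec_iff_rel.1 (vec_multilinear Matrix.detRowAlternating.toMultilinearMap fun i =>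
    vec_linear (LinearMap.proj i) hM)

theorem Tangent.rel_det_of_eq_one (hM : D.vec M M') (hone : M t = 1) :
    D.rel (fun x => (M x).det) M'.trace := by
  have hdet (i : Fin n) : ((M t).updateRow i (M' i)).det = M' i i := by
    rw [hone, ← Matrix.cramer_transpose_apply, Matrix.transpose_one, Matrix.cramer_one]
    rfl
  have hrel := rel_det hM
  simp only [hdet] at hrel
  exact hrel

theorem Tangent.vec_updateRow (hM : D.vec M M') (j : Fin n) (v : Fin n → K) :
    D.vec (fun x => (M x).updateRow j v) (M'.updateRow j 0) := by
  refine vec_pi fun i => ?_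
  rcases eq_or_ne i j with rfl | hij
  · simpa only [Matrix.updateRow_self] using vec_const (D := D) v
  · simp only [Matrix.updateRow_ne hij]
    exact vec_linear (LinearMap.proj i) hM

theorem Tangent.exists_vec_adjugate (hM : D.vec M M') : ∃ A, D.vec (fun x => (M x).adjugate) A :=
  ⟨fun i j => _, vec_pi fun i => vec_pi fun j => by
    simp only [Matrix.adjugate_apply]
    exact vec_iff_rel.2 (rel_det (vec_updateRow hM j (Pi.single i 1)))⟩

end Det

section Cayley

variable {K : Type*} [Field K] {V : Type*} [AddCommGroup V] [Module K V] [FiniteDimensional K V]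

/-- The Cayley transform `(1 + Y) (1 - Y)⁻¹`, multiplied by `det (1 - Y)` in order to be polynomial
in `Y`. -/
def cayley (Y : Module.End K V) : Module.End K V :=
  let b := Module.finBasis K V
  let M := LinearMap.toMatrixAlgEquiv b Y
  Matrix.toLinAlgEquiv b ((1 + M) * (1 - M).adjugate)

theorem cayley_mul_one_sub (Y : Module.End K V) :
    cayley Y * (1 - Y) = LinearMap.det (1 - Y) • (1 + Y) := by
  let b := Module.finBasis K V
  have hdet : (1 - LinearMap.toMatrixAlgEquiv b Y).det = LinearMap.det (1 - Y) := by
    rw [← map_one (LinearMap.toMatrixAlgEquiv b), ← map_sub]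
    exact LinearMap.det_toMatrix b (1 - Y)
  refine (LinearMap.toMatrixAlgEquiv b).injective ?_
  rw [map_mul, map_smul, map_sub, map_add, map_one, cayley,
    LinearMap.toMatrixAlgEquiv_toLinAlgEquiv, mul_assoc, Matrix.adjugate_mul, mul_smul_comm,
    mul_one, hdet]

theorem cayley_zero : cayley (0 : Module.End K V) = 1 := by
  simpa using cayley_mul_one_sub (0 : Module.End K V)

theorem commute_cayley {Y s : Module.End K V} (hY : LinearMap.det (1 - Y) ≠ 0) (hs : Commute Y s) :
    Commute (cayley Y) s := by
  have hsub : Commute (1 - Y) s := (Commute.one_left s).sub_left hs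
  have hadd : Commute (1 + Y) s := (Commute.one_left s).add_left hs
  refine ((LinearMap.isUnit_iff_isUnit_det _).2 hY.isUnit).mul_right_cancel ?_
  rw [mul_assoc, ← hsub.eq, ← mul_assoc, cayley_mul_one_sub, smul_mul_assoc, hadd.eq, mul_assoc,
    cayley_mul_one_sub, mul_smul_comm]

variable {B : LinearMap.BilinForm K V}

theorem exists_mem_GAut_of_apply_apply (hnd : B.Nondegenerate) {g : Module.End K V} {c : K}
    (hc : c ≠ 0) (hg : ∀ v w, B (g v) (g w) = c * B v w) :
    ∃ g' ∈ GAut B, (g' : V →ₗ[K] V) = g := by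
  have hinj : Function.Injective g := by
    refine (injective_iff_map_eq_zero g).2 fun v hv => hnd.1 v fun w => ?_
    have hzero := hg v w
    rw [hv, map_zero, LinearMap.zero_apply] at hzero
    exact (mul_eq_zero.1 hzero.symm).resolve_left hc
  exact ⟨LinearEquiv.ofInjectiveEndo g hinj, ⟨Units.mk0 c hc, hg⟩, rfl⟩

theorem exists_mem_GAut_eq_cayley (hnd : B.Nondegenerate) {Y : Module.End K V} (hY : Y ∈ skew B)
    (hdet : LinearMap.det (1 - Y) ≠ 0) : ∃ g ∈ GAut B, (g : V →ₗ[K] V) = cayley Y := by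
  refine exists_mem_GAut_of_apply_apply hnd (pow_ne_zero 2 hdet) fun v w => ?_
  have hsurj : Function.Surjective (1 - Y : Module.End K V) :=
    ((Module.End.isUnit_iff _).1 ((LinearMap.isUnit_iff_isUnit_det _).2 hdet.isUnit)).2
  obtain ⟨x, rfl⟩ := hsurj v
  obtain ⟨y, rfl⟩ := hsurj w
  have hcayley (x : V) : cayley Y ((1 - Y) x) = LinearMap.det (1 - Y) • (1 + Y) x :=
    LinearMap.congr_fun (cayley_mul_one_sub Y) x
  have hxy := hY x y
  rw [hcayley, hcayley]
  simp only [LinearMap.sub_apply, LinearMap.add_apply, Module.End.one_apply, map_add, map_sub,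
    map_smul, LinearMap.smul_apply, smul_eq_mul]
  linear_combination 2 * LinearMap.det (1 - Y) ^ 2 * hxy

theorem trace_eq_zero_of_mem_skew [NeZero (2 : K)] (hnd : B.Nondegenerate) {Y : Module.End K V}
    (hY : Y ∈ skew B) : LinearMap.trace K V Y = 0 := by
  have hconj : (B.toDual hnd).conj Y = -Module.Dual.transpose (R := K) Y := by
    refine LinearMap.ext fun l => LinearMap.ext fun w => ?_
    obtain ⟨v, rfl⟩ := (B.toDual hnd).surjective l
    rw [LinearEquiv.conj_apply_apply, LinearEquiv.symm_apply_apply]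
    exact eq_neg_of_add_eq_zero_left (hY v w)
  have htrace : LinearMap.trace K V Y = -LinearMap.trace K V Y := by
    refine (LinearMap.trace_conj' Y (B.toDual hnd)).symm.trans ?_
    rw [hconj]
    exact (map_neg (LinearMap.trace K (Module.Dual K V)) _).trans
      (congrArg Neg.neg (LinearMap.trace_transpose' Y))
  have htwo : 2 * LinearMap.trace K V Y = 0 := by linear_combination htrace
  exact (mul_eq_zero.1 htwo).resolve_left two_ne_zero

variable {T : Type*} {t : T} {D : Tangent K t} {y : T → Module.End K V} {Y : Module.End K V}

theorem Tangent.rel_linearMap_det (hy : D.vec y Y) (hone : y t = 1) :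
    D.rel (fun x => LinearMap.det (y x)) (LinearMap.trace K V Y) := by
  let b := Module.finBasis K V
  have hM := vec_linear (LinearMap.toMatrix b b).toLinearMap hy
  have hrel := rel_det_of_eq_one hM (by simp [hone, LinearMap.toMatrix_one])
  simpa [LinearMap.trace_eq_matrix_trace K b] using hrel

theorem Tangent.exists_vec_cayley (hy : D.vec y Y) : ∃ Y', D.vec (fun x => cayley (y x)) Y' := by
  let b := Module.finBasis K V
  have hM := vec_linear (LinearMap.toMatrixAlgEquiv b).toLinearMap hy
  obtain ⟨A, hA⟩ := exists_vec_adjugate (vec_sub (vec_const 1) hM)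
  exact ⟨_, vec_linear (Matrix.toLinAlgEquiv b).toLinearMap
    (vec_bilinear (LinearMap.mul K _) (vec_add (vec_const 1) hM) hA)⟩

theorem Tangent.vec_cayley (hy : D.vec y Y) (hzero : y t = 0) (htrace : LinearMap.trace K V Y = 0) :
    D.vec (fun x => cayley (y x)) ((2 : K) • Y) := by
  obtain ⟨Y', hY'⟩ := exists_vec_cayley hy
  have hsub : D.vec (fun x => 1 - y x) (-Y) := by simpa using vec_sub (vec_const 1) hy
  have hadd : D.vec (fun x => 1 + y x) Y := by simpa using vec_add (vec_const 1) hy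
  have hdet : D.rel (fun x => LinearMap.det (1 - y x)) 0 := by
    simpa [htrace] using rel_linearMap_det hsub (by rw [hzero, sub_zero])
  have hleft := vec_bilinear (LinearMap.mul K (Module.End K V)) hY' hsub
  have hright := vec_smul hdet hadd
  simp only [LinearMap.mul_apply', cayley_mul_one_sub] at hleft
  have heq := vec_unique hleft hright
  simp only [hzero, cayley_zero, one_mul, sub_zero, mul_one, map_one, one_smul, zero_smul,
    add_zero] at heq
  rwa [two_smul, ← neg_add_eq_iff_eq_add.1 heq]

end Cayley

section LowerBound

variable {K : Type*} [Field K]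

theorem Tangent.exists_rel_prod {T : Type*} {t : T} {D : Tangent K t} {ι : Type*} (s : Finset ι)
    {f : ι → T → K} (hf : ∀ i, ∃ a, D.rel (f i) a) : ∃ a, D.rel (fun x => ∏ i ∈ s, f i x) a := by
  induction s using Finset.cons_induction with
  | empty => exact ⟨0, D.const 1⟩
  | cons i s hi ih =>
    obtain ⟨a, ha⟩ := ih
    obtain ⟨a', ha'⟩ := hf i
    simp only [Finset.prod_cons]
    exact ⟨_, D.mul ha' ha⟩

open MvPolynomial in
theorem polyTangent_vec_id [Infinite K] {n : ℕ} (j : Fin n) :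
    (polyTangent K j).vec (fun u => u) (Pi.single j 1) := by
  refine Tangent.vec_pi fun i => Tangent.vec_iff_rel.2 ⟨X i, fun u => eval_X i, ?_⟩
  rw [pderiv_X, Pi.single_apply, Pi.single_apply]
  split_ifs
  · exact map_one _
  · exact map_zero _

theorem polyTangent_rel_one_add [Infinite K] {n : ℕ} {κ : Type*}
    (c : (Fin n → K) →ₗ[K] (κ → K)) (j : Fin n) (p : κ) :
    (polyTangent K j).rel (fun u => 1 + c u p) (c (Pi.single j 1) p) := by
  have hc := Tangent.vec_linear (LinearMap.proj p ∘ₗ c) (polyTangent_vec_id j)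
  have hadd := (polyTangent K j).add ((polyTangent K j).const 1) (Tangent.vec_iff_rel.1 hc)
  rwa [zero_add] at hadd

variable {V : Type*} [AddCommGroup V] [Module K V] {B : LinearMap.BilinForm K V}
  {d : ℕ} {F F₀ : ℤ → Submodule K V}

theorem mem_adjFil_zero {Z : Module.End K V} (hF : IsSelfDualFiltration B d F) (hZ : Z ∈ skew B)
    (hZF : ∀ p : Fin (d + 2), ∀ v ∈ F (p : ℕ), Z v ∈ F (p : ℕ)) : Z ∈ adjFil B F 0 := by
  refine ⟨mem_lieGAut_of_mem_skew hZ, fun i v hv => ?_⟩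
  rw [add_zero]
  rcases lt_or_ge i 0 with hneg | hnonneg
  · rw [hF.eq_top i hneg.le]
    trivial
  rcases lt_or_ge (d : ℤ) i with hlt | hle
  · rw [hF.eq_bot i hlt, Submodule.mem_bot] at hv
    rw [hv, map_zero]
    exact zero_mem _
  · lift i to ℕ using hnonneg
    exact hZF ⟨i, by omega⟩ v hv

variable {k : ℤ → ℕ} (w : ∀ p : Fin (d + 2), Module.Basis (Fin (k (p : ℕ))) K (F (p : ℕ)))

theorem orbitMap_mem_pluckerCone (hF : F ∈ flagVariety B d F₀) {g : V ≃ₗ[K] V} (hg : g ∈ GAut B)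
    {c : Fin (d + 2) → K} (hc : ∀ p, c p ≠ 0) :
    orbitMap (fun p i => (w p i : V)) ((g : V →ₗ[K] V), c) ∈
      pluckerCone d k (flagVariety B d F₀) := by
  refine ⟨fun p => (F p).map (g : V →ₗ[K] V), ⟨hF.1.map hg, fun p => ?_⟩, fun p => ?_⟩
  · rw [LinearEquiv.finrank_map_eq, hF.2]
  · let gw := (w p).map (g.submoduleMap (F (p : ℕ)))
    exact ⟨smul_ne_zero (hc p) (ιMulti_basis_ne_zero gw), (mem_range_map_iff gw _).2 ⟨c p, rfl⟩⟩

theorem ker_coprod_orbitDeriv_scaleMap (hF : IsSelfDualFiltration B d F)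
    {C : Submodule K (Module.End K V)} (hC : C ≤ skew B) (hdisj : Disjoint C (adjFil B F 0)) :
    LinearMap.ker ((orbitDeriv (fun p i => (w p i : V)) 1 ∘ₗ C.subtype).coprod
      (scaleMap fun p i => (w p i : V))) = ⊥ := by
  rw [LinearMap.ker_eq_bot']
  rintro ⟨Z, c⟩ hZc
  rw [LinearMap.coprod_apply] at hZc
  have hrange : orbitDeriv (fun p i => (w p i : V)) 1 (Z : Module.End K V) ∈
      LinearMap.range (scaleMap fun p i => (w p i : V)) :=
    ⟨-c, by rw [map_neg]; exact (eq_neg_of_add_eq_zero_left hZc).symm⟩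
  obtain rfl : Z = 0 := Subtype.ext (Submodule.disjoint_def.1 hdisj Z Z.2
    (mem_adjFil_zero hF (hC Z.2) fun p v hv =>
      apply_mem_of_orbitDeriv_mem_range_scaleMap w hrange hv))
  rw [map_zero, zero_add] at hZc
  refine Prod.ext rfl (funext fun p => ?_)
  exact (smul_eq_zero.1 (congrFun hZc p)).resolve_right (ιMulti_basis_ne_zero (w p))

variable [FiniteDimensional K V]

theorem exists_rel_linearMap_det_one_sub [Infinite K] {n : ℕ} (Z : (Fin n → K) →ₗ[K] Module.End K V)
    (j : Fin n) : ∃ a, (polyTangent K j).rel (fun u => LinearMap.det (1 - Z u)) a :=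
  ⟨_, Tangent.rel_linearMap_det (Tangent.vec_sub (Tangent.vec_const 1)
    (Tangent.vec_linear Z (polyTangent_vec_id j))) (by rw [map_zero, sub_zero])⟩

theorem polyTangent_vec_cayley [CharZero K] {n : ℕ} (hnd : B.Nondegenerate)
    {Z : (Fin n → K) →ₗ[K] Module.End K V} (hZ : ∀ u, Z u ∈ skew B) (j : Fin n) :
    (polyTangent K j).vec (fun u => cayley (Z u)) ((2 : K) • Z (Pi.single j 1)) :=
  Tangent.vec_cayley (Tangent.vec_linear Z (polyTangent_vec_id j)) (map_zero Z)
    (trace_eq_zero_of_mem_skew hnd (hZ _))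

theorem polyTangent_vec_orbitMap [CharZero K] {n : ℕ} (hnd : B.Nondegenerate)
    {Z : (Fin n → K) →ₗ[K] Module.End K V} (hZ : ∀ u, Z u ∈ skew B) {κ : Type*} [Finite κ]
    {k : κ → ℕ} (w : ∀ p, Fin (k p) → V) (c : (Fin n → K) →ₗ[K] (κ → K)) (j : Fin n) :
    (polyTangent K j).vec (fun u => orbitMap w (cayley (Z u), 1 + c u))
      (orbitDeriv w 1 ((2 : K) • Z (Pi.single j 1)) + scaleMap w (c (Pi.single j 1))) := by
  have hcayley : (polyTangent K j).vec (fun u => cayley (Z u))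
      (((2 : K) • Z (Pi.single j 1)) ∘ₗ cayley (Z 0)) := by
    rw [map_zero, cayley_zero]
    exact polyTangent_vec_cayley hnd hZ j
  have horbit := Tangent.vec_orbitMap w hcayley (polyTangent_rel_one_add c j)
  simp only [map_zero, cayley_zero, Pi.zero_apply, add_zero] at horbit
  exact horbit

theorem finrank_le_zariskiDim_centralizer [CharZero K] (hnd : B.Nondegenerate)
    (s : Module.End K V) :
    (Module.finrank K (skew B ⊓ commutant s : Submodule K (Module.End K V)) : WithBot ℕ∞) ≤
      zariskiDim K (centralizerGAut B s) := by
  let C := skew B ⊓ commutant s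
  let L := (Module.finBasis K C).equivFun.symm
  let Z := C.subtype ∘ₗ L.toLinearMap
  have hker : LinearMap.ker ((2 : K) • Z) = ⊥ := by
    rw [LinearMap.ker_smul _ _ two_ne_zero, LinearMap.ker_eq_bot]
    exact C.subtype_injective.comp L.injective
  have hmem (u) (hu : LinearMap.det (1 - Z u) ≠ 0) : cayley (Z u) ∈ centralizerGAut B s :=
    ⟨exists_mem_GAut_eq_cayley hnd (L u).2.1 hu, commute_cayley hu (mem_commutant.1 (L u).2.2)⟩
  have hbound := le_zariskiDim (exists_rel_linearMap_det_one_sub Z)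
    (by rw [map_zero, sub_zero, map_one]; exact one_ne_zero) hmem
    ((Pi.basisFun K _).linearIndependent.map' _ hker)
    fun j => by
      rw [Function.comp_apply, Pi.basisFun_apply]
      exact polyTangent_vec_cayley hnd (fun u => (L u).2.1) j
  rwa [Fintype.card_fin] at hbound

include w in
theorem le_zariskiDim_pluckerCone [CharZero K] (hnd : B.Nondegenerate)
    (hF : F ∈ flagVariety B d F₀) {C : Submodule K (Module.End K V)} (hC : C ≤ skew B)
    (hdisj : Disjoint C (adjFil B F 0)) :
    ((Module.finrank K C + (d + 2) : ℕ) : WithBot ℕ∞) ≤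
      zariskiDim K (pluckerCone d k (flagVariety B d F₀)) := by
  let L := (Module.finBasis K (C × (Fin (d + 2) → K))).equivFun.symm
  let Z := (2 : K)⁻¹ • (C.subtype ∘ₗ LinearMap.fst K C _ ∘ₗ L.toLinearMap)
  have hZ (u) : Z u ∈ skew B := Submodule.smul_mem _ _ (hC (L u).1.2)
  let c := LinearMap.snd K C _ ∘ₗ L.toLinearMap
  have hinj := LinearMap.ker_eq_bot.1 (ker_coprod_orbitDeriv_scaleMap w hF.1 hC hdisj)
  let Ψ := (orbitDeriv (fun p i => (w p i : V)) 1 ∘ₗ C.subtype).coprod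
    (scaleMap fun p i => (w p i : V)) ∘ₗ L.toLinearMap
  have hker : LinearMap.ker Ψ = ⊥ := LinearMap.ker_eq_bot.2 (hinj.comp L.injective)
  have hη (j) : ∃ a, (polyTangent K j).rel
      (fun u => LinearMap.det (1 - Z u) * ∏ p, (1 + c u p)) a := by
    obtain ⟨a, ha⟩ := exists_rel_linearMap_det_one_sub Z j
    obtain ⟨a', ha'⟩ := Tangent.exists_rel_prod Finset.univ fun p =>
      ⟨_, polyTangent_rel_one_add c j p⟩
    exact ⟨_, (polyTangent K j).mul ha ha'⟩
  have hη0 : LinearMap.det (1 - Z 0) * ∏ p, (1 + c 0 p) ≠ 0 := by simp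
  have hmem (u) (hu : LinearMap.det (1 - Z u) * ∏ p, (1 + c u p) ≠ 0) :
      orbitMap (fun p i => (w p i : V)) (cayley (Z u), 1 + c u) ∈
        pluckerCone d k (flagVariety B d F₀) := by
    obtain ⟨g, hg, hgZ⟩ := exists_mem_GAut_eq_cayley hnd (hZ u) (left_ne_zero_of_mul hu)
    rw [← hgZ]
    exact orbitMap_mem_pluckerCone w hF hg fun p =>
      Finset.prod_ne_zero_iff.1 (right_ne_zero_of_mul hu) p (Finset.mem_univ p)
  have hbound := le_zariskiDim hη hη0 hmem ((Pi.basisFun K _).linearIndependent.map' _ hker)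
    fun j => by
      have hvec := polyTangent_vec_orbitMap hnd hZ (fun p i => (w p i : V)) c j
      have htwo : (2 : K) • Z (Pi.single j 1) = (L (Pi.single j 1)).1 :=
        smul_inv_smul₀ two_ne_zero _
      rw [htwo] at hvec
      rw [Function.comp_apply, Pi.basisFun_apply]
      exact hvec
  rwa [Fintype.card_fin, Module.finrank_prod, Module.finrank_fin_fun] at hbound

end LowerBound

section Main

variable {K : Type*} [Field K] {V : Type*} [AddCommGroup V] [Module K V]
variable {B : LinearMap.BilinForm K V} {ε : ℤˣ} {d m : ℕ} {F F₀ : ℤ → Submodule K V}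

theorem finrank_skew_eq [CharZero K] [FiniteDimensional K V] {ι : Type*} [Fintype ι]
    {b : Module.Basis ι K V} {P : ι → ℤ} (hnd : B.Nondegenerate) (hB : IsEpsilonSymm B ε)
    (hF : IsSelfDualFiltration B d F) (hP : IsAdapted b F (fun p a => p ≤ P a)) :
    2 * (Module.finrank K (skew B) : ℤ) =
      2 * Module.finrank K (skew B ⊓ adjFil B F 0 : Submodule K (Module.End K V)) +
        pairSum ε (fun a a' => if d < P a + P a' then 1 else 0) := by
  have hall := two_mul_finrank_skewOn_eq_pairSum hnd hB b (fun _ _ => True) (fun _ _ h => h)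
  have hstab := two_mul_finrank_skewOn_eq_pairSum hnd hB b (fun a a' => P a + P a' ≤ (d : ℤ) - 0)
    (fun a a' h => by omega)
  have hskew : skewOn B b (fun _ _ => True) = skew B :=
    le_antisymm (fun X hX => hX.1) fun X hX => ⟨hX, fun a a' h => absurd trivial h⟩
  rw [hskew] at hall
  rw [← skew_inf_adjFil_eq_skewOn hB hF hP] at hstab
  rw [hall, hstab, ← pairSum_add]
  congr 1
  funext a a'
  split_ifs <;> omega

theorem exists_disjoint_finrank_add_eq {E : Type*} [AddCommGroup E] [Module K E]
    [FiniteDimensional K E] (S N : Submodule K E) :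
    ∃ C ≤ S, Disjoint C N ∧
      Module.finrank K C + Module.finrank K (S ⊓ N : Submodule K E) = Module.finrank K S := by
  obtain ⟨C, hC⟩ := Submodule.exists_isCompl (S ⊓ N)
  have hdisj : Disjoint (S ⊓ C) (S ⊓ N) := hC.disjoint.symm.mono_left inf_le_right
  refine ⟨S ⊓ C, inf_le_left, fun X hXC hXN => hdisj hXC (le_inf (hXC.trans inf_le_left) hXN), ?_⟩
  have hsup : S ⊓ C ⊔ S ⊓ N = S := by
    rw [sup_comm, inf_comm S C, ← sup_inf_assoc_of_le C inf_le_left, hC.sup_eq_top, top_inf_eq]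
  rw [← Submodule.finrank_sup_add_finrank_inf_eq, hsup, hdisj.eq_bot, finrank_bot, add_zero]

theorem codimAtLeast_empty (e : ℕ) : CodimAtLeast B d F₀ ∅ e := by
  have hcone : pluckerCone d (fun p => Module.finrank K (F₀ p))
      (∅ : Set (ℤ → Submodule K V)) = ∅ :=
    Set.eq_empty_of_forall_notMem fun _ ⟨_, hF, _⟩ => hF
  rw [CodimAtLeast, hcone, zariskiDim_empty, WithBot.bot_add]
  exact bot_le

theorem nontrivial_of_topSum_lt {x y : ℝ}
    (hsum : topSum d (hodge B F₀) x + topSum d (hodge B F₀) y <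
      ∑ p ∈ Finset.Icc (1 : ℤ) d, (p : ℝ) * (hodge B F₀ p : ℝ)) : Nontrivial V := by
  by_contra hV
  rw [not_nontrivial_iff_subsingleton] at hV
  have hhodge (p : ℤ) : hodge B F₀ p = 0 := Module.finrank_zero_of_subsingleton
  simp [topSum, hhodge] at hsum

theorem codimAtLeast_of_forall_isTransporter [CharZero K] [FiniteDimensional K V]
    {f : ℕ → Submodule K V} (hnd : B.Nondegenerate) (hB : IsEpsilonSymm B ε)
    {φ : V ≃ₗ[K] V} (hφ : φ ∈ GAut B) (hF₀ : IsSelfDualFiltration B d F₀)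
    {s : Module.End K V} (hs : IsSemisimplePart (φ : V →ₗ[K] V) s)
    {z : ℕ} (hz : zariskiDim K (centralizerGAut B s) = (z : WithBot ℕ∞)) {e : ℕ}
    (hnum : z + e ≤ ∑ p ∈ Finset.Icc (1 : ℤ) d, hodge B F₀ p)
    (hsum : topSum d (hodge B F₀) ((z : ℝ) + e) +
        topSum d (hodge B F₀) ((hodge B F₀ 0 : ℝ) / 2 + z + e) <
      ∑ p ∈ Finset.Icc (1 : ℤ) d, (p : ℝ) * (hodge B F₀ p : ℝ))
    (hF : F ∈ flagVariety B d F₀) (hf : IsSelfDualFlag B m f)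
    (hweight : ∀ k, k ≤ 2 * m → Nontrivial (Gr f k) → weight d (inducedFil F f k) = (d : ℚ) / 2)
    {S : Set (ℤ → Submodule K V)}
    (hS : ∀ F' ∈ S, ∃ g, IsTransporter B φ m f g ∧ ∀ p, (F p).map (g : V →ₗ[K] V) = F' p) :
    CodimAtLeast B d F₀ S e := by
  have := nontrivial_of_topSum_lt hsum
  obtain ⟨b, P, J, hP, hJ⟩ := exists_adapted_basis hF.1.antitone (hF.1.eq_top 0 le_rfl)
    hF.1.eq_bot hf.monotone hf.eq_bot hf.eq_top
  have hbalance (k : ℕ) : ∑ a with J a = k, ((d : ℤ) - 2 * P a) = 0 := by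
    rcases le_or_gt k (2 * m) with hk | hk
    · exact sum_sub_two_mul_eq_zero_of_weight hF.1 hf.monotone hP hJ (hweight k hk)
    · exact Finset.sum_eq_zero fun a ha => by
        have := hf.adapted_le hJ a
        have := (Finset.mem_filter.1 ha).2
        omega
  rw [← hodge_congr hnd hB hF.1 hF₀ hF.2] at hnum hsum
  have hpairs := pairSum_neg_add_le hnd hB hF.1 hf hP hJ hbalance hnum hsum
  have hskew := finrank_skew_eq hnd hB hF.1 hP
  have hcentralizer :
      Module.finrank K (skew B ⊓ commutant s : Submodule K (Module.End K V)) ≤ z := by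
    exact_mod_cast (finrank_le_zariskiDim_centralizer hnd s).trans_eq hz
  have hnonneg : 0 ≤
      pairSum ε fun a a' => if 2 * m < J a + J a' ∧ (d : ℤ) < P a + P a' then 1 else 0 :=
    pairSum_nonneg fun a a' => by split_ifs <;> simp
  obtain ⟨C, hC, hdisj, hdim⟩ := exists_disjoint_finrank_add_eq (skew B) (adjFil B F 0)
  obtain ⟨r, hr⟩ : ∃ r, r + e = Module.finrank K C + (d + 2) :=
    ⟨_, Nat.sub_add_cancel (by omega)⟩
  let w (p : Fin (d + 2)) : Module.Basis (Fin (Module.finrank K (F₀ (p : ℕ)))) K (F (p : ℕ)) :=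
    Module.finBasisOfFinrankEq K _ (hF.2 _)
  have hlower := le_zariskiDim_pluckerCone (k := fun p => Module.finrank K (F₀ p)) w hnd hF hC hdisj
  have hupper := zariskiDim_orbit_le (m := m) hnd hB hφ hs hF.1 hP hJ w (r := r)
    (by rw [Fintype.card_fin]; omega)
  have hcone := pluckerCone_subset_range (k := fun p => Module.finrank K (F₀ p)) w hS
  calc _ ≤ (r : WithBot ℕ∞) + e := add_le_add_left ((zariskiDim_mono hcone).trans hupper) _
    _ = (Module.finrank K C + (d + 2) : ℕ) := by rw [← Nat.cast_add, hr]
    _ ≤ _ := hlower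

theorem codimAtLeast_bad [CharZero K] [FiniteDimensional K V] (hnd : B.Nondegenerate)
    (hB : IsEpsilonSymm B ε) {φ : V ≃ₗ[K] V} (hφ : φ ∈ GAut B)
    {A : Fin (m + 1) → Type*} [∀ j, AddCommGroup (A j)] [∀ j, Module K (A j)]
    {FA : ∀ j, ℤ → Submodule K (A j)} {φA : ∀ j, A j ≃ₗ[K] A j}
    {BA : LinearMap.BilinForm K (A (Fin.last m))} (hF₀ : IsSelfDualFiltration B d F₀)
    {s : Module.End K V} (hs : IsSemisimplePart (φ : V →ₗ[K] V) s)
    {z : ℕ} (hz : zariskiDim K (centralizerGAut B s) = (z : WithBot ℕ∞)) {e : ℕ}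
    (hnum : z + e ≤ ∑ p ∈ Finset.Icc (1 : ℤ) d, hodge B F₀ p)
    (hsum : topSum d (hodge B F₀) ((z : ℝ) + e) +
        topSum d (hodge B F₀) ((hodge B F₀ 0 : ℝ) / 2 + z + e) <
      ∑ p ∈ Finset.Icc (1 : ℤ) d, (p : ℝ) * (hodge B F₀ p : ℝ)) :
    CodimAtLeast B d F₀ {F | F ∈ flagVariety B d F₀ ∧ IsBad B φ d m A FA φA BA F} e := by
  rcases Set.eq_empty_or_nonempty {F | F ∈ flagVariety B d F₀ ∧ IsBad B φ d m A FA φA BA F}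
    with hempty | ⟨F, hF, hbad⟩
  · rw [hempty]
    exact codimAtLeast_empty e
  · obtain ⟨f, hf, hweight, htransporter⟩ :=
      hbad.exists_flag_forall_exists_isTransporter hnd hB hF.1
    exact codimAtLeast_of_forall_isTransporter hnd hB hφ hF₀ hs hz hnum hsum hF hf hweight
      fun F' hF' => htransporter F' hF'.1.1 hF'.2

end Main

end BadFil

end

theorem mainTheorem7 {K : Type*} [Field K] [CharZero K]
    {V : Type*} [AddCommGroup V] [Module K V] [FiniteDimensional K V]
    (B : LinearMap.BilinForm K V) (hB : B.Nondegenerate) (hB' : B.IsSymm ∨ B.IsAlt)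
    (φ : V ≃ₗ[K] V) (hφ : φ ∈ BadFil.GAut B)
    -- the fixed filtered modules with automorphism, and the form on the last one
    (m : ℕ) (A : Fin (m + 1) → Type*) [∀ j, AddCommGroup (A j)] [∀ j, Module K (A j)]
    (FA : ∀ j, ℤ → Submodule K (A j)) (hFA : ∀ j, Antitone (FA j))
    (φA : ∀ j, A j ≃ₗ[K] A j) (BA : LinearMap.BilinForm K (A (Fin.last m)))
    -- a self-dual filtration, which fixes the dimension data
    (d : ℕ) (F₀ : ℤ → Submodule K V) (hF₀ : BadFil.IsSelfDualFiltration B d F₀)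
    -- the dimension of the centralizer of the semisimple part of `φ`
    (s : Module.End K V) (hs : BadFil.IsSemisimplePart (φ : V →ₗ[K] V) s)
    (z : ℕ) (hz : BadFil.zariskiDim K (BadFil.centralizerGAut B s) = (z : WithBot ℕ∞))
    (e : ℕ) (he : 0 < e)
    (hnum : z + e ≤ ∑ p ∈ Finset.Icc (1 : ℤ) d, BadFil.hodge B F₀ p)
    (hsum : BadFil.topSum d (BadFil.hodge B F₀) ((z : ℝ) + e) +
        BadFil.topSum d (BadFil.hodge B F₀) ((BadFil.hodge B F₀ 0 : ℝ) / 2 + z + e) <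
      ∑ p ∈ Finset.Icc (1 : ℤ) d, (p : ℝ) * (BadFil.hodge B F₀ p : ℝ)) :
    BadFil.CodimAtLeast B d F₀
      {F | F ∈ BadFil.flagVariety B d F₀ ∧ BadFil.IsBad B φ d m A FA φA BA F} e := by
  rcases hB' with hsymm | halt
  · exact BadFil.codimAtLeast_bad hB (BadFil.isEpsilonSymm_one hsymm) hφ hF₀ hs hz hnum hsum
  · exact BadFil.codimAtLeast_bad hB (BadFil.isEpsilonSymm_neg_one halt) hφ hF₀ hs hz hnum hsum
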